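/- **Setting.** Let $K\ge 2$, $\mathcal T=\{0,\dots,K-1\}$, and fix $t\in\mathcal T$. Let $(Y,T,X)$ consist of an outcome, a treatment in $\mathcal T$ and covariates, with potential outcomes $Y^{(k)}$, $Y=Y^{(T)}$ and $R^{(k)}=1\{T=k\}$. Assume unconfoundedness ($R^{(k)}$ and $Y^{(k)}$ are conditionally independent given $X$ for all $k$) and overlap ($P(T=k\mid X)>0$ a.s. for all $k$). Let $(Y_i,T_i,X_i)$, $i=1,\dots,n$ ($n\ge1$), be i.i.d. copies of $(Y,T,X)$ and let $\tilde{\mathrm E}$ denote the sample average. Let $f=(f_0,\dots,f_p)^{\mathrm T}$ be known measurable functions of $X$ with $f_0\equiv 1$, and let $\psi:\mathbb R\to\mathbb R$ be differentiable, $\psi_2=\psi'$, $\Psi(u)=\int_0^u\psi$. For $(p+1)\times(K-1)$ matrices $\gamma=(\gamma_k)_{k\ne t}$ and $\alpha=(\alpha^{(k)})_{k\neq t}$ put $\gamma_t=0$, $$\pi(k,X;\gamma)=\frac{e^{\gamma_k^{\mathrm T}f(X)}}{\sum_{l\in\mathcal T}e^{\gamma_l^{\mathrm T}f(X)}},\qquad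 \omega(k,X;\gamma)=\frac{\pi(k,X;\gamma)}{\pi(t,X;\gamma)}=e^{\gamma_k^{\mathrm T}f(X)},$$ $$\ell_{\rm CAL}(\gamma)=\tilde{\mathrm E}\sum_{k\ne t}\{R^{(t)}e^{\gamma_k^{\mathrm T}f(X)}-R^{(k)}\gamma_k^{\mathrm T}f(X)\},$$ $$\ell_{\rm WL}(\alpha;\gamma)=\tilde{\mathrm E}\sum_{k\ne t}R^{(t)}e^{\gamma_k^{\mathrm T}f(X)}[-Y\alpha^{(k)\mathrm T}f(X)+\Psi\{\alpha^{(k)\mathrm T}f(X)\}],$$ $$\varphi(\alpha,\gamma)=R^{(t)}Y+\sum_{k\ne t}\Big[R^{(t)}Y\omega(k,X;\gamma)-\{R^{(t)}\omega(k,X;\gamma)-R^{(k)}\}\psi\{\alpha^{(k)\mathrm T}f(X)\}\Big].$$ For a matrix $b$ with rows $b_{j\cdot}$, $j=0,\dots,p$, let $\|b\|_{2,1}=\sum_{j=0}^p\|b_{j\cdot}\|_2$ and $S(b)=\{0\}\cup\{j\ge 1:b_{j\cdot}\ne0\}$. Let $\bar\gamma$ be a minimizer of $\mathrm E\,\ell_{\rm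 CAL}(\gamma)$, $\bar\alpha$ a minimizer of $\mathrm E\,\ell_{\rm WL}(\alpha;\bar\gamma)$, $S_\gamma=S(\bar\gamma)$ and $S_\alpha=S(\bar\alpha)$. Let $0<\epsilon<1$, $\rho=\sqrt{(K-1)/n+\log\{(p+1)/\epsilon\}/n}$, $\tilde\lambda_1=4\sqrt2B_0^2B_1\rho$ and $\tilde\lambda_2=\max\{\tilde\lambda_1,\sqrt3B_0(B_1-1)\sigma_0\rho\}$. Let $\hat\gamma$ minimize $\ell_{\rm CAL}(\gamma)+A_1\tilde\lambda_1\sum_{j=1}^p\|\gamma_{j\cdot}\|_2$ and let $\hat\alpha$ minimize $\ell_{\rm WL}(\alpha;\hat\gamma)+A_2\tilde\lambda_2\sum_{j=1}^p\|\alpha_{j\cdot}\|_2$ ($\hat\gamma$ and $\hat\alpha$ are arbitrary at samples where no minimizer exists). Put $\hat\varphi_{tc}=\varphi(\hat\alpha,\hat\gamma)-\tilde{\mathrm E}\varphi(\hat\alpha,\hat\gamma)$ and $\bar\varphi_{tc}=\varphi(\bar\alpha,\bar\gamma)-\tilde{\mathrm E}\varphi(\bar\alpha,\bar\gamma)$,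 so that $\hat V_t=\tilde{\mathrm E}(\hat\varphi_{tc}^2)$. For $r\ge0$ let $$\Lambda(r)=\sup_{0\le j\le p,\ \|\alpha-\bar\alpha\|_{2,1}\le r}\Big\|\Big(\mathrm E\big[\psi_2\{\alpha^{(k)\mathrm T}f(X)\}\{R^{(t)}\omega(k,X;\bar\gamma)-R^{(k)}\}f_j(X)\big]\Big)_{k\ne t}\Big\|_2 .$$ **Derived constants.** $\xi_{1,1}=(\xi_1+1)(A_1-1)$, $\nu_{1,1}=\nu_1(1-\eta_{1,1})^{1/2}(1-\eta_{1,2})^{1/2}$, $M_1=\xi_{1,1}^2\nu_{1,1}^{-2}$, $\eta_{1,3}=(A_1-1)^{-1}M_1\eta_1B_0$, $M_{1,1}=3\sigma_0^2(A_1-1)^{-2}M_1^2\eta_1+2\sigma_0^2e^{\eta_{1,3}}M_1$, $\xi_{2,2}=(\xi_2+1)(A_2-1)$, $\xi_{2,1}=1-2A_2/\xi_{2,2}$, $\xi_{2,3}=\xi_{2,1}(1-\eta_{2,2})^{1/2}C_2^{1/2}$, $\nu_{2,2}=\nu_2(1-\eta_2)^{1/2}(1-\eta_{2,1})^{1/2}C_2^{1/2}$.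 **Assumption 1.** (i) $\max_{1\le j\le p}|f_j(X)|\le B_0$ a.s., $B_0\ge1$. (ii) $\pi(t,X;\bar\gamma)^{-1}\le B_1$ a.s., $B_1>1$. (iii) Compatibility with $(S_\gamma,\nu_1,\xi_1)$, $\nu_1>0$, $\xi_1>1$, where compatibility with $(S,\nu,\xi)$ means: every $b$ with $\sum_{j\notin S}\|b_{j\cdot}\|_2\le\xi\sum_{j\in S}\|b_{j\cdot}\|_2$ satisfies $\nu^2(\sum_{j\in S}\|b_{j\cdot}\|_2)^2\le|S|\sum_{k\ne t}b_k^{\mathrm T}\mathrm E\{R^{(t)}\omega(k,X;\bar\gamma)f(X)f(X)^{\mathrm T}\}b_k$. (iv) $(\xi_1+1)^2\nu_1^{-2}|S_\gamma|\tilde\lambda_1\le\eta_{1,1}$ and $B_0(\xi_1+1)^2(A_1-1)(1-\eta_{1,1})^{-1}\nu_1^{-2}|S_\gamma|\tilde\lambda_1\le\eta_{1,2}$ with $0<\eta_{1,1},\eta_{1,2}<1$. Moreover $\eta_1$ is a constant with $|S_\gamma|\tilde\lambda_1\le\eta_1$. **Assumption 2.** (i) For every $k\ne t$, $W_k=Y^{(t)}-\psi\{\bar\alpha^{(k)\mathrm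 T}f(X)\}$ is sub-gaussian with parameter $\sigma_0^2$ given $X$, that is, $\mathrm E\{\exp(W_k^2/\sigma_0^2)\mid X\}\le2$ a.s., $\sigma_0>0$. (ii) Compatibility with $(S_\alpha,\nu_2,\xi_2)$, $\nu_2>0$, $\xi_2>1$. (iii)–(iv) $C_2\le\psi_2\{\bar\alpha^{(k)\mathrm T}f(X)\}\le C_1$ a.s. for all $k\ne t$, $C_1,C_2>0$. (v) $\psi_2(h)\le\psi_2(h')e^{C_3|h-h'|}$ for all $h,h'\in\mathbb R$, $C_3\ge0$. (vi) (a) $(1+\xi_2^2)\nu_2^{-2}|S_\alpha|\tilde\lambda_2\le\eta_2$, (b) $e^{\eta_{1,3}}B_0C_3C_2^{-1}\nu_2^{-2}(\xi_2+1)^2(A_2-1)(1-\eta_2)^{-1}|S_\alpha|\tilde\lambda_2\le\eta_{2,1}$, (c) $e^{3\eta_{1,3}}B_0C_3C_2^{-1}\xi_{2,1}^{-2}(A_2-1)^{-1}M_{1,1}|S_\gamma|\tilde\lambda_1\le\eta_{2,2}$, with $0<\eta_2<1$ and $0\le\eta_{2,1},\eta_{2,2}<1$. **Theorem.** Suppose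 Assumptions 1 and 2 hold, $A_1>(\xi_1+1)/(\xi_1-1)$, $A_2>(\xi_2+1)/(\xi_2-1)$ and $[(K-1)+\log\{(p+1)/\epsilon\}]/n\le1$. Let $M_3$ be a constant such that $$e^{4\eta_{1,3}}\xi_{2,3}^{-2}M_{1,1}|S_\gamma|\tilde\lambda_1^2+e^{2\eta_{1,3}}\xi_{2,2}^2\nu_{2,2}^{-2}|S_\alpha|\tilde\lambda_2^2\le e^{\eta_{1,3}}M_3\big(|S_\gamma|\tilde\lambda_1\tilde\lambda_2+|S_\alpha|\tilde\lambda_2^2\big),$$ and put $\eta_3=(A_2-1)^{-1}M_3(|S_\gamma|\tilde\lambda_1+|S_\alpha|\tilde\lambda_2)$. Then, with probability at least $1-9\epsilon$, $$|\tilde{\mathrm E}(\hat\varphi_{tc}^2-\bar\varphi_{tc}^2)|\le2M_{3,4}^{1/2}\{\tilde{\mathrm E}(\bar\varphi_{tc}^2)\}^{1/2}\{(K-1)+\Lambda^2(\eta_3)\}^{1/2}(|S_\gamma|\tilde\lambda_1+|S_\alpha|\tilde\lambda_2)+M_{3,4}\{(K-1)+\Lambda^2(\eta_3)\}(|S_\gamma|\tilde\lambda_1+|S_\alpha|\tilde\lambda_2)^2,$$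 where $M_{3,4}>0$ depends only on $(B_0,B_1,A_1,\xi_1,\nu_1,\eta_1)$, $(\sigma_0,A_2,\xi_2,\nu_2,\eta_2)$ and $(C_1,C_2,C_3,\eta_{2,1},\eta_{2,2})$. -/

import Mathlib

open MeasureTheory ProbabilityTheory

namespace MultiTreat

noncomputable section

/-- An observation `(Y, T, X)`: outcome, treatment in `{0, …, K-1}`, covariates. -/
abbrev Obs (K : ℕ) (𝒳 : Type*) := ℝ × Fin K × 𝒳

/-- `(p+1) × (K-1)` coefficient matrices, with rows `j = 0, …, p` and columns `k ≠ t`.  They are used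
for `γ = (γ_k : k ≠ t)` (with `γ_t ≡ 0`) and for `α_t^# = (α_t^{(k)} : k ≠ t)`. -/
abbrev Coef (p K : ℕ) (t : Fin K) := Fin (p + 1) → {k : Fin K // k ≠ t} → ℝ

/-! ### The causal model -/

/-- The observed data: `Y = Y^{(T)}` (consistency). -/
def observed {Ω₀ 𝒳 : Type*} {K : ℕ} (Ypot : Fin K → Ω₀ → ℝ) (T : Ω₀ → Fin K) (X : Ω₀ → 𝒳) :
    Ω₀ → Obs K 𝒳 :=
  fun ω => (Ypot (T ω) ω, T ω, X ω)

/-- Measurability, unconfoundedness and overlap. -/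
structure CausalAssumptions {Ω₀ 𝒳 : Type*} [MeasurableSpace Ω₀] [mX : MeasurableSpace 𝒳] {K : ℕ}
    (P : Measure Ω₀) (Ypot : Fin K → Ω₀ → ℝ) (T : Ω₀ → Fin K) (X : Ω₀ → 𝒳) : Prop where
  measurable_Ypot : ∀ k, Measurable (Ypot k)
  measurable_T : Measurable T
  measurable_X : Measurable X
  /-- `R^{(k)} = 1{T = k}` and `Y^{(k)}` are conditionally independent given `X`. -/
  unconfounded : ∀ (k : Fin K) (B : Set ℝ), MeasurableSet B →
    P[({ω | T ω = k} ∩ {ω | Ypot k ω ∈ B}).indicator (fun _ => (1 : ℝ)) | mX.comap X] =ᵐ[P]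
      P[({ω | T ω = k}).indicator (fun _ => (1 : ℝ)) | mX.comap X] *
        P[({ω | Ypot k ω ∈ B}).indicator (fun _ => (1 : ℝ)) | mX.comap X]
  /-- `π^*(k, X) = P(T = k | X) > 0` almost surely. -/
  overlap : ∀ k : Fin K, ∀ᵐ ω ∂P,
    0 < (P[({ω | T ω = k}).indicator (fun _ => (1 : ℝ)) | mX.comap X]) ω

/-- `W` is sub-gaussian with parameter `σ²` given `X`, without being centered:
`E[exp(W²/σ²) | X] ≤ 2` almost surely. -/
def SubGaussianGiven {Ω₀ 𝒳 : Type*} [MeasurableSpace Ω₀] [mX : MeasurableSpace 𝒳]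
    (P : Measure Ω₀) (X : Ω₀ → 𝒳) (W : Ω₀ → ℝ) (σ : ℝ) : Prop :=
  Integrable (fun ω => Real.exp (W ω ^ 2 / σ ^ 2)) P ∧
    ∀ᵐ ω ∂P, (P[fun ω => Real.exp (W ω ^ 2 / σ ^ 2) | mX.comap X]) ω ≤ 2

/-! ### Matrices of coefficients -/

section Matrices

variable {p K : ℕ} {t : Fin K}

/-- `‖b_{j·}‖₂`. -/
def rowNorm (b : Coef p K t) (j : Fin (p + 1)) : ℝ := √(∑ k, b j k ^ 2)

/-- `‖b‖_{2,1} = ∑_{j=0}^p ‖b_{j·}‖₂`. -/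
def norm21 (b : Coef p K t) : ℝ := ∑ j, rowNorm b j

/-- The group Lasso penalty `∑_{j=1}^p ‖b_{j·}‖₂`; the intercepts are not penalized. -/
def penalty (b : Coef p K t) : ℝ := ∑ j : Fin p, rowNorm b j.succ

open Classical in
/-- `{0} ∪ {j : b_{j·} ≠ 0}`. -/
def support (b : Coef p K t) : Finset (Fin (p + 1)) := {j | j = 0 ∨ b j ≠ 0}

end Matrices

/-! ### Working models, losses and estimating functions -/

section Models

variable {p K n : ℕ} {t : Fin K} {𝒳 : Type*}

/-- The treatment indicator `R^{(k)} = 1{T = k}`. -/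
def R (k : Fin K) (o : Obs K 𝒳) : ℝ := if o.2.1 = k then 1 else 0

/-- The sample average `Ẽ`. -/
def sampleMean (o : Fin n → Obs K 𝒳) (g : Obs K 𝒳 → ℝ) : ℝ := (∑ i, g (o i)) / n

/-- `b_kᵀ f(x)` for `k ≠ t`. -/
def lin (f : Fin (p + 1) → 𝒳 → ℝ) (b : Coef p K t) (k : {k : Fin K // k ≠ t}) (x : 𝒳) : ℝ :=
  ∑ j, b j k * f j x

/-- `γ_kᵀ f(x)` for all `k`, where `γ_t = 0`. -/
def linAll (f : Fin (p + 1) → 𝒳 → ℝ) (γ : Coef p K t) (k : Fin K) (x : 𝒳) : ℝ :=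
  if h : k ≠ t then lin f γ ⟨k, h⟩ x else 0

/-- The multi-class logistic propensity score `π(k, x; γ)`, where `γ_t = 0`. -/
def propScore (f : Fin (p + 1) → 𝒳 → ℝ) (γ : Coef p K t) (k : Fin K) (x : 𝒳) : ℝ :=
  Real.exp (linAll f γ k x) / ∑ l, Real.exp (linAll f γ l x)

/-- `ω(k, x; γ) = π(k, x; γ) / π(t, x; γ)`. -/
def oddsRatio (f : Fin (p + 1) → 𝒳 → ℝ) (γ : Coef p K t) (k : Fin K) (x : 𝒳) : ℝ :=
  propScore f γ k x / propScore f γ t x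

/-- The calibration loss of one observation, under `γ_t = 0`. -/
def calLoss (f : Fin (p + 1) → 𝒳 → ℝ) (γ : Coef p K t) (o : Obs K 𝒳) : ℝ :=
  ∑ k : {k : Fin K // k ≠ t},
    (R t o * Real.exp (lin f γ k o.2.2) - R k.1 o * lin f γ k o.2.2)

/-- The weighted likelihood loss of one observation, summed over `k ≠ t`, under `γ_t = 0`;
here `Ψ(u) = ∫₀ᵘ ψ`. -/
def wlLoss (ψ : ℝ → ℝ) (f : Fin (p + 1) → 𝒳 → ℝ) (γ α : Coef p K t) (o : Obs K 𝒳) : ℝ :=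
  ∑ k : {k : Fin K // k ≠ t}, R t o * Real.exp (lin f γ k o.2.2) *
    (-(o.1 * lin f α k o.2.2) + ∫ u in (0 : ℝ)..(lin f α k o.2.2), ψ u)

/-- `γ` minimizes the calibration loss plus `lam` times the group Lasso penalty. -/
def IsRCAL (f : Fin (p + 1) → 𝒳 → ℝ) (lam : ℝ) (o : Fin n → Obs K 𝒳) (γ : Coef p K t) : Prop :=
  ∀ γ' : Coef p K t, sampleMean o (calLoss f γ) + lam * penalty γ ≤
    sampleMean o (calLoss f γ') + lam * penalty γ'

/-- `α` minimizes the weighted likelihood loss (with weights from `γ`) plus `lam` times the group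
Lasso penalty. -/
def IsRWL (ψ : ℝ → ℝ) (f : Fin (p + 1) → 𝒳 → ℝ) (lam : ℝ) (o : Fin n → Obs K 𝒳)
    (γ α : Coef p K t) : Prop :=
  ∀ α' : Coef p K t, sampleMean o (wlLoss ψ f γ α) + lam * penalty α ≤
    sampleMean o (wlLoss ψ f γ α') + lam * penalty α'

/-- The augmented IPW function `φ_t(Y, T, X; α^#, γ)`, where `m(t, X; α) = ψ(αᵀ f(X))`. -/
def phi (ψ : ℝ → ℝ) (f : Fin (p + 1) → 𝒳 → ℝ) (α γ : Coef p K t) (o : Obs K 𝒳) : ℝ :=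
  R t o * o.1 + ∑ k : {k : Fin K // k ≠ t},
    (R t o * o.1 * oddsRatio f γ k o.2.2 -
      (R t o * oddsRatio f γ k o.2.2 - R k.1 o) * ψ (lin f α k o.2.2))

/-- `φ_t(·; α^#, γ)` centered at its sample average `μ_t(m^#, π)`. -/
def phiCentered (ψ : ℝ → ℝ) (f : Fin (p + 1) → 𝒳 → ℝ) (o : Fin n → Obs K 𝒳) (α γ : Coef p K t)
    (z : Obs K 𝒳) : ℝ :=
  phi ψ f α γ z - sampleMean o (phi ψ f α γ)

variable {Ω₀ : Type*} [MeasurableSpace Ω₀]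

/-- `γ` minimizes the expected calibration loss. -/
def IsTargetCAL (P : Measure Ω₀) (Z : Ω₀ → Obs K 𝒳) (f : Fin (p + 1) → 𝒳 → ℝ)
    (γ : Coef p K t) : Prop :=
  ∀ γ' : Coef p K t, ∫ ω, calLoss f γ (Z ω) ∂P ≤ ∫ ω, calLoss f γ' (Z ω) ∂P

/-- `α` minimizes the expected weighted likelihood loss with weights from `γ`. -/
def IsTargetWL (P : Measure Ω₀) (Z : Ω₀ → Obs K 𝒳) (ψ : ℝ → ℝ) (f : Fin (p + 1) → 𝒳 → ℝ)
    (γ α : Coef p K t) : Prop :=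
  ∀ α' : Coef p K t, ∫ ω, wlLoss ψ f γ α (Z ω) ∂P ≤ ∫ ω, wlLoss ψ f γ α' (Z ω) ∂P

/-- The theoretical compatibility condition with subset `S` and constants `ν`, `ξ`. -/
def Compatibility (P : Measure Ω₀) (Z : Ω₀ → Obs K 𝒳) (f : Fin (p + 1) → 𝒳 → ℝ)
    (γ : Coef p K t) (S : Finset (Fin (p + 1))) (ν ξ : ℝ) : Prop :=
  ∀ b : Coef p K t, ∑ j ∈ Sᶜ, rowNorm b j ≤ ξ * ∑ j ∈ S, rowNorm b j →
    ν ^ 2 * (∑ j ∈ S, rowNorm b j) ^ 2 ≤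
      (S.card : ℝ) * ∑ k : {k : Fin K // k ≠ t}, ∑ i, ∑ j, b i k *
        (∫ ω, R t (Z ω) * oddsRatio f γ k (Z ω).2.2 * (f i (Z ω).2.2 * f j (Z ω).2.2) ∂P) * b j k

/-- `Λ(r)`, the supremum over `j` and over `‖α^# - ᾱ^#‖_{2,1} ≤ r` of
`‖E[diag{ψ₂(α^{(k)ᵀ} f(X))} g(X; γ) f_j(X)]‖₂`, where
`g_k = R^{(t)} π(k, X; γ) / π(t, X; γ) - R^{(k)}`. -/
def Lambda (P : Measure Ω₀) (Z : Ω₀ → Obs K 𝒳) (ψ : ℝ → ℝ) (f : Fin (p + 1) → 𝒳 → ℝ)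
    (γ αbar : Coef p K t) (r : ℝ) : ℝ :=
  sSup {v | ∃ (j : Fin (p + 1)) (α : Coef p K t), norm21 (α - αbar) ≤ r ∧
    v = √(∑ k : {k : Fin K // k ≠ t},
      (∫ ω, deriv ψ (lin f α k (Z ω).2.2) *
        (R t (Z ω) * oddsRatio f γ k (Z ω).2.2 - R k.1 (Z ω)) * f j (Z ω).2.2 ∂P) ^ 2)}

end Models

/-! ### Constants -/

/-- The constants on which the constant of the variance bound may depend. -/
structure Constants where
  (B₀ B₁ A₁ ξ₁ ν₁ η₁ σ₀ A₂ ξ₂ ν₂ η₂ C₁ C₂ C₃ η₂₁ η₂₂ : ℝ)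

namespace Constants

variable (c : Constants) (η₁₁ η₁₂ : ℝ)

def ξ₁₁ : ℝ := (c.ξ₁ + 1) * (c.A₁ - 1)
def ν₁₁ : ℝ := c.ν₁ * √(1 - η₁₁) * √(1 - η₁₂)
def M₁ : ℝ := c.ξ₁₁ ^ 2 / c.ν₁₁ η₁₁ η₁₂ ^ 2
def η₁₃ : ℝ := (c.A₁ - 1)⁻¹ * c.M₁ η₁₁ η₁₂ * c.η₁ * c.B₀
def M₁₁ : ℝ :=
  3 * c.σ₀ ^ 2 * (c.M₁ η₁₁ η₁₂ / (c.A₁ - 1)) ^ 2 * c.η₁ +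
    2 * c.σ₀ ^ 2 * Real.exp (c.η₁₃ η₁₁ η₁₂) * c.M₁ η₁₁ η₁₂
def ξ₂₁ : ℝ := 1 - 2 * c.A₂ / ((c.ξ₂ + 1) * (c.A₂ - 1))
def ξ₂₂ : ℝ := (c.ξ₂ + 1) * (c.A₂ - 1)
def ξ₂₃ : ℝ := c.ξ₂₁ * √(1 - c.η₂₂) * √c.C₂
def ν₂₁ : ℝ := c.ν₂ * √(1 - c.η₂)
def ν₂₂ : ℝ := c.ν₂₁ * √(1 - c.η₂₁) * √c.C₂

/-- `√{(K-1)/n + log((p+1)/ε)/n}`. -/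
def rate (K p n : ℕ) (ε : ℝ) : ℝ := √(((K : ℝ) - 1) / n + Real.log (((p : ℝ) + 1) / ε) / n)

/-- `λ̃₁`. -/
def lam₁ (K p n : ℕ) (ε : ℝ) : ℝ := 4 * √2 * c.B₀ ^ 2 * c.B₁ * rate K p n ε

/-- `λ̃₂`. -/
def lam₂ (K p n : ℕ) (ε : ℝ) : ℝ :=
  max (c.lam₁ K p n ε) (√3 * c.B₀ * (c.B₁ - 1) * c.σ₀ * rate K p n ε)

end Constants

/-! ### Assumptions -/

section Assumptions

variable {p K : ℕ} {t : Fin K} {𝒳 Ω₀ : Type*} [MeasurableSpace Ω₀]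

/-- The assumptions for the propensity score estimation. -/
structure AssumptionPS (c : Constants) (η₁₁ η₁₂ : ℝ) (n : ℕ) (ε : ℝ) (P : Measure Ω₀)
    (Z : Ω₀ → Obs K 𝒳) (f : Fin (p + 1) → 𝒳 → ℝ) (γbar : Coef p K t) : Prop where
  one_le_B₀ : 1 ≤ c.B₀
  one_lt_B₁ : 1 < c.B₁
  ν₁_pos : 0 < c.ν₁
  one_lt_ξ₁ : 1 < c.ξ₁
  η₁₁_mem : η₁₁ ∈ Set.Ioo (0 : ℝ) 1
  η₁₂_mem : η₁₂ ∈ Set.Ioo (0 : ℝ) 1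
  bounded : ∀ᵐ ω ∂P, ∀ j : Fin p, |f j.succ (Z ω).2.2| ≤ c.B₀
  inv_propScore_le : ∀ᵐ ω ∂P, (propScore f γbar t (Z ω).2.2)⁻¹ ≤ c.B₁
  compatibility : Compatibility P Z f γbar (support γbar) c.ν₁ c.ξ₁
  sparse_a : (c.ξ₁ + 1) ^ 2 / c.ν₁ ^ 2 * (support γbar).card * c.lam₁ K p n ε ≤ η₁₁
  sparse_b : c.B₀ * (c.ξ₁ + 1) ^ 2 * (c.A₁ - 1) / (1 - η₁₁) / c.ν₁ ^ 2 *
    (support γbar).card * c.lam₁ K p n ε ≤ η₁₂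
  /-- `η₁` is a constant bounding `|S_γ| λ̃₁`. -/
  card_le_η₁ : (support γbar).card * c.lam₁ K p n ε ≤ c.η₁

/-- The assumptions for the outcome regression estimation. -/
structure AssumptionOR [MeasurableSpace 𝒳] (c : Constants) (η₁₁ η₁₂ : ℝ) (n : ℕ) (ε : ℝ)
    (P : Measure Ω₀) (Ypot : Fin K → Ω₀ → ℝ) (T : Ω₀ → Fin K) (X : Ω₀ → 𝒳)
    (ψ : ℝ → ℝ) (f : Fin (p + 1) → 𝒳 → ℝ) (γbar αbar : Coef p K t) : Prop where
  σ₀_pos : 0 < c.σ₀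
  ν₂_pos : 0 < c.ν₂
  one_lt_ξ₂ : 1 < c.ξ₂
  C₁_pos : 0 < c.C₁
  C₂_pos : 0 < c.C₂
  C₃_nonneg : 0 ≤ c.C₃
  η₂_mem : c.η₂ ∈ Set.Ioo (0 : ℝ) 1
  η₂₁_mem : c.η₂₁ ∈ Set.Ico (0 : ℝ) 1
  η₂₂_mem : c.η₂₂ ∈ Set.Ico (0 : ℝ) 1
  subGaussian : ∀ k : {k : Fin K // k ≠ t},
    SubGaussianGiven P X (fun ω => Ypot t ω - ψ (lin f αbar k (X ω))) c.σ₀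
  compatibility : Compatibility P (observed Ypot T X) f γbar (support αbar) c.ν₂ c.ξ₂
  deriv_le : ∀ᵐ ω ∂P, ∀ k : {k : Fin K // k ≠ t}, deriv ψ (lin f αbar k (X ω)) ≤ c.C₁
  le_deriv : ∀ᵐ ω ∂P, ∀ k : {k : Fin K // k ≠ t}, c.C₂ ≤ deriv ψ (lin f αbar k (X ω))
  deriv_growth : ∀ h h' : ℝ, deriv ψ h ≤ deriv ψ h' * Real.exp (c.C₃ * |h - h'|)
  sparse_a : (1 + c.ξ₂ ^ 2) / c.ν₂ ^ 2 * (support αbar).card * c.lam₂ K p n ε ≤ c.η₂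
  sparse_b : Real.exp (c.η₁₃ η₁₁ η₁₂) * c.B₀ * c.C₃ / c.C₂ / c.ν₂ ^ 2 * (c.ξ₂ + 1) ^ 2 *
    (c.A₂ - 1) / (1 - c.η₂) * (support αbar).card * c.lam₂ K p n ε ≤ c.η₂₁
  sparse_c : Real.exp (3 * c.η₁₃ η₁₁ η₁₂) * c.B₀ * c.C₃ / c.C₂ / c.ξ₂₁ ^ 2 / (c.A₂ - 1) *
    c.M₁₁ η₁₁ η₁₂ * (support γbar).card * c.lam₁ K p n ε ≤ c.η₂₂

end Assumptions

end

end MultiTreat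

open MultiTreat

/-! ### Sub-Gaussian tails for sums of independent vectors, free of the dimension. -/

section Concentration

open scoped RealInnerProductSpace

/-! Write `d = γ̂ - γ̄`, `b = α̂ - ᾱ`, `s = |S_γ| λ̃₁ + |S_α| λ̃₂`, and let `w_k` be the odds
weights and `W_k` the residuals at the targets. The two sample variances differ by the average of `2
φ̄ Δ + Δ²`, with `Δ` the centered change of the estimating function, so by Cauchy–Schwarz
(`abs_sampleMean_sq_sub_sq_le`) it is enough that the mean squared change be at most a constant
times `(K-1) s²`. The term `Λ²` then enters only through `K - 1 ≤ K - 1 + Λ²`.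

By `phi_sub_eq` the change splits into a part `∑ w_k (e^{d_kᵀf} - 1) W_k`, due to the odds, and a
part driven by the increments of `ψ`, due to the regressions. Linear predictors are bounded by `B₀`
times the `(2,1)` norm of the coefficients, so `phi_sub_sq_le` needs only `(2,1)` bounds on `d` and
`b` of order `s`, together with a bound on the sample mean of `∑ w_k W_k²`. The latter is a sum of
`K - 1` bounded diagonal entries; this is where `K - 1` comes from.

The `(2,1)` bounds are deterministic on a regular sample. A convex objective that is larger on a
sphere than at its center has all its minimizers in the ball, and it has one
(`exists_minimizer_of_lt_on_sphere`). On the sphere the curvature of the loss, the compatibility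
condition and the penalty beat the score. For `γ̂` this is `isRCAL_localization`. For `α̂` the
weights are themselves estimated; `wlLoss_sub_ge` pays for this with a residual-weighted quadratic
form in `d`, which unconfoundedness and the conditional second moment of the residuals reduce to the
Gram form of `d`, already controlled (`popResidualForm_le`, `IsRegularSample.residualForm_le`).

A sample is regular when the rows of both scores and the entries of two Gram matrices are close to
their expectations. The scores are centered by the first-order conditions of the targets, and their
rows obey the vector tail bound `measure_norm_sum_sq_ge_le`; the Gram entries obey Hoeffding and
Bernstein bounds. Each of the four families fails with probability at most `2ε`.

The final constant must not depend on `η₁₁, η₁₂`. Hence sharp bounds carrying these parameters are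
used only to check the range of validity of the curvature estimates, and cruder ones
(`calRadius_le_mul`, `le_of_le_gram_add'`) supply the constant. -/

theorem exp_le_add_exp_sq (x : ℝ) : Real.exp x ≤ x + Real.exp (2 / 3 * x ^ 2) := by
  have hq : 1 + 2 / 3 * x ^ 2 + (2 / 3 * x ^ 2) ^ 2 / 2 ≤ Real.exp (2 / 3 * x ^ 2) :=
    Real.quadratic_le_exp_of_nonneg (by positivity)
  -- Three regimes. For `|x| ≤ 1`, Taylor against the quadratic lower bound of `exp`. For `x > 1`,
  -- factor out `e^x`; what remains is `1 - 2x/3 ≤ e^{-x}`, read off the tangent at `1` since `1/3 <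
  -- e⁻¹ < 2/3`. For `x < -1`, `e^x ≤ 1/2`.
  rcases le_or_gt |x| 1 with hx | hx
  · have h := Real.exp_bound hx (n := 4) (by norm_num)
    simp only [Finset.sum_range_succ, Finset.sum_range_zero, Nat.factorial] at h
    have h4 : |x| ^ 4 = x ^ 4 := by rw [← abs_pow, abs_of_nonneg (by positivity)]
    rw [h4] at h
    have h' := (abs_le.1 h).2
    norm_num at h'
    have : 0 ≤ x ^ 2 * (1 / 6 - x / 6 + x ^ 2 * (4 / 18 - 5 / 96)) := by
      refine mul_nonneg (by positivity) ?_
      nlinarith [sq_nonneg (x - 1 / 2)]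
    nlinarith
  · rcases lt_abs.1 hx with h1 | h1
    · have ha : Real.exp x * (1 + (2 / 3 * x ^ 2 - x)) ≤ Real.exp (2 / 3 * x ^ 2) := by
        have : Real.exp (2 / 3 * x ^ 2) = Real.exp x * Real.exp (2 / 3 * x ^ 2 - x) := by
          rw [← Real.exp_add]; congr 1; ring
        rw [this]
        have := Real.add_one_le_exp (2 / 3 * x ^ 2 - x)
        exact mul_le_mul_of_nonneg_left (by linarith) (Real.exp_pos x).le
      have hb : 1 - 2 / 3 * x ≤ Real.exp (-x) := by
        have e1 : Real.exp (-x) = Real.exp (-1) * Real.exp (1 - x) := by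
          rw [← Real.exp_add]; congr 1; ring
        have e2 := Real.add_one_le_exp (1 - x)
        have e3 : 1 / 3 < Real.exp (-1) := by
          rw [Real.exp_neg, one_div]
          exact inv_strictAnti₀ (Real.exp_pos 1) (by linarith [Real.exp_one_lt_d9])
        have e4 : Real.exp (-1) < 2 / 3 := by
          rw [Real.exp_neg, inv_lt_comm₀ (Real.exp_pos 1) (by norm_num)]
          linarith [Real.exp_one_gt_d9]
        rw [e1]
        nlinarith [Real.exp_pos (-1), mul_le_mul_of_nonneg_left e2 (Real.exp_pos (-1)).le]
      have hc : Real.exp x * (1 - 2 / 3 * x) ≤ 1 := by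
        calc _ ≤ Real.exp x * Real.exp (-x) := mul_le_mul_of_nonneg_left hb (Real.exp_pos x).le
          _ = 1 := by rw [← Real.exp_add]; simp
      nlinarith
    · have h2 : Real.exp x ≤ 1 / 2 := by
        calc Real.exp x ≤ Real.exp (-1) := Real.exp_le_exp.2 (by linarith)
          _ ≤ 1 / 2 := by
            rw [Real.exp_neg, one_div]
            exact inv_anti₀ (by norm_num) (by linarith [Real.exp_one_gt_d9])
      nlinarith [sq_nonneg (x + 3 / 4), sq_nonneg (x ^ 2)]

theorem exp_convex_comb_le {a : ℝ} (h0 : 0 ≤ a) (h1 : a ≤ 1) (x y : ℝ) :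
    Real.exp ((1 - a) * x + a * y) ≤ (1 - a) * Real.exp x + a * Real.exp y := by
  have := convexOn_exp.2 (Set.mem_univ x) (Set.mem_univ y) (sub_nonneg.2 h1) h0 (by ring)
  simpa using this

variable {E : Type*} [NormedAddCommGroup E] [InnerProductSpace ℝ E] [MeasurableSpace E]
  [BorelSpace E] [SecondCountableTopology E]

omit [MeasurableSpace E] [BorelSpace E] [SecondCountableTopology E] in
theorem inner_le_sq_add_sq (u v : E) : ⟪u, v⟫ ≤ ‖u‖ ^ 2 / 4 + ‖v‖ ^ 2 := by
  have := real_inner_le_norm u v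
  nlinarith [sq_nonneg (‖u‖ / 2 - ‖v‖)]

theorem integrable_exp_inner {ν : Measure E} (hi : Integrable (fun v => Real.exp (‖v‖ ^ 2)) ν)
    (u : E) : Integrable (fun v => Real.exp ⟪u, v⟫) ν := by
  refine (hi.const_mul (Real.exp (‖u‖ ^ 2 / 4))).mono' (by fun_prop) (ae_of_all _ fun v => ?_)
  rw [Real.norm_eq_abs, abs_of_pos (Real.exp_pos _), ← Real.exp_add]
  exact Real.exp_le_exp.2 (inner_le_sq_add_sq u v)

/-- A centered vector with `E exp(‖V‖²) ≤ 2` is sub-Gaussian. -/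
theorem integral_exp_inner_le {ν : Measure E} [IsProbabilityMeasure ν]
    (hi : Integrable (fun v => Real.exp (‖v‖ ^ 2)) ν) (h2 : ∫ v, Real.exp (‖v‖ ^ 2) ∂ν ≤ 2)
    (h0 : ∀ u : E, ∫ v, ⟪u, v⟫ ∂ν = 0) (u : E) :
    ∫ v, Real.exp ⟪u, v⟫ ∂ν ≤ Real.exp (57 / 80 * ‖u‖ ^ 2) := by
  have hl2 := Real.log_two_lt_d9
  have hl2' := Real.log_two_gt_d9
  -- For small `u` the linear term integrates to zero and convexity gives the bound `2^p`. For large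
  -- `u` the crude bound is `2 exp(‖u‖²/4)`. At the threshold `‖u‖² = 3/2` the latter asks for `1/4
  -- + (2/3) log 2 ≤ 57/80`, which fixes the constant.
  rcases le_or_gt (‖u‖ ^ 2) (3 / 2) with hu | hu
  · set p : ℝ := 2 / 3 * ‖u‖ ^ 2 with hp
    have hp0 : 0 ≤ p := by positivity
    have hp1 : p ≤ 1 := by linarith
    have hlin : Integrable (fun v => ⟪u, v⟫) ν := by
      refine (hi.const_mul (‖u‖)).mono' (by fun_prop) (ae_of_all _ fun v => ?_)
      refine (norm_inner_le_norm u v).trans (mul_le_mul_of_nonneg_left ?_ (norm_nonneg _))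
      have := Real.add_one_le_exp (‖v‖ ^ 2)
      nlinarith [sq_nonneg (‖v‖ - 1)]
    have hpt : ∀ v, Real.exp ⟪u, v⟫ ≤ ⟪u, v⟫ + Real.exp (p * Real.log 2) *
        ((1 - p) + p * (Real.exp (‖v‖ ^ 2) / 2)) := fun v => by
      refine (exp_le_add_exp_sq _).trans (add_le_add_right ?_ _)
      have e1 : 2 / 3 * ⟪u, v⟫ ^ 2 ≤ p * ‖v‖ ^ 2 := by
        have := abs_real_inner_le_norm u v
        have h3 : ⟪u, v⟫ ^ 2 ≤ (‖u‖ * ‖v‖) ^ 2 := by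
          rw [← sq_abs ⟪u, v⟫]; gcongr
        rw [hp]; nlinarith
      have e2 := exp_convex_comb_le hp0 hp1 0 (‖v‖ ^ 2 - Real.log 2)
      rw [Real.exp_sub, Real.exp_log two_pos, Real.exp_zero, mul_one] at e2
      calc _ ≤ Real.exp (p * ‖v‖ ^ 2) := Real.exp_le_exp.2 e1
        _ = Real.exp (p * Real.log 2) * Real.exp ((1 - p) * 0 + p * (‖v‖ ^ 2 - Real.log 2)) := by
          rw [← Real.exp_add]; congr 1; ring
        _ ≤ _ := mul_le_mul_of_nonneg_left e2 (Real.exp_pos _).le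
    have hi2 : Integrable (fun v => Real.exp (p * Real.log 2) *
        ((1 - p) + p * (Real.exp (‖v‖ ^ 2) / 2))) ν :=
      ((integrable_const _).add ((hi.div_const 2).const_mul p)).const_mul _
    calc ∫ v, Real.exp ⟪u, v⟫ ∂ν
        ≤ ∫ v, (⟪u, v⟫ + Real.exp (p * Real.log 2) *
          ((1 - p) + p * (Real.exp (‖v‖ ^ 2) / 2))) ∂ν :=
          integral_mono (integrable_exp_inner hi u) (hlin.add hi2) hpt
      _ = Real.exp (p * Real.log 2) * ((1 - p) + p * ((∫ v, Real.exp (‖v‖ ^ 2) ∂ν) / 2)) := by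
          rw [integral_add hlin hi2, h0, zero_add, integral_const_mul,
            integral_add (integrable_const _) ((hi.div_const 2).const_mul p), integral_const_mul,
            integral_div]
          simp
      _ ≤ Real.exp (p * Real.log 2) * 1 := by
          refine mul_le_mul_of_nonneg_left ?_ (Real.exp_pos _).le
          nlinarith
      _ ≤ _ := by
          rw [mul_one]
          refine Real.exp_le_exp.2 ?_
          rw [hp]
          nlinarith [sq_nonneg ‖u‖]
  · calc ∫ v, Real.exp ⟪u, v⟫ ∂ν ≤ ∫ v, Real.exp (‖u‖ ^ 2 / 4) * Real.exp (‖v‖ ^ 2) ∂ν := by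
          refine integral_mono (integrable_exp_inner hi u) (hi.const_mul _) fun v => ?_
          simp only [← Real.exp_add]
          exact Real.exp_le_exp.2 (inner_le_sq_add_sq u v)
      _ ≤ Real.exp (‖u‖ ^ 2 / 4) * 2 := by
          rw [integral_const_mul]
          exact mul_le_mul_of_nonneg_left h2 (Real.exp_pos _).le
      _ = Real.exp (‖u‖ ^ 2 / 4 + Real.log 2) := by rw [Real.exp_add, Real.exp_log two_pos]
      _ ≤ _ := Real.exp_le_exp.2 (by nlinarith)

/-- One step of a Gaussian-like recursion: integrating out an independent summand costs a factor
`2^{1/b}` and shrinks the denominator `b` by `57/20`. The expanded exponent is a convex combination,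
with weights `1 - 1/b` and `1/b`, of a linear exponent and of `‖v‖²`; each is normalized so that its
exponential has integral at most `1`. -/
theorem lintegral_exp_norm_add_sq_le {ν : Measure E} [IsProbabilityMeasure ν]
    (hi : Integrable (fun v => Real.exp (‖v‖ ^ 2)) ν) (h2 : ∫ v, Real.exp (‖v‖ ^ 2) ∂ν ≤ 2)
    (h0 : ∀ u : E, ∫ v, ⟪u, v⟫ ∂ν = 0) {b : ℝ} (hb : 57 / 20 < b) (s : E) :
    ∫⁻ v, ENNReal.ofReal (Real.exp (‖s + v‖ ^ 2 / b)) ∂ν ≤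
      ENNReal.ofReal (Real.exp (Real.log 2 / b) * Real.exp (‖s‖ ^ 2 / (b - 57 / 20))) := by
  set a : ℝ := 1 / b with ha
  have hb0 : 0 < b := by linarith
  have ha0 : 0 < a := by positivity
  have ha1 : a < 1 := by rw [ha, div_lt_one hb0]; linarith
  have h1a : 0 < 1 - a := by linarith
  -- Chosen so that `(1 - a) ⟪u, v⟫` is the cross term `2a ⟪s, v⟫`.
  set u : E := (2 * a / (1 - a)) • s with hu
  set A : ℝ := 57 / 80 * ‖u‖ ^ 2 with hA
  have hun : ‖u‖ ^ 2 = (2 * a / (1 - a)) ^ 2 * ‖s‖ ^ 2 := by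
    rw [hu, norm_smul, mul_pow, Real.norm_eq_abs, sq_abs]
  have hus : ∀ v, (1 - a) * ⟪u, v⟫ = 2 * a * ⟪s, v⟫ := fun v => by
    rw [hu, real_inner_smul_left]; field_simp
  set C : ℝ := Real.exp (a * ‖s‖ ^ 2 + (1 - a) * A + a * Real.log 2) with hC
  have hpt : ∀ v, Real.exp (‖s + v‖ ^ 2 / b) ≤
      C * ((1 - a) * (Real.exp ⟪u, v⟫ / Real.exp A) + a * (Real.exp (‖v‖ ^ 2) / 2)) := fun v => by
    have e2 := exp_convex_comb_le ha0.le ha1.le (⟪u, v⟫ - A) (‖v‖ ^ 2 - Real.log 2)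
    rw [Real.exp_sub, Real.exp_sub, Real.exp_log two_pos] at e2
    refine le_trans (le_of_eq ?_) (mul_le_mul_of_nonneg_left e2 (Real.exp_pos _).le)
    rw [hC, ← Real.exp_add]
    congr 1
    have : ‖s + v‖ ^ 2 / b = a * ‖s + v‖ ^ 2 := by rw [ha]; ring
    rw [this, norm_add_sq_real]
    linear_combination (-1 : ℝ) * hus v
  have hi1 := integrable_exp_inner hi u
  have hi3 : Integrable (fun v => C * ((1 - a) * (Real.exp ⟪u, v⟫ / Real.exp A) +
      a * (Real.exp (‖v‖ ^ 2) / 2))) ν :=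
    (((hi1.div_const _).const_mul _).add ((hi.div_const 2).const_mul a)).const_mul _
  calc ∫⁻ v, ENNReal.ofReal (Real.exp (‖s + v‖ ^ 2 / b)) ∂ν
      ≤ ∫⁻ v, ENNReal.ofReal (C * ((1 - a) * (Real.exp ⟪u, v⟫ / Real.exp A) +
          a * (Real.exp (‖v‖ ^ 2) / 2))) ∂ν :=
        lintegral_mono fun v => ENNReal.ofReal_le_ofReal (hpt v)
    _ = ENNReal.ofReal (∫ v, C * ((1 - a) * (Real.exp ⟪u, v⟫ / Real.exp A) +
          a * (Real.exp (‖v‖ ^ 2) / 2)) ∂ν) :=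
        (ofReal_integral_eq_lintegral_ofReal hi3 (ae_of_all _ fun v => by
          have : 0 < C := Real.exp_pos _
          simp only [Pi.zero_apply]; positivity)).symm
    _ ≤ ENNReal.ofReal C := by
        refine ENNReal.ofReal_le_ofReal ?_
        rw [integral_const_mul, integral_add ((hi1.div_const _).const_mul _)
          ((hi.div_const 2).const_mul a), integral_const_mul, integral_const_mul, integral_div,
          integral_div]
        have e3 : (∫ v, Real.exp ⟪u, v⟫ ∂ν) / Real.exp A ≤ 1 :=
          (div_le_one (Real.exp_pos _)).2 (integral_exp_inner_le hi h2 h0 u)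
        refine mul_le_of_le_one_right (Real.exp_pos _).le ?_
        nlinarith
    _ ≤ _ := by
        refine ENNReal.ofReal_le_ofReal ?_
        rw [← Real.exp_add, hC]
        refine Real.exp_le_exp.2 ?_
        -- The loss `57/20` is `4 · 57/80`: the square of the factor `2` in the cross term times the
        -- sub-Gaussian constant.
        have e4 : a * ‖s‖ ^ 2 + (1 - a) * A ≤ ‖s‖ ^ 2 / (b - 57 / 20) := by
          have e5 : (1 - a) * A = (57 / 20 * a ^ 2 / (1 - a)) * ‖s‖ ^ 2 := by
            rw [hA, hun]; field_simp; ring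
          have e6 : a + 57 / 20 * a ^ 2 / (1 - a) ≤ 1 / (b - 57 / 20) := by
            have hb1 : 0 < b - 1 := by linarith
            have hb2 : 0 < b - 57 / 20 := by linarith
            have : a + 57 / 20 * a ^ 2 / (1 - a) = (b - 1 + 57 / 20) / (b * (b - 1)) := by
              have h3 : 1 - a = (b - 1) / b := by rw [ha]; field_simp
              rw [h3, ha]; field_simp
            rw [this, div_le_div_iff₀ (by positivity) hb2]
            nlinarith
          rw [e5, ← add_mul, div_eq_mul_one_div (‖s‖ ^ 2), mul_comm (‖s‖ ^ 2)]
          exact mul_le_mul_of_nonneg_right e6 (by positivity)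
        have e7 : a * Real.log 2 = Real.log 2 / b := by rw [ha]; ring
        linarith

variable {Ω ι : Type*} [MeasurableSpace Ω] {μ : Measure Ω} [IsProbabilityMeasure μ]

/-- The bound has the shape of `E exp(G²/b)` for a one-dimensional Gaussian `G`, so the dimension
never enters. The statement is for all `b` because each induction step lowers `b` by `57/20`. -/
theorem lintegral_exp_norm_sum_sq_le {V : ι → Ω → E} (hm : ∀ i, AEMeasurable (V i) μ)
    (hind : iIndepFun V μ) (hi : ∀ i, Integrable (fun ω => Real.exp (‖V i ω‖ ^ 2)) μ)
    (h2 : ∀ i, ∫ ω, Real.exp (‖V i ω‖ ^ 2) ∂μ ≤ 2) (h0 : ∀ i (u : E), ∫ ω, ⟪u, V i ω⟫ ∂μ = 0)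
    (s : Finset ι) : ∀ b : ℝ, 57 / 20 * (s.card : ℝ) < b →
    ∫⁻ ω, ENNReal.ofReal (Real.exp (‖∑ i ∈ s, V i ω‖ ^ 2 / b)) ∂μ ≤
      ENNReal.ofReal √(b / (b - 57 / 20 * s.card)) := by
  classical
  induction s using Finset.induction_on with
  | empty =>
    intro b hb
    have hb' : b ≠ 0 := by simp at hb; exact hb.ne'
    simp [hb']
  | insert i s his ih =>
    intro b hb
    rw [Finset.card_insert_of_notMem his] at hb ⊢
    push_cast at hb ⊢
    set m : ℝ := (s.card : ℝ)
    have hm0 : 0 ≤ m := Nat.cast_nonneg _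
    have hb1 : 57 / 20 < b := by linarith
    have hb0 : 0 < b := by linarith
    have hind' : IndepFun (∑ j ∈ s, V j) (V i) μ := hind.indepFun_finsetSum_of_notMem₀ hm his
    have hmS : AEMeasurable (∑ j ∈ s, V j) μ := Finset.aemeasurable_sum s fun j _ => hm j
    have hmap := (indepFun_iff_map_prod_eq_prod_map_map hmS (hm i)).1 hind'
    have : IsProbabilityMeasure (μ.map (V i)) := Measure.isProbabilityMeasure_map (hm i)
    have : IsProbabilityMeasure (μ.map (∑ j ∈ s, V j)) := Measure.isProbabilityMeasure_map hmS
    have hiν : Integrable (fun v => Real.exp (‖v‖ ^ 2)) (μ.map (V i)) :=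
      (integrable_map_measure (by fun_prop) (hm i)).2 (hi i)
    have h2ν : ∫ v, Real.exp (‖v‖ ^ 2) ∂(μ.map (V i)) ≤ 2 := by
      rw [integral_map (hm i) (by fun_prop)]; exact h2 i
    have h0ν : ∀ u : E, ∫ v, ⟪u, v⟫ ∂(μ.map (V i)) = 0 := fun u => by
      rw [integral_map (hm i) (by fun_prop)]; exact h0 i u
    calc ∫⁻ ω, ENNReal.ofReal (Real.exp (‖∑ j ∈ insert i s, V j ω‖ ^ 2 / b)) ∂μ
        = ∫⁻ z, ENNReal.ofReal (Real.exp (‖z.1 + z.2‖ ^ 2 / b))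
            ∂(μ.map fun ω => ((∑ j ∈ s, V j) ω, V i ω)) := by
          rw [lintegral_map' (by fun_prop) (hmS.prodMk (hm i))]
          refine lintegral_congr fun ω => ?_
          rw [Finset.sum_insert his, add_comm, Finset.sum_apply]
      _ = ∫⁻ x, ∫⁻ v, ENNReal.ofReal (Real.exp (‖x + v‖ ^ 2 / b)) ∂(μ.map (V i))
            ∂(μ.map (∑ j ∈ s, V j)) := by
          rw [hmap, lintegral_prod _ (by fun_prop)]
      _ ≤ ∫⁻ x, ENNReal.ofReal (Real.exp (Real.log 2 / b) *
            Real.exp (‖x‖ ^ 2 / (b - 57 / 20))) ∂(μ.map (∑ j ∈ s, V j)) :=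
          lintegral_mono fun x => lintegral_exp_norm_add_sq_le hiν h2ν h0ν hb1 x
      _ = ENNReal.ofReal (Real.exp (Real.log 2 / b)) *
            ∫⁻ ω, ENNReal.ofReal (Real.exp (‖∑ j ∈ s, V j ω‖ ^ 2 / (b - 57 / 20))) ∂μ := by
          rw [lintegral_map' (by fun_prop) hmS]
          simp only [ENNReal.ofReal_mul (Real.exp_pos (Real.log 2 / b)).le, Finset.sum_apply]
          rw [lintegral_const_mul'' _ ?_]
          have : AEMeasurable (fun ω => ∑ j ∈ s, V j ω) μ :=
            Finset.aemeasurable_fun_sum _ fun j _ => hm j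
          fun_prop
      _ ≤ ENNReal.ofReal (Real.exp (Real.log 2 / b)) *
            ENNReal.ofReal √((b - 57 / 20) / (b - 57 / 20 - 57 / 20 * m)) := by
          gcongr
          exact ih _ (by linarith)
      _ ≤ _ := by
          rw [← ENNReal.ofReal_mul (Real.exp_pos _).le]
          refine ENNReal.ofReal_le_ofReal (Real.le_sqrt_of_sq_le ?_)
          have hd : 0 < b - 57 / 20 - 57 / 20 * m := by linarith
          rw [mul_pow, Real.sq_sqrt (div_nonneg (by linarith) hd.le), ← Real.exp_nat_mul]
          -- The factors `2^{1/b}` are absorbed because `2 log 2 < 57/20`.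
          have he : Real.exp ((2 : ℕ) * (Real.log 2 / b)) * (b - 57 / 20) ≤ b := by
            have h1 := Real.add_one_le_exp (-((2 : ℕ) * (Real.log 2 / b)))
            have h3 : b - 57 / 20 ≤ b * Real.exp (-((2 : ℕ) * (Real.log 2 / b))) := by
              have : b - 57 / 20 ≤ b * (-((2 : ℕ) * (Real.log 2 / b)) + 1) := by
                have h5 : b * (-((2 : ℕ) * (Real.log 2 / b)) + 1) = b - 2 * Real.log 2 := by
                  push_cast; field_simp; ring
                rw [h5]; linarith [Real.log_two_lt_d9]
              exact this.trans (mul_le_mul_of_nonneg_left h1 hb0.le)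
            calc _ ≤ Real.exp ((2 : ℕ) * (Real.log 2 / b)) *
                  (b * Real.exp (-((2 : ℕ) * (Real.log 2 / b)))) :=
                  mul_le_mul_of_nonneg_left h3 (Real.exp_pos _).le
              _ = b := by rw [mul_left_comm, ← Real.exp_add]; simp
          have e1 : b - 57 / 20 * (m + 1) = b - 57 / 20 - 57 / 20 * m := by ring
          rw [e1, ← mul_div_assoc]
          exact div_le_div_of_nonneg_right he hd.le

/-- Tail bound for a sum of independent centered vectors with `E exp(‖V‖²/σ²) ≤ 2`. -/
theorem measure_norm_sum_sq_ge_le {n : ℕ} (hn : 1 ≤ n) {V : Fin n → Ω → E}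
    (hm : ∀ i, AEMeasurable (V i) μ) (hind : iIndepFun V μ) {σ : ℝ} (hσ : 0 < σ)
    (hi : ∀ i, Integrable (fun ω => Real.exp (‖V i ω‖ ^ 2 / σ ^ 2)) μ)
    (h2 : ∀ i, ∫ ω, Real.exp (‖V i ω‖ ^ 2 / σ ^ 2) ∂μ ≤ 2)
    (h0 : ∀ i (u : E), ∫ ω, ⟪u, V i ω⟫ ∂μ = 0) (x : ℝ) :
    μ {ω | 3 * n * (1 + x) * σ ^ 2 ≤ ‖∑ i, V i ω‖ ^ 2} ≤ ENNReal.ofReal (2 * Real.exp (-x)) := by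
  have hn0 : (0 : ℝ) < n := by exact_mod_cast hn
  have hnorm : ∀ v : E, ‖σ⁻¹ • v‖ ^ 2 = ‖v‖ ^ 2 / σ ^ 2 := fun v => by
    rw [norm_smul, mul_pow, Real.norm_eq_abs, sq_abs, inv_pow]; field_simp
  have key := lintegral_exp_norm_sum_sq_le (V := fun i ω => σ⁻¹ • V i ω) (μ := μ)
    (fun i => (hm i).const_smul _)
    (hind.comp (fun _ v => σ⁻¹ • v) fun _ => measurable_const_smul _)
    (by simpa only [hnorm] using hi) (by simpa only [hnorm] using h2)
    (fun i u => by simp only [real_inner_smul_right, integral_const_mul, h0, mul_zero])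
    Finset.univ (3 * n) (by simp; linarith)
  simp only [← Finset.smul_sum, hnorm, Finset.card_univ, Fintype.card_fin] at key
  -- The choice `b = 3n` lies just above `57n/20`. The moment is then at most `√20`, and `√20 ≤ 2e`
  -- gives the tail `2e^{-x}`.
  have e20 : (3 * n : ℝ) / (3 * n - 57 / 20 * n) = 20 := by
    have : (3 * n - 57 / 20 * n : ℝ) = 3 / 20 * n := by ring
    rw [this]; field_simp
  rw [e20] at key
  have hexp : ENNReal.ofReal (Real.exp (1 + x)) ≠ 0 := by simp [Real.exp_pos]
  calc μ {ω | 3 * n * (1 + x) * σ ^ 2 ≤ ‖∑ i, V i ω‖ ^ 2}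
      ≤ μ {ω | ENNReal.ofReal (Real.exp (1 + x)) ≤
          ENNReal.ofReal (Real.exp (‖∑ i, V i ω‖ ^ 2 / σ ^ 2 / (3 * n)))} := by
        refine measure_mono fun ω hω => ?_
        simp only [Set.mem_ofPred_eq] at hω ⊢
        refine ENNReal.ofReal_le_ofReal (Real.exp_le_exp.2 ?_)
        rw [div_div, le_div_iff₀ (by positivity)]
        nlinarith
    _ ≤ (∫⁻ ω, ENNReal.ofReal (Real.exp (‖∑ i, V i ω‖ ^ 2 / σ ^ 2 / (3 * n))) ∂μ) /
          ENNReal.ofReal (Real.exp (1 + x)) := by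
        refine meas_ge_le_lintegral_div ?_ hexp ENNReal.ofReal_ne_top
        have : AEMeasurable (fun ω => ∑ i, V i ω) μ := Finset.aemeasurable_fun_sum _ fun i _ => hm i
        fun_prop
    _ ≤ ENNReal.ofReal √20 / ENNReal.ofReal (Real.exp (1 + x)) := by gcongr
    _ ≤ _ := by
        rw [← ENNReal.ofReal_div_of_pos (Real.exp_pos _)]
        refine ENNReal.ofReal_le_ofReal ?_
        rw [div_le_iff₀ (Real.exp_pos _)]
        have : 2 * Real.exp (-x) * Real.exp (1 + x) = 2 * Real.exp 1 := by
          rw [mul_assoc, ← Real.exp_add]; congr 2; ring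
        rw [this]
        refine (Real.sqrt_le_left (by positivity)).2 ?_
        nlinarith [Real.exp_one_gt_d9]

end Concentration

/-! ### Bernstein and Hoeffding bounds for scalar averages. -/

section ScalarConcentration

theorem abs_exp_sub_one_sub_le (x : ℝ) : |Real.exp x - 1 - x| ≤ x ^ 2 * Real.exp |x| := by
  have h := Complex.norm_exp_sub_sum_le_norm_mul_exp (x : ℂ) 2
  simp only [Finset.sum_range_succ, Finset.sum_range_zero, Nat.factorial, pow_zero, pow_one,
    Complex.norm_real, Real.norm_eq_abs, sq_abs] at h
  norm_num at h
  rw [← Complex.ofReal_exp, ← Complex.ofReal_one, ← Complex.ofReal_add, ← Complex.ofReal_sub,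
    Complex.norm_real, Real.norm_eq_abs] at h
  rwa [sub_sub]

theorem sq_mul_exp_half_le (z : ℝ) : z ^ 2 * Real.exp (|z| / 2) ≤ 8 * Real.exp |z| := by
  have h := Real.quadratic_le_exp_of_nonneg (x := |z| / 2) (by positivity)
  have h1 : z ^ 2 ≤ 8 * Real.exp (|z| / 2) := by
    rw [← sq_abs]; nlinarith [abs_nonneg z]
  calc _ ≤ 8 * Real.exp (|z| / 2) * Real.exp (|z| / 2) :=
        mul_le_mul_of_nonneg_right h1 (Real.exp_pos _).le
    _ = _ := by rw [mul_assoc, ← Real.exp_add]; congr 2; ring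

variable {Ω : Type*} [MeasurableSpace Ω] {μ : Measure Ω} [IsProbabilityMeasure μ]

omit [IsProbabilityMeasure μ] in
theorem integrable_of_integrable_exp_abs {ζ : Ω → ℝ} (hm : AEMeasurable ζ μ)
    (hi : Integrable (fun ω => Real.exp |ζ ω|) μ) : Integrable ζ μ := by
  refine hi.mono' hm.aestronglyMeasurable (ae_of_all _ fun ω => ?_)
  rw [Real.norm_eq_abs]
  linarith [Real.add_one_le_exp |ζ ω|]

omit [IsProbabilityMeasure μ] in
theorem integrable_exp_mul_of_integrable_exp_abs {ζ : Ω → ℝ} (hm : AEMeasurable ζ μ)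
    (hi : Integrable (fun ω => Real.exp |ζ ω|) μ) {θ : ℝ} (hθ : |θ| ≤ 1 / 2) :
    Integrable (fun ω => Real.exp (θ * ζ ω)) μ := by
  refine hi.mono' (by fun_prop) (ae_of_all _ fun ω => ?_)
  rw [Real.norm_eq_abs, abs_of_pos (Real.exp_pos _)]
  refine Real.exp_le_exp.2 ?_
  calc θ * ζ ω ≤ |θ| * |ζ ω| := by rw [← abs_mul]; exact le_abs_self _
    _ ≤ |ζ ω| := by nlinarith [abs_nonneg (ζ ω)]

/-- For `|θ| ≤ 1/2` the second-order remainder of `e^{θζ}` uses only half of the exponential moment,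
and the other half absorbs the factor `ζ²`. -/
theorem mgf_le_of_integral_exp_abs_le_two {ζ : Ω → ℝ} (hm : AEMeasurable ζ μ)
    (hi : Integrable (fun ω => Real.exp |ζ ω|) μ) (h2 : ∫ ω, Real.exp |ζ ω| ∂μ ≤ 2)
    {θ : ℝ} (hθ : |θ| ≤ 1 / 2) :
    mgf ζ μ θ ≤ Real.exp (θ * ∫ ω, ζ ω ∂μ + 16 * θ ^ 2) := by
  have hpt : ∀ ω, Real.exp (θ * ζ ω) ≤ 1 + θ * ζ ω + 8 * θ ^ 2 * Real.exp |ζ ω| := fun ω => by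
    have h1 := (abs_le.1 (abs_exp_sub_one_sub_le (θ * ζ ω))).2
    have h2 : (θ * ζ ω) ^ 2 * Real.exp |θ * ζ ω| ≤ 8 * θ ^ 2 * Real.exp |ζ ω| := by
      calc _ ≤ (θ * ζ ω) ^ 2 * Real.exp (|ζ ω| / 2) := by
            gcongr
            rw [abs_mul]; nlinarith [abs_nonneg (ζ ω)]
        _ = θ ^ 2 * (ζ ω ^ 2 * Real.exp (|ζ ω| / 2)) := by ring
        _ ≤ θ ^ 2 * (8 * Real.exp |ζ ω|) :=
          mul_le_mul_of_nonneg_left (sq_mul_exp_half_le _) (sq_nonneg _)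
        _ = _ := by ring
    linarith
  have hζ := integrable_of_integrable_exp_abs hm hi
  have hi1 : Integrable (fun ω => 1 + θ * ζ ω) μ := (integrable_const _).add (hζ.const_mul θ)
  calc mgf ζ μ θ ≤ ∫ ω, (1 + θ * ζ ω + 8 * θ ^ 2 * Real.exp |ζ ω|) ∂μ :=
        integral_mono (integrable_exp_mul_of_integrable_exp_abs hm hi hθ)
          (hi1.add (hi.const_mul _)) hpt
    _ = 1 + θ * ∫ ω, ζ ω ∂μ + 8 * θ ^ 2 * ∫ ω, Real.exp |ζ ω| ∂μ := by
        rw [integral_add hi1 (hi.const_mul _), integral_add (integrable_const _) (hζ.const_mul θ),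
          integral_const_mul, integral_const_mul]
        simp
    _ ≤ θ * ∫ ω, ζ ω ∂μ + 16 * θ ^ 2 + 1 := by nlinarith [sq_nonneg θ]
    _ ≤ _ := Real.add_one_le_exp _

theorem measure_sum_sub_ge_le {n : ℕ} {ζ : Fin n → Ω → ℝ} (hm : ∀ i, AEMeasurable (ζ i) μ)
    (hind : iIndepFun ζ μ) (hi : ∀ i, Integrable (fun ω => Real.exp |ζ i ω|) μ)
    (h2 : ∀ i, ∫ ω, Real.exp |ζ i ω| ∂μ ≤ 2) {m : ℝ} (hmean : ∀ i, ∫ ω, ζ i ω ∂μ = m)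
    {ρ : ℝ} (hρ0 : 0 ≤ ρ) (hρ1 : ρ ≤ 1) :
    μ {ω | 16 * ρ * n ≤ ∑ i, ζ i ω - n * m} ≤ ENNReal.ofReal (Real.exp (-(3 * n * ρ ^ 2))) := by
  -- Chernoff at `θ = ρ/4`: the exponent is `-4nρ² + nρ² = -3nρ²`.
  have hθ : |ρ / 4| ≤ 1 / 2 := by rw [abs_of_nonneg (by positivity)]; linarith
  have hint : Integrable (fun ω => Real.exp (ρ / 4 * (∑ i, ζ i) ω)) μ := by
    -- A non-integrable exponential has `mgf` equal to `0`, whereas by independence it is a product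
    -- of positive factors.
    by_contra hcon
    have h0 := mgf_undef hcon
    rw [hind.mgf_sum₀ hm, Finset.prod_eq_zero_iff] at h0
    obtain ⟨i, -, h⟩ := h0
    exact (mgf_pos (integrable_exp_mul_of_integrable_exp_abs (hm i) (hi i) hθ)).ne' h
  have h := measure_ge_le_exp_mul_mgf (X := ∑ i, ζ i) (μ := μ) (16 * ρ * n + n * m)
    (t := ρ / 4) (by positivity) hint
  rw [← ofReal_measureReal]
  refine ENNReal.ofReal_le_ofReal ?_
  calc μ.real {ω | 16 * ρ * n ≤ ∑ i, ζ i ω - n * m}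
      = μ.real {ω | 16 * ρ * n + n * m ≤ (∑ i, ζ i) ω} := by
        simp only [Finset.sum_apply, le_sub_iff_add_le]
    _ ≤ _ := h
    _ ≤ Real.exp (-(ρ / 4) * (16 * ρ * n + n * m)) *
          ∏ _i : Fin n, Real.exp (ρ / 4 * m + 16 * (ρ / 4) ^ 2) := by
        rw [hind.mgf_sum₀ hm]
        gcongr with i
        · exact fun i _ => mgf_nonneg
        · rw [← hmean i]
          exact mgf_le_of_integral_exp_abs_le_two (hm i) (hi i) (h2 i) hθ
    _ = _ := by
        rw [Finset.prod_const, ← Real.exp_nat_mul, ← Real.exp_add]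
        congr 1
        simp
        ring

/-- A Bernstein bound for independent variables with `E exp |ζ| ≤ 2`. -/
theorem measure_abs_sum_sub_ge_le {n : ℕ} {ζ : Fin n → Ω → ℝ} (hm : ∀ i, AEMeasurable (ζ i) μ)
    (hind : iIndepFun ζ μ) (hi : ∀ i, Integrable (fun ω => Real.exp |ζ i ω|) μ)
    (h2 : ∀ i, ∫ ω, Real.exp |ζ i ω| ∂μ ≤ 2) {m : ℝ} (hmean : ∀ i, ∫ ω, ζ i ω ∂μ = m)
    {ρ : ℝ} (hρ0 : 0 ≤ ρ) (hρ1 : ρ ≤ 1) :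
    μ {ω | 16 * ρ * n ≤ |∑ i, ζ i ω - n * m|} ≤
      ENNReal.ofReal (2 * Real.exp (-(3 * n * ρ ^ 2))) := by
  have h1 := measure_sum_sub_ge_le hm hind hi h2 hmean hρ0 hρ1
  have h3 := measure_sum_sub_ge_le (ζ := fun i ω => -ζ i ω) (m := -m) (fun i => (hm i).neg)
    (hind.comp (fun _ x => -x) fun _ => measurable_neg) (by simpa using hi) (by simpa using h2)
    (fun i => by rw [integral_neg, hmean]) hρ0 hρ1
  rw [two_mul, ENNReal.ofReal_add (Real.exp_pos _).le (Real.exp_pos _).le]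
  refine (measure_mono fun ω hω => ?_).trans ((measure_union_le _ _).trans (add_le_add h1 h3))
  rcases le_abs.1 (show _ ≤ |∑ i, ζ i ω - n * m| from hω) with h | h
  · exact Or.inl h
  · right
    simp only [Set.mem_ofPred_eq, Finset.sum_neg_distrib]
    linarith

/-- Hoeffding's inequality for independent variables with values in `[-L, L]`. -/
theorem measure_abs_sum_sub_ge_le_of_bounded {n : ℕ} {ζ : Fin n → Ω → ℝ}
    (hm : ∀ i, AEMeasurable (ζ i) μ) (hind : iIndepFun ζ μ) {L : ℝ} (hL : 0 < L)
    (hb : ∀ i, ∀ᵐ ω ∂μ, |ζ i ω| ≤ L) {m : ℝ} (hmean : ∀ i, ∫ ω, ζ i ω ∂μ = m)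
    {x : ℝ} (hx : 0 ≤ x) (hn : 1 ≤ n) :
    μ {ω | n * x ≤ |∑ i, ζ i ω - n * m|} ≤
      ENNReal.ofReal (2 * Real.exp (-(n * x ^ 2 / (2 * L ^ 2)))) := by
  have hn0 : (0 : ℝ) < n := by exact_mod_cast hn
  have key : ∀ (ζ : Fin n → Ω → ℝ), (∀ i, AEMeasurable (ζ i) μ) → iIndepFun ζ μ →
      (∀ i, ∀ᵐ ω ∂μ, |ζ i ω| ≤ L) → ∀ m : ℝ, (∀ i, ∫ ω, ζ i ω ∂μ = m) →
      μ {ω | n * x ≤ ∑ i, ζ i ω - n * m} ≤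
        ENNReal.ofReal (Real.exp (-(n * x ^ 2 / (2 * L ^ 2)))) := by
    intro ζ hm hind hb m hmean
    have hsub : ∀ i ∈ Finset.univ, HasSubgaussianMGF (fun ω => ζ i ω - m)
        ((‖L - -L‖₊ / 2) ^ 2) μ := fun i _ => by
      have := hasSubgaussianMGF_of_mem_Icc (hm i) (a := -L) (b := L)
        ((hb i).mono fun ω h => abs_le.1 h)
      rwa [hmean i] at this
    have h := HasSubgaussianMGF.measure_sum_ge_le_of_iIndepFun (X := fun i ω => ζ i ω - m)
      (hind.comp (fun _ y => y - m) fun _ => measurable_sub_const m) hsub (ε := n * x)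
      (by positivity)
    rw [← ofReal_measureReal]
    refine ENNReal.ofReal_le_ofReal ?_
    simp only [Finset.sum_sub_distrib, Finset.sum_const, Finset.card_univ, Fintype.card_fin,
      nsmul_eq_mul] at h
    refine h.trans (Real.exp_le_exp.2 (le_of_eq ?_))
    have h2L : L - -L = 2 * L := by ring
    have hnorm : ((‖L - -L‖₊ : NNReal) : ℝ) = 2 * L := by
      rw [coe_nnnorm, h2L, Real.norm_eq_abs, abs_of_pos (by positivity)]
    push_cast
    rw [coe_nnnorm] at hnorm
    rw [hnorm]
    field_simp
  have h1 := key ζ hm hind hb m hmean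
  have h3 := key (fun i ω => -ζ i ω) (fun i => (hm i).neg)
    (hind.comp (fun _ x => -x) fun _ => measurable_neg) (by simpa using hb) (-m)
    (fun i => by rw [integral_neg, hmean])
  rw [two_mul, ENNReal.ofReal_add (Real.exp_pos _).le (Real.exp_pos _).le]
  refine (measure_mono fun ω hω => ?_).trans ((measure_union_le _ _).trans (add_le_add h1 h3))
  rcases le_abs.1 (show _ ≤ |∑ i, ζ i ω - n * m| from hω) with h | h
  · exact Or.inl h
  · right
    simp only [Set.mem_ofPred_eq, Finset.sum_neg_distrib]
    linarith

end ScalarConcentration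

/-! ### The `(2,1)` norm, the group penalty, and minimizers of convex functions. -/

section CoefficientNorms

variable {p K : ℕ} {t : Fin K} {𝒳 : Type*}

theorem rowNorm_eq_norm (b : Coef p K t) (j : Fin (p + 1)) :
    rowNorm b j = ‖(WithLp.toLp 2 (b j) : EuclideanSpace ℝ {k : Fin K // k ≠ t})‖ := by
  rw [EuclideanSpace.norm_eq, rowNorm]
  simp

theorem rowNorm_nonneg (b : Coef p K t) (j : Fin (p + 1)) : 0 ≤ rowNorm b j := Real.sqrt_nonneg _

theorem rowNorm_add_le (a b : Coef p K t) (j : Fin (p + 1)) :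
    rowNorm (a + b) j ≤ rowNorm a j + rowNorm b j := by
  simp only [rowNorm_eq_norm, Pi.add_apply, WithLp.toLp_add]
  exact norm_add_le _ _

theorem rowNorm_smul (τ : ℝ) (b : Coef p K t) (j : Fin (p + 1)) :
    rowNorm (τ • b) j = |τ| * rowNorm b j := by
  simp only [rowNorm_eq_norm, Pi.smul_apply, WithLp.toLp_smul, norm_smul, Real.norm_eq_abs]

theorem rowNorm_neg (b : Coef p K t) (j : Fin (p + 1)) : rowNorm (-b) j = rowNorm b j := by
  simp [rowNorm]

theorem continuous_rowNorm (j : Fin (p + 1)) : Continuous fun b : Coef p K t => rowNorm b j := by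
  unfold rowNorm; fun_prop

theorem abs_le_rowNorm (b : Coef p K t) (j : Fin (p + 1)) (k : {k : Fin K // k ≠ t}) :
    |b j k| ≤ rowNorm b j :=
  Real.abs_le_sqrt (Finset.single_le_sum (f := fun k => b j k ^ 2) (fun _ _ => sq_nonneg _)
    (Finset.mem_univ k))

theorem norm21_nonneg (b : Coef p K t) : 0 ≤ norm21 b :=
  Finset.sum_nonneg fun j _ => rowNorm_nonneg b j

theorem rowNorm_le_norm21 (b : Coef p K t) (j : Fin (p + 1)) : rowNorm b j ≤ norm21 b :=
  Finset.single_le_sum (f := fun j => rowNorm b j) (fun j _ => rowNorm_nonneg b j)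
    (Finset.mem_univ j)

theorem norm21_smul (τ : ℝ) (b : Coef p K t) : norm21 (τ • b) = |τ| * norm21 b := by
  simp only [norm21, rowNorm_smul, Finset.mul_sum]

theorem continuous_norm21 : Continuous fun b : Coef p K t => norm21 b :=
  continuous_finsetSum _ fun j _ => continuous_rowNorm j

theorem isCompact_norm21_le (g : Coef p K t) (r : ℝ) :
    IsCompact {m : Coef p K t | norm21 (m - g) ≤ r} := by
  refine Metric.isCompact_of_isClosed_isBounded
    (isClosed_le (continuous_norm21.comp (by fun_prop)) continuous_const) ?_
  refine (Metric.isBounded_closedBall (x := g) (r := max r 0)).subset fun m hm => ?_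
  rw [Metric.mem_closedBall, dist_eq_norm, pi_norm_le_iff_of_nonneg (le_max_right _ _)]
  intro j
  rw [pi_norm_le_iff_of_nonneg (le_max_right _ _)]
  intro k
  exact (abs_le_rowNorm (m - g) j k).trans ((rowNorm_le_norm21 _ j).trans
    (le_trans hm (le_max_left _ _)))

theorem convexOn_rowNorm (j : Fin (p + 1)) :
    ConvexOn ℝ Set.univ fun b : Coef p K t => rowNorm b j := by
  refine ⟨convex_univ, fun a _ b _ u v hu hv _ => ?_⟩
  refine (rowNorm_add_le _ _ j).trans ?_
  rw [rowNorm_smul, rowNorm_smul, abs_of_nonneg hu, abs_of_nonneg hv]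
  rfl

theorem convexOn_penalty : ConvexOn ℝ Set.univ fun b : Coef p K t => penalty b := by
  unfold penalty
  exact Finset.sum_induction (fun (j : Fin p) (b : Coef p K t) => rowNorm b j.succ)
    (fun F => ConvexOn ℝ Set.univ F) (fun _ _ => ConvexOn.add) (convexOn_const 0 convex_univ)
    (fun j _ => convexOn_rowNorm j.succ) |> fun h => by simpa [Finset.sum_fn] using h

theorem continuous_penalty : Continuous fun b : Coef p K t => penalty b :=
  continuous_finsetSum _ fun j _ => continuous_rowNorm j.succ

theorem zero_mem_support (g : Coef p K t) : 0 ∈ support g := by simp [support]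

theorem rowNorm_eq_zero_of_notMem {g : Coef p K t} {j : Fin (p + 1)} (hj : j ∉ support g) :
    g j = 0 := by
  simp only [support, Finset.mem_filter, Finset.mem_univ, true_and, not_or, not_not] at hj
  exact hj.2

theorem one_le_card_support (g : Coef p K t) : (1 : ℝ) ≤ (support g).card := by
  exact_mod_cast Finset.card_pos.2 ⟨0, zero_mem_support g⟩

/-- `∑_{j ∈ S(g)} ‖b_{j·}‖₂`. -/
noncomputable def supportNorm (g b : Coef p K t) : ℝ := ∑ j ∈ support g, rowNorm b j

theorem supportNorm_nonneg (g b : Coef p K t) : 0 ≤ supportNorm g b :=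
  Finset.sum_nonneg fun j _ => rowNorm_nonneg b j

theorem sum_compl_support (g b : Coef p K t) :
    ∑ j ∈ (support g)ᶜ, rowNorm b j = norm21 b - supportNorm g b := by
  rw [norm21, supportNorm, ← Finset.sum_add_sum_compl (support g)]; ring

theorem supportNorm_le_norm21 (g b : Coef p K t) : supportNorm g b ≤ norm21 b :=
  Finset.sum_le_sum_of_subset_of_nonneg (Finset.subset_univ _) fun j _ _ => rowNorm_nonneg b j

/-- Decomposability of the group penalty: rows in the support lose at most `‖b_{j·}‖` by the
triangle inequality, rows outside gain exactly `‖b_{j·}‖`. The unpenalized intercept lies in the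
support, so its contribution to the left side is nonpositive and can be dropped. -/
theorem penalty_add_sub_ge (g b : Coef p K t) :
    norm21 b - 2 * supportNorm g b ≤ penalty (g + b) - penalty g := by
  classical
  set h : Fin (p + 1) → ℝ := fun j => rowNorm b j - 2 * if j ∈ support g then rowNorm b j else 0
    with hh
  have h1 : ∀ j, h j ≤ rowNorm (g + b) j - rowNorm g j := fun j => by
    simp only [hh]
    split_ifs with hj
    · have := rowNorm_add_le (g + b) (-b) j
      rw [rowNorm_neg, add_neg_cancel_right] at this
      linarith
    · have hg := rowNorm_eq_zero_of_notMem hj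
      simp [rowNorm, hg]
  have h0 : h 0 ≤ 0 := by
    simp only [hh, zero_mem_support, if_true]
    linarith [rowNorm_nonneg b 0]
  have hsum : ∑ j, h j = norm21 b - 2 * supportNorm g b := by
    simp only [hh, Finset.sum_sub_distrib, ← Finset.mul_sum, Finset.sum_ite_mem,
      Finset.univ_inter, norm21, supportNorm]
  have h2 : ∑ j : Fin p, h j.succ ≤ penalty (g + b) - penalty g := by
    rw [penalty, penalty, ← Finset.sum_sub_distrib]
    exact Finset.sum_le_sum fun j _ => h1 j.succ
  rw [Fin.sum_univ_succ] at hsum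
  linarith

theorem lin_add (f : Fin (p + 1) → 𝒳 → ℝ) (a b : Coef p K t) (k : {k : Fin K // k ≠ t}) (x : 𝒳) :
    lin f (a + b) k x = lin f a k x + lin f b k x := by
  simp [lin, add_mul, Finset.sum_add_distrib]

theorem lin_smul (f : Fin (p + 1) → 𝒳 → ℝ) (τ : ℝ) (b : Coef p K t) (k : {k : Fin K // k ≠ t})
    (x : 𝒳) : lin f (τ • b) k x = τ * lin f b k x := by
  simp [lin, mul_assoc, Finset.mul_sum]

/-- The vector of the linear predictors over `k` is the combination of the rows of `b` with
coefficients `f_j(x)`; the triangle inequality then costs no factor in `K`. -/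
theorem sum_lin_sq_le {f : Fin (p + 1) → 𝒳 → ℝ} {x : 𝒳} {B : ℝ} (hB : ∀ j, |f j x| ≤ B)
    (b : Coef p K t) : ∑ k, lin f b k x ^ 2 ≤ (B * norm21 b) ^ 2 := by
  have e : (WithLp.toLp 2 (fun k => lin f b k x) : EuclideanSpace ℝ {k : Fin K // k ≠ t}) =
      ∑ j, f j x • WithLp.toLp 2 (b j) := by
    ext k
    simp [lin, mul_comm]
  have h1 : ‖(WithLp.toLp 2 (fun k => lin f b k x) : EuclideanSpace ℝ {k : Fin K // k ≠ t})‖ ≤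
      B * norm21 b := by
    rw [e, norm21, Finset.mul_sum]
    refine (norm_sum_le _ _).trans (Finset.sum_le_sum fun j _ => ?_)
    rw [norm_smul, rowNorm_eq_norm]
    exact mul_le_mul_of_nonneg_right (hB j) (norm_nonneg _)
  have h2 := pow_le_pow_left₀ (norm_nonneg _) h1 2
  rw [EuclideanSpace.norm_sq_eq] at h2
  simpa using h2

theorem abs_lin_le {f : Fin (p + 1) → 𝒳 → ℝ} {x : 𝒳} {B : ℝ} (hB : ∀ j, |f j x| ≤ B)
    (b : Coef p K t) (k : {k : Fin K // k ≠ t}) : |lin f b k x| ≤ B * norm21 b := by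
  have hB0 : 0 ≤ B := (abs_nonneg _).trans (hB 0)
  refine abs_le_of_sq_le_sq ?_ (mul_nonneg hB0 (norm21_nonneg b))
  exact (Finset.single_le_sum (f := fun k => lin f b k x ^ 2) (fun _ _ => sq_nonneg _)
    (Finset.mem_univ k)).trans (sum_lin_sq_le hB b)

/-- Duality of the `(2,1)` and `(2,∞)` norms, by Cauchy–Schwarz in each row. It bounds the linear
(score) terms of both losses. -/
theorem abs_sum_mul_le_of_rowNorm_le {G : Coef p K t} {lam : ℝ} (hG : ∀ j, rowNorm G j ≤ lam)
    (b : Coef p K t) : |∑ k, ∑ j, b j k * G j k| ≤ lam * norm21 b := by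
  rw [Finset.sum_comm, norm21, Finset.mul_sum]
  refine (Finset.abs_sum_le_sum_abs _ _).trans (Finset.sum_le_sum fun j _ => ?_)
  have h := abs_real_inner_le_norm (WithLp.toLp 2 (G j) : EuclideanSpace ℝ {k : Fin K // k ≠ t})
    (WithLp.toLp 2 (b j))
  rw [← rowNorm_eq_norm, ← rowNorm_eq_norm] at h
  simp only [PiLp.inner_apply, RCLike.inner_apply, conj_trivial] at h
  exact h.trans (mul_le_mul_of_nonneg_right (hG j) (rowNorm_nonneg b j))

/-- The forms are diagonal in `k`, so Cauchy–Schwarz over `k` turns an entrywise error into one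
relative to `‖b‖²_{2,1}`, without a factor `K - 1`. -/
theorem abs_quadForm_le {D : Fin (p + 1) → Fin (p + 1) → {k : Fin K // k ≠ t} → ℝ} {τ : ℝ}
    (hD : ∀ i j k, |D i j k| ≤ τ) (b : Coef p K t) :
    |∑ k, ∑ i, ∑ j, b i k * D i j k * b j k| ≤ τ * norm21 b ^ 2 := by
  have h1 : ∀ i j, ∑ k, |b i k * D i j k * b j k| ≤ τ * (rowNorm b i * rowNorm b j) := by
    intro i j
    have hc := Real.sum_mul_le_sqrt_mul_sqrt Finset.univ (fun k => |b i k|) (fun k => |b j k|)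
    simp only [sq_abs] at hc
    -- With no index `k` the hypothesis says nothing about the sign of `τ`, but all row norms
    -- vanish.
    rcases isEmpty_or_nonempty {k : Fin K // k ≠ t} with he | ⟨⟨k0⟩⟩
    · simp [rowNorm]
    have hτ : 0 ≤ τ := (abs_nonneg _).trans (hD i j k0)
    calc ∑ k, |b i k * D i j k * b j k| ≤ ∑ k, τ * (|b i k| * |b j k|) := by
          refine Finset.sum_le_sum fun k _ => ?_
          rw [abs_mul, abs_mul]
          nlinarith [mul_le_mul_of_nonneg_left (hD i j k)
            (mul_nonneg (abs_nonneg (b i k)) (abs_nonneg (b j k)))]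
      _ ≤ _ := by
          rw [← Finset.mul_sum]
          exact mul_le_mul_of_nonneg_left hc hτ
  calc |∑ k, ∑ i, ∑ j, b i k * D i j k * b j k|
      ≤ ∑ k, ∑ i, ∑ j, |b i k * D i j k * b j k| :=
        (Finset.abs_sum_le_sum_abs _ _).trans (Finset.sum_le_sum fun k _ =>
          (Finset.abs_sum_le_sum_abs _ _).trans (Finset.sum_le_sum fun i _ =>
            Finset.abs_sum_le_sum_abs _ _))
    _ = ∑ i, ∑ j, ∑ k, |b i k * D i j k * b j k| := by
        rw [Finset.sum_comm]
        exact Finset.sum_congr rfl fun i _ => Finset.sum_comm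
    _ ≤ ∑ i, ∑ j, τ * (rowNorm b i * rowNorm b j) :=
        Finset.sum_le_sum fun i _ => Finset.sum_le_sum fun j _ => h1 i j
    _ = _ := by
        rw [norm21, sq, Finset.sum_mul_sum, Finset.mul_sum]
        simp only [Finset.mul_sum]

/-- A convex function that is larger on a sphere than at its center has a minimizer, and all its
minimizers lie in the ball. -/
theorem exists_minimizer_of_lt_on_sphere {F : Coef p K t → ℝ} (hF : ConvexOn ℝ Set.univ F)
    (hcont : Continuous F) {g : Coef p K t} {r : ℝ} (hr : 0 < r)
    (hs : ∀ b, norm21 b = r → F g < F (g + b)) :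
    (∃ m, ∀ z, F m ≤ F z) ∧ ∀ m, (∀ z, F m ≤ F z) → norm21 (m - g) ≤ r := by
  have hout : ∀ z, r < norm21 (z - g) → F g < F z := fun z hz => by
    set N := norm21 (z - g)
    have hN : 0 < N := hr.trans hz
    -- The segment from `g` to a point outside the ball crosses the sphere; as `F` exceeds `F g`
    -- there, convexity forces `F z > F g`.
    have h1 := hs ((r / N) • (z - g)) (by
      rw [norm21_smul, abs_of_pos (by positivity)]
      exact div_mul_cancel₀ r hN.ne')
    have h2 : F ((1 - r / N) • g + (r / N) • z) ≤ (1 - r / N) • F g + (r / N) • F z :=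
      hF.2 (Set.mem_univ g) (Set.mem_univ z) (sub_nonneg.2 ((div_le_one hN).2 hz.le))
        (by positivity) (by ring)
    have h3 : (1 - r / N) • g + (r / N) • z = g + (r / N) • (z - g) := by module
    rw [h3] at h2
    simp only [smul_eq_mul] at h2
    have h4 : 0 < r / N := by positivity
    nlinarith
  refine ⟨?_, fun m hm => not_lt.1 fun h => (hout m h).not_ge (hm g)⟩
  obtain ⟨m, hmem, hm⟩ := (isCompact_norm21_le g r).exists_isMinOn
    ⟨g, by simp [norm21, rowNorm, hr.le]⟩ hcont.continuousOn
  refine ⟨m, fun z => ?_⟩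
  rcases le_or_gt (norm21 (z - g)) r with hz | hz
  · exact hm hz
  · exact (hm (show g ∈ _ by simp [norm21, rowNorm, hr.le])).trans (hout z hz).le

end CoefficientNorms

/-! ### Curvature of the exponential and of the primitive of `ψ`. -/

section Calculus

/-- The cubic Taylor term `u³/6 ≥ -a u²/6` accounts for the factor `1 - a/3`; the higher-order
terms, remainder included, are together nonnegative. -/
theorem exp_sub_one_sub_ge {a u : ℝ} (hu : |u| ≤ a) (ha : a ≤ 1) :
    (1 - a / 3) / 2 * u ^ 2 ≤ Real.exp u - 1 - u := by
  have h := Real.exp_bound (hu.trans ha) (n := 6) (by norm_num)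
  simp only [Finset.sum_range_succ, Finset.sum_range_zero, Nat.factorial] at h
  have h6 : |u| ^ 6 = u ^ 6 := by rw [← abs_pow, abs_of_nonneg (by positivity)]
  rw [h6] at h
  have h' := (abs_le.1 h).1
  norm_num at h'
  have hu1 := abs_le.1 (hu.trans ha)
  have hua := abs_le.1 hu
  have h4 : 0 ≤ u ^ 4 * (1 / 24 + u / 120 - u ^ 2 * (7 / 4320)) := by
    refine mul_nonneg (by positivity) ?_
    nlinarith
  have h3 : 0 ≤ u ^ 2 * (u + a) := mul_nonneg (sq_nonneg u) (by linarith)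
  nlinarith

theorem abs_exp_sub_one_le (d : ℝ) : |Real.exp d - 1| ≤ |d| * Real.exp |d| := by
  rw [abs_le]
  constructor
  · have h1 := Real.add_one_le_exp d
    have h2 := Real.one_le_exp (abs_nonneg d)
    nlinarith [neg_abs_le d, abs_nonneg d]
  · have h1 := Real.add_one_le_exp (-d)
    have h2 : Real.exp d * Real.exp (-d) = 1 := by rw [← Real.exp_add]; simp
    have h3 : Real.exp d ≤ Real.exp |d| := Real.exp_le_exp.2 (le_abs_self d)
    have h4 : Real.exp d - 1 ≤ Real.exp d * d := by nlinarith [Real.exp_pos d]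
    calc Real.exp d - 1 ≤ Real.exp d * d := h4
      _ ≤ Real.exp d * |d| := mul_le_mul_of_nonneg_left (le_abs_self d) (Real.exp_pos d).le
      _ ≤ |d| * Real.exp |d| := by
        rw [mul_comm]; exact mul_le_mul_of_nonneg_left h3 (abs_nonneg d)

theorem nonneg_of_deriv_nonneg {D D' : ℝ → ℝ} (hD : ∀ τ, HasDerivAt D (D' τ) τ) (h0 : D 0 = 0)
    (h : ∀ τ ∈ Set.Icc (0 : ℝ) 1, 0 ≤ D' τ) {τ : ℝ} (hτ : τ ∈ Set.Icc (0 : ℝ) 1) : 0 ≤ D τ := by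
  have hmono : MonotoneOn D (Set.Icc (0 : ℝ) 1) := by
    refine monotoneOn_of_deriv_nonneg (convex_Icc 0 1)
      (fun x _ => (hD x).continuousAt.continuousWithinAt)
      (fun x _ => (hD x).differentiableAt.differentiableWithinAt) fun x hx => ?_
    rw [(hD x).deriv]
    exact h x (interior_subset hx)
  have := hmono (Set.left_mem_Icc.2 zero_le_one) hτ hτ.1
  rwa [h0] at this

variable {ψ : ℝ → ℝ}

theorem hasDerivAt_primitive (hψ : Differentiable ℝ ψ) (u : ℝ) :
    HasDerivAt (fun u => ∫ v in (0 : ℝ)..u, ψ v) (ψ u) u :=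
  intervalIntegral.integral_hasDerivAt_right (hψ.continuous.intervalIntegrable _ _)
    (hψ.continuous.stronglyMeasurableAtFilter _ _) hψ.continuous.continuousAt

/-- The growth condition carries positivity of the derivative from one point to the whole line. -/
theorem monotone_of_deriv_growth (hψ : Differentiable ℝ ψ) {C : ℝ}
    (hg : ∀ h h' : ℝ, deriv ψ h ≤ deriv ψ h' * Real.exp (C * |h - h'|)) {h₀ : ℝ}
    (hpos : 0 < deriv ψ h₀) : Monotone ψ :=
  monotone_of_deriv_nonneg hψ fun h => by
    have := hpos.trans_le (hg h₀ h)
    exact (pos_of_mul_pos_left this (Real.exp_pos _).le).le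

theorem convexOn_primitive (hψ : Differentiable ℝ ψ) (hm : Monotone ψ) :
    ConvexOn ℝ Set.univ fun u => ∫ v in (0 : ℝ)..u, ψ v := by
  refine Monotone.convexOn_univ_of_deriv (fun u => (hasDerivAt_primitive hψ u).differentiableAt) ?_
  have : deriv (fun u => ∫ v in (0 : ℝ)..u, ψ v) = ψ :=
    funext fun u => (hasDerivAt_primitive hψ u).deriv
  rwa [this]

/-- Along the segment `ψ'(h + τu) ≥ C₂ (1 - C₃ τ |u|)`. Integrating twice gives `C₂ (u²/2 -
C₃|u|³/6)`, and `C₃|u| ≤ 3/2` leaves `C₂ u²/4`. Two monotonicity arguments replace the integrations,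
since `ψ'` need not be continuous. -/
theorem primitive_bregman_ge (hψ : Differentiable ℝ ψ) {C₂ C₃ : ℝ} (hC₂ : 0 < C₂)
    (hg : ∀ h h' : ℝ, deriv ψ h ≤ deriv ψ h' * Real.exp (C₃ * |h - h'|)) {h u : ℝ}
    (hh : C₂ ≤ deriv ψ h) (hu : C₃ * |u| ≤ 3 / 2) :
    C₂ / 4 * u ^ 2 ≤
      (∫ v in (0 : ℝ)..(h + u), ψ v) - (∫ v in (0 : ℝ)..h, ψ v) - ψ h * u := by
  set D' : ℝ → ℝ := fun τ => u * ψ (h + τ * u) - u * ψ h -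
    C₂ * (τ * u ^ 2 - C₃ * |u| ^ 3 * τ ^ 2 / 2) with hD'
  set D : ℝ → ℝ := fun τ => (∫ v in (0 : ℝ)..(h + τ * u), ψ v) - (∫ v in (0 : ℝ)..h, ψ v) -
    τ * (ψ h * u) - C₂ * (τ ^ 2 * u ^ 2 / 2 - C₃ * |u| ^ 3 * τ ^ 3 / 6) with hD
  have hlin : ∀ τ, HasDerivAt (fun τ : ℝ => h + τ * u) u τ := fun τ => by
    simpa using ((hasDerivAt_id τ).mul_const u).const_add h
  have h1 : ∀ τ, HasDerivAt D' (u * (deriv ψ (h + τ * u) * u) -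
      C₂ * (u ^ 2 - C₃ * |u| ^ 3 * τ)) τ := fun τ => by
    have e1 := (((hψ (h + τ * u)).hasDerivAt.comp τ (hlin τ)).const_mul u).sub_const (u * ψ h)
    have e2 := (((hasDerivAt_id τ).mul_const (u ^ 2)).sub
      ((((hasDerivAt_id τ).pow 2).const_mul (C₃ * |u| ^ 3)).div_const 2)).const_mul C₂
    refine HasDerivAt.congr_deriv (f := D') (e1.sub e2) ?_
    simp only [id]; push_cast; ring
  have h2 : ∀ τ, HasDerivAt D (D' τ) τ := fun τ => by
    have e1 := (((hasDerivAt_primitive hψ (h + τ * u)).comp τ (hlin τ)).sub_const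
      (∫ v in (0 : ℝ)..h, ψ v)).sub ((hasDerivAt_id τ).mul_const (ψ h * u))
    have e2 := (((((hasDerivAt_id τ).pow 2).mul_const (u ^ 2)).div_const 2).sub
      ((((hasDerivAt_id τ).pow 3).const_mul (C₃ * |u| ^ 3)).div_const 6)).const_mul C₂
    refine HasDerivAt.congr_deriv (f := D) (e1.sub e2) ?_
    simp only [hD', id]; push_cast; ring
  have h3 : ∀ τ ∈ Set.Icc (0 : ℝ) 1, 0 ≤ u * (deriv ψ (h + τ * u) * u) -
      C₂ * (u ^ 2 - C₃ * |u| ^ 3 * τ) := fun τ hτ => by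
    have e1 := hg h (h + τ * u)
    have e2 : |h - (h + τ * u)| = τ * |u| := by
      rw [sub_add_cancel_left, abs_neg, abs_mul, abs_of_nonneg hτ.1]
    rw [e2] at e1
    have e3 : C₂ * (1 - C₃ * (τ * |u|)) ≤ deriv ψ (h + τ * u) := by
      have e4 := Real.add_one_le_exp (-(C₃ * (τ * |u|)))
      have e5 : C₂ ≤ deriv ψ (h + τ * u) * Real.exp (C₃ * (τ * |u|)) := hh.trans e1
      calc C₂ * (1 - C₃ * (τ * |u|)) ≤ C₂ * Real.exp (-(C₃ * (τ * |u|))) := by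
            gcongr; linarith
        _ ≤ deriv ψ (h + τ * u) * Real.exp (C₃ * (τ * |u|)) * Real.exp (-(C₃ * (τ * |u|))) := by
            gcongr
        _ = _ := by rw [mul_assoc, ← Real.exp_add]; simp
    have e6 : |u| ^ 3 = |u| * u ^ 2 := by rw [pow_succ, sq_abs]; ring
    rw [e6]
    nlinarith [mul_le_mul_of_nonneg_left e3 (sq_nonneg u)]
  have h4 : ∀ τ ∈ Set.Icc (0 : ℝ) 1, 0 ≤ D' τ := fun τ hτ =>
    nonneg_of_deriv_nonneg h1 (by simp [hD']) h3 hτ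
  have h5 := nonneg_of_deriv_nonneg h2 (by simp [hD]) h4 (Set.right_mem_Icc.2 zero_le_one)
  simp only [hD, one_mul, one_pow, mul_one] at h5
  have e6 : |u| ^ 3 = |u| * u ^ 2 := by rw [pow_succ, sq_abs]; ring
  rw [e6] at h5
  nlinarith [mul_le_mul_of_nonneg_left hu (mul_nonneg hC₂.le (sq_nonneg u))]

theorem abs_sub_le_of_deriv_growth (hψ : Differentiable ℝ ψ) (hm : Monotone ψ) {C₁ C₃ : ℝ}
    (hC₃ : 0 ≤ C₃)
    (hg : ∀ h h' : ℝ, deriv ψ h ≤ deriv ψ h' * Real.exp (C₃ * |h - h'|)) {h u : ℝ}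
    (hh : deriv ψ h ≤ C₁) : |ψ (h + u) - ψ h| ≤ C₁ * Real.exp (C₃ * |u|) * |u| := by
  have := (convex_uIcc h (h + u)).norm_image_sub_le_of_norm_deriv_le (f := ψ)
    (C := C₁ * Real.exp (C₃ * |u|)) (fun x _ => hψ x) (fun x hx => ?_) Set.left_mem_uIcc
    (Set.right_mem_uIcc (a := h) (b := h + u))
  · simpa [Real.norm_eq_abs] using this
  · rw [Real.norm_eq_abs, abs_of_nonneg hm.deriv_nonneg]
    have h1 : |x - h| ≤ |u| := by
      have := Set.abs_sub_left_of_mem_uIcc hx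
      simpa using this
    calc deriv ψ x ≤ deriv ψ h * Real.exp (C₃ * |x - h|) := hg x h
      _ ≤ C₁ * Real.exp (C₃ * |u|) := by
        have := hm.deriv_nonneg (x := h)
        gcongr
        linarith

theorem abs_primitive_bregman_le (hψ : Differentiable ℝ ψ) (hm : Monotone ψ) {C₁ C₃ : ℝ}
    (hC₃ : 0 ≤ C₃)
    (hg : ∀ h h' : ℝ, deriv ψ h ≤ deriv ψ h' * Real.exp (C₃ * |h - h'|)) {h u : ℝ}
    (hh : deriv ψ h ≤ C₁) :
    |(∫ v in (0 : ℝ)..(h + u), ψ v) - (∫ v in (0 : ℝ)..h, ψ v) - ψ h * u| ≤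
      C₁ * Real.exp (C₃ * |u|) * u ^ 2 := by
  have hC₁ : 0 ≤ C₁ := hm.deriv_nonneg.trans hh
  have := (convex_uIcc h (h + u)).norm_image_sub_le_of_norm_hasDerivWithin_le
    (f := fun y => (∫ v in (0 : ℝ)..y, ψ v) - ψ h * y) (f' := fun y => ψ y - ψ h)
    (C := C₁ * Real.exp (C₃ * |u|) * |u|)
    (fun x _ => ((hasDerivAt_primitive hψ x).sub
      (by simpa using (hasDerivAt_id x).const_mul (ψ h))).hasDerivWithinAt)
    (fun x hx => ?_) Set.left_mem_uIcc (Set.right_mem_uIcc (a := h) (b := h + u))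
  · rw [Real.norm_eq_abs, Real.norm_eq_abs, add_sub_cancel_left, mul_assoc, ← sq, sq_abs] at this
    convert this using 2
    ring
  · have h1 : |x - h| ≤ |u| := by
      have := Set.abs_sub_left_of_mem_uIcc hx
      simpa using this
    have h2 := abs_sub_le_of_deriv_growth hψ hm hC₃ hg (u := x - h) hh
    rw [add_sub_cancel] at h2
    rw [Real.norm_eq_abs]
    refine h2.trans ?_
    gcongr

end Calculus

/-! ### Deterministic localization of the two penalized estimators. -/

section SampleBounds

variable {p K n : ℕ} {t : Fin K} {𝒳 : Type*}

theorem sampleMean_add (o : Fin n → Obs K 𝒳) (g h : Obs K 𝒳 → ℝ) :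
    sampleMean o (fun z => g z + h z) = sampleMean o g + sampleMean o h := by
  simp [sampleMean, Finset.sum_add_distrib, add_div]

theorem sampleMean_sub (o : Fin n → Obs K 𝒳) (g h : Obs K 𝒳 → ℝ) :
    sampleMean o (fun z => g z - h z) = sampleMean o g - sampleMean o h := by
  simp [sampleMean, Finset.sum_sub_distrib, sub_div]

theorem sampleMean_const_mul (o : Fin n → Obs K 𝒳) (a : ℝ) (g : Obs K 𝒳 → ℝ) :
    sampleMean o (fun z => a * g z) = a * sampleMean o g := by
  simp [sampleMean, ← Finset.mul_sum, mul_div_assoc]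

theorem sampleMean_sum {ι : Type*} (s : Finset ι) (o : Fin n → Obs K 𝒳) (g : ι → Obs K 𝒳 → ℝ) :
    sampleMean o (fun z => ∑ i ∈ s, g i z) = ∑ i ∈ s, sampleMean o (g i) := by
  simp only [sampleMean, ← Finset.sum_div]
  rw [Finset.sum_comm]

theorem sampleMean_const (hn : 1 ≤ n) (o : Fin n → Obs K 𝒳) (a : ℝ) :
    sampleMean o (fun _ => a) = a := by
  have : (n : ℝ) ≠ 0 := by positivity
  simp [sampleMean, this]

theorem sampleMean_mono {o : Fin n → Obs K 𝒳} {g h : Obs K 𝒳 → ℝ}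
    (hgh : ∀ i, g (o i) ≤ h (o i)) : sampleMean o g ≤ sampleMean o h :=
  div_le_div_of_nonneg_right (Finset.sum_le_sum fun i _ => hgh i) (Nat.cast_nonneg n)

theorem sampleMean_nonneg {o : Fin n → Obs K 𝒳} {g : Obs K 𝒳 → ℝ}
    (hg : ∀ i, 0 ≤ g (o i)) : 0 ≤ sampleMean o g :=
  div_nonneg (Finset.sum_nonneg fun i _ => hg i) (Nat.cast_nonneg n)

theorem R_nonneg (k : Fin K) (z : Obs K 𝒳) : 0 ≤ R k z := by unfold R; split_ifs <;> simp

theorem R_le_one (k : Fin K) (z : Obs K 𝒳) : R k z ≤ 1 := by unfold R; split_ifs <;> simp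

theorem sampleMean_sum_mul_lin (o : Fin n → Obs K 𝒳) (f : Fin (p + 1) → 𝒳 → ℝ) (b : Coef p K t)
    (h : {k : Fin K // k ≠ t} → Obs K 𝒳 → ℝ) :
    sampleMean o (fun z => ∑ k, h k z * lin f b k z.2.2) =
      ∑ k, ∑ j, b j k * sampleMean o (fun z => h k z * f j z.2.2) := by
  simp only [← sampleMean_const_mul, ← sampleMean_sum]
  congr 1
  ext z
  simp only [lin, Finset.mul_sum]
  exact Finset.sum_congr rfl fun k _ => Finset.sum_congr rfl fun j _ => by ring

theorem sum_mul_lin_sq (f : Fin (p + 1) → 𝒳 → ℝ) (b : Coef p K t)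
    (h : {k : Fin K // k ≠ t} → ℝ) (x : 𝒳) :
    ∑ k, h k * lin f b k x ^ 2 = ∑ k, ∑ i, ∑ j, b i k * (h k * (f i x * f j x)) * b j k := by
  refine Finset.sum_congr rfl fun k _ => ?_
  rw [lin, sq, Finset.sum_mul_sum, Finset.mul_sum]
  refine Finset.sum_congr rfl fun i _ => ?_
  rw [Finset.mul_sum]
  exact Finset.sum_congr rfl fun j _ => by ring

theorem sampleMean_sum_mul_lin_sq (o : Fin n → Obs K 𝒳) (f : Fin (p + 1) → 𝒳 → ℝ)
    (b : Coef p K t) (h : {k : Fin K // k ≠ t} → Obs K 𝒳 → ℝ) :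
    sampleMean o (fun z => ∑ k, h k z * lin f b k z.2.2 ^ 2) =
      ∑ k, ∑ i, ∑ j, b i k * sampleMean o (fun z => h k z * (f i z.2.2 * f j z.2.2)) * b j k := by
  simp only [sum_mul_lin_sq, mul_comm _ (b _ _), ← sampleMean_const_mul, ← sampleMean_sum]

/-- `R^{(t)} exp(γ_kᵀ f(X))`. -/
noncomputable def oddsWeight (f : Fin (p + 1) → 𝒳 → ℝ) (γ : Coef p K t)
    (k : {k : Fin K // k ≠ t}) (z : Obs K 𝒳) : ℝ :=
  R t z * Real.exp (lin f γ k z.2.2)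

/-- The residual `Y - ψ(α^{(k)ᵀ} f(X))`. -/
noncomputable def outcomeResid (ψ : ℝ → ℝ) (f : Fin (p + 1) → 𝒳 → ℝ) (α : Coef p K t)
    (k : {k : Fin K // k ≠ t}) (z : Obs K 𝒳) : ℝ :=
  z.1 - ψ (lin f α k z.2.2)

/-- The sample quadratic form `Ẽ ∑_k R^{(t)} exp(γ_kᵀ f) (b_kᵀ f)²`. -/
noncomputable def gramForm (o : Fin n → Obs K 𝒳) (f : Fin (p + 1) → 𝒳 → ℝ) (γ b : Coef p K t) : ℝ :=
  sampleMean o fun z => ∑ k, oddsWeight f γ k z * lin f b k z.2.2 ^ 2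

/-- The gradient of the sample calibration loss. -/
noncomputable def calScore (o : Fin n → Obs K 𝒳) (f : Fin (p + 1) → 𝒳 → ℝ) (γ : Coef p K t) :
    Coef p K t :=
  fun j k => sampleMean o fun z => (oddsWeight f γ k z - R k.1 z) * f j z.2.2

/-- Minus the gradient of the sample weighted likelihood loss. -/
noncomputable def wlScore (ψ : ℝ → ℝ) (o : Fin n → Obs K 𝒳) (f : Fin (p + 1) → 𝒳 → ℝ)
    (γ α : Coef p K t) : Coef p K t :=
  fun j k => sampleMean o fun z => (oddsWeight f γ k z * outcomeResid ψ f α k z) * f j z.2.2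

/-- `Ẽ ∑_k R^{(t)} exp(γ_kᵀ f) W_k² (b_kᵀ f)²` with residuals `W_k`. -/
noncomputable def residualForm (ψ : ℝ → ℝ) (o : Fin n → Obs K 𝒳) (f : Fin (p + 1) → 𝒳 → ℝ)
    (γ α b : Coef p K t) : ℝ :=
  sampleMean o fun z =>
    ∑ k, (oddsWeight f γ k z * outcomeResid ψ f α k z ^ 2) * lin f b k z.2.2 ^ 2

theorem oddsWeight_nonneg (f : Fin (p + 1) → 𝒳 → ℝ) (γ : Coef p K t) (k : {k : Fin K // k ≠ t})
    (z : Obs K 𝒳) : 0 ≤ oddsWeight f γ k z :=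
  mul_nonneg (R_nonneg _ _) (Real.exp_pos _).le

theorem gramForm_nonneg (o : Fin n → Obs K 𝒳) (f : Fin (p + 1) → 𝒳 → ℝ) (γ b : Coef p K t) :
    0 ≤ gramForm o f γ b :=
  sampleMean_nonneg fun _ => Finset.sum_nonneg fun _ _ =>
    mul_nonneg (oddsWeight_nonneg _ _ _ _) (sq_nonneg _)

theorem residualForm_nonneg (ψ : ℝ → ℝ) (o : Fin n → Obs K 𝒳) (f : Fin (p + 1) → 𝒳 → ℝ)
    (γ α b : Coef p K t) : 0 ≤ residualForm ψ o f γ α b :=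
  sampleMean_nonneg fun _ => Finset.sum_nonneg fun _ _ =>
    mul_nonneg (mul_nonneg (oddsWeight_nonneg _ _ _ _) (sq_nonneg _)) (sq_nonneg _)

theorem oddsWeight_add (f : Fin (p + 1) → 𝒳 → ℝ) (γ b : Coef p K t) (k : {k : Fin K // k ≠ t})
    (z : Obs K 𝒳) :
    oddsWeight f (γ + b) k z = oddsWeight f γ k z * Real.exp (lin f b k z.2.2) := by
  rw [oddsWeight, oddsWeight, lin_add, Real.exp_add, mul_assoc]

/-- The linear part of the increment is the score paired with `b`, bounded by duality; the rest is
`w_k (e^u - 1 - u)`, which supplies the curvature. -/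
theorem sampleMean_calLoss_sub_ge {o : Fin n → Obs K 𝒳} {f : Fin (p + 1) → 𝒳 → ℝ} {B a lam : ℝ}
    (hB : ∀ i j, |f j (o i).2.2| ≤ B) {γ : Coef p K t}
    (hG : ∀ j, rowNorm (calScore o f γ) j ≤ lam) (b : Coef p K t) (hb : B * norm21 b ≤ a)
    (ha : a ≤ 1) :
    (1 - a / 3) / 2 * gramForm o f γ b - lam * norm21 b ≤
      sampleMean o (calLoss f (γ + b)) - sampleMean o (calLoss f γ) := by
  have hnoise := (abs_le.1 (abs_sum_mul_le_of_rowNorm_le hG b)).1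
  have e := sampleMean_sum_mul_lin o f b (fun k z => oddsWeight f γ k z - R k.1 z)
  simp only [calScore] at hnoise
  rw [← e] at hnoise
  rw [← sampleMean_sub]
  have hle : sampleMean o (fun z => (1 - a / 3) / 2 *
      (∑ k, oddsWeight f γ k z * lin f b k z.2.2 ^ 2) +
      ∑ k, (oddsWeight f γ k z - R k.1 z) * lin f b k z.2.2) ≤
      sampleMean o (fun z => calLoss f (γ + b) z - calLoss f γ z) := by
    refine sampleMean_mono fun i => ?_
    rw [Finset.mul_sum, ← Finset.sum_add_distrib, calLoss, calLoss, ← Finset.sum_sub_distrib]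
    refine Finset.sum_le_sum fun k _ => ?_
    have h1 := exp_sub_one_sub_ge ((abs_lin_le (hB i) b k).trans hb) ha
    have h2 := mul_le_mul_of_nonneg_left h1 (oddsWeight_nonneg f γ k (o i))
    have h3 := oddsWeight_add f γ b k (o i)
    rw [oddsWeight] at h3
    rw [h3, lin_add]
    have h4 : R t (o i) * Real.exp (lin f γ k (o i).2.2) = oddsWeight f γ k (o i) := rfl
    rw [h4]
    linarith
  rw [sampleMean_add, sampleMean_const_mul] at hle
  have : gramForm o f γ b =
    sampleMean o (fun z => ∑ k, oddsWeight f γ k z * lin f b k z.2.2 ^ 2) := rfl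
  rw [this]
  linarith

theorem convexOn_sampleMean {o : Fin n → Obs K 𝒳} {L : Coef p K t → Obs K 𝒳 → ℝ}
    (h : ∀ z, ConvexOn ℝ Set.univ fun g => L g z) :
    ConvexOn ℝ Set.univ fun g => sampleMean o (L g) := by
  refine ⟨convex_univ, fun a _ b _ u v hu hv huv => ?_⟩
  simp only [smul_eq_mul, ← sampleMean_const_mul, ← sampleMean_add]
  exact sampleMean_mono fun i => (h (o i)).2 (Set.mem_univ a) (Set.mem_univ b) hu hv huv

theorem continuous_sampleMean {o : Fin n → Obs K 𝒳} {L : Coef p K t → Obs K 𝒳 → ℝ}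
    (h : ∀ z, Continuous fun g => L g z) : Continuous fun g => sampleMean o (L g) :=
  (continuous_finsetSum _ fun i _ => h (o i)).div_const _

theorem convexOn_comp_lin {φ : ℝ → ℝ} (hφ : ConvexOn ℝ Set.univ φ) (f : Fin (p + 1) → 𝒳 → ℝ)
    (k : {k : Fin K // k ≠ t}) (x : 𝒳) :
    ConvexOn ℝ Set.univ fun g : Coef p K t => φ (lin f g k x) := by
  refine ⟨convex_univ, fun a _ b _ u v hu hv huv => ?_⟩
  simp only [lin_add, lin_smul]
  exact hφ.2 (Set.mem_univ _) (Set.mem_univ _) hu hv huv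

theorem convexOn_finset_sum {ι : Type*} (s : Finset ι) {F : ι → Coef p K t → ℝ}
    (h : ∀ i ∈ s, ConvexOn ℝ Set.univ (F i)) : ConvexOn ℝ Set.univ fun g => ∑ i ∈ s, F i g := by
  refine ⟨convex_univ, fun a _ b _ u v hu hv huv => ?_⟩
  simp only [smul_eq_mul, Finset.mul_sum, ← Finset.sum_add_distrib]
  exact Finset.sum_le_sum fun i hi => (h i hi).2 (Set.mem_univ a) (Set.mem_univ b) hu hv huv

theorem continuous_lin (f : Fin (p + 1) → 𝒳 → ℝ) (k : {k : Fin K // k ≠ t}) (x : 𝒳) :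
    Continuous fun g : Coef p K t => lin f g k x := by
  unfold lin; fun_prop

theorem convexOn_calLoss (f : Fin (p + 1) → 𝒳 → ℝ) (z : Obs K 𝒳) :
    ConvexOn ℝ Set.univ fun g : Coef p K t => calLoss f g z := by
  refine convexOn_finset_sum _ fun k _ => ?_
  refine convexOn_comp_lin (φ := fun u => R t z * Real.exp u - R k.1 z * u) ?_ f k z.2.2
  refine ⟨convex_univ, fun a _ b _ u v hu hv huv => ?_⟩
  have := mul_le_mul_of_nonneg_left
    (convexOn_exp.2 (Set.mem_univ a) (Set.mem_univ b) hu hv huv) (R_nonneg t z)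
  simp only [smul_eq_mul] at this ⊢
  linarith

theorem continuous_calLoss (f : Fin (p + 1) → 𝒳 → ℝ) (z : Obs K 𝒳) :
    Continuous fun g : Coef p K t => calLoss f g z := by
  have := fun k => continuous_lin (t := t) f k z.2.2
  unfold calLoss
  fun_prop

theorem convexOn_wlLoss {ψ : ℝ → ℝ} (hψ : Differentiable ℝ ψ) (hm : Monotone ψ)
    (f : Fin (p + 1) → 𝒳 → ℝ) (γ : Coef p K t) (z : Obs K 𝒳) :
    ConvexOn ℝ Set.univ fun g : Coef p K t => wlLoss ψ f γ g z := by
  refine convexOn_finset_sum _ fun k _ => ?_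
  refine convexOn_comp_lin (φ := fun u => R t z * Real.exp (lin f γ k z.2.2) *
    (-(z.1 * u) + ∫ v in (0 : ℝ)..u, ψ v)) ?_ f k z.2.2
  refine ⟨convex_univ, fun a _ b _ u v hu hv huv => ?_⟩
  have := mul_le_mul_of_nonneg_left
    ((convexOn_primitive hψ hm).2 (Set.mem_univ a) (Set.mem_univ b) hu hv huv)
    (oddsWeight_nonneg f γ k z)
  simp only [smul_eq_mul, oddsWeight] at this ⊢
  linarith

theorem continuous_wlLoss {ψ : ℝ → ℝ} (hψ : Differentiable ℝ ψ)
    (f : Fin (p + 1) → 𝒳 → ℝ) (γ : Coef p K t) (z : Obs K 𝒳) :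
    Continuous fun g : Coef p K t => wlLoss ψ f γ g z := by
  have h1 := fun k => continuous_lin (t := t) f k z.2.2
  have h2 : Continuous fun u => ∫ v in (0 : ℝ)..u, ψ v :=
    continuous_iff_continuousAt.2 fun u => (hasDerivAt_primitive hψ u).continuousAt
  have h3 := fun k => h2.comp (h1 k)
  simp only [Function.comp_def] at h3
  unfold wlLoss
  fun_prop

/-- Existence and localization of the regularized calibrated estimator. -/
theorem isRCAL_localization {o : Fin n → Obs K 𝒳} {f : Fin (p + 1) → 𝒳 → ℝ}
    {B lam A ξ κ r : ℝ} (hB0 : 0 ≤ B) (hB : ∀ i j, |f j (o i).2.2| ≤ B) {γ : Coef p K t}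
    (hG : ∀ j, rowNorm (calScore o f γ) j ≤ lam) (hlam : 0 < lam) (hA : 1 < A)
    (hAξ : 2 * A < (ξ + 1) * (A - 1)) (hκ : 0 < κ)
    (hcone : ∀ b, norm21 b ≤ (1 + ξ) * supportNorm γ b →
      κ * supportNorm γ b ^ 2 ≤ gramForm o f γ b)
    (hr : 0 < r) (hBr : B * r ≤ 1) (hrA : 3 * A ^ 2 * lam < (A - 1) * κ * r) :
    (∃ γ', IsRCAL f (A * lam) o γ' (t := t)) ∧ ∀ γ', IsRCAL f (A * lam) o γ' →
      norm21 (γ' - γ) ≤ r ∧ gramForm o f γ (γ' - γ) ≤ 6 * A * lam * r ∧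
      κ * (1 - B * r / 3) ^ 2 * gramForm o f γ (γ' - γ) ≤ 16 * A ^ 2 * lam ^ 2 := by
  have hBr0 : 0 ≤ B * r := mul_nonneg hB0 hr.le
  have hbasic : ∀ b, norm21 b ≤ r →
      (1 - B * r / 3) / 2 * gramForm o f γ b + (A - 1) * lam * norm21 b -
        2 * A * lam * supportNorm γ b ≤
      (sampleMean o (calLoss f (γ + b)) + A * lam * penalty (γ + b)) -
        (sampleMean o (calLoss f γ) + A * lam * penalty γ) := fun b hb => by
    have h1 := sampleMean_calLoss_sub_ge hB hG b (mul_le_mul_of_nonneg_left hb hB0) hBr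
    have h2 := mul_le_mul_of_nonneg_left (penalty_add_sub_ge γ b)
      (mul_nonneg (by linarith : (0 : ℝ) ≤ A) hlam.le)
    linarith
  -- Either `b` lies in the cone where compatibility applies, or the penalty alone dominates,
  -- because `2A < (ξ + 1)(A - 1)`.
  have hcoef : ∀ b, norm21 b ≤ (1 + ξ) * supportNorm γ b ∨
      2 * A * lam * supportNorm γ b ≤ (A - 1) * lam * norm21 b ∧
      (0 < norm21 b → 2 * A * lam * supportNorm γ b < (A - 1) * lam * norm21 b) := fun b => by
    rcases le_or_gt (norm21 b) ((1 + ξ) * supportNorm γ b) with h | h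
    · exact Or.inl h
    · right
      have hv := supportNorm_nonneg γ b
      have h1 : 2 * A * supportNorm γ b ≤ (ξ + 1) * (A - 1) * supportNorm γ b :=
        mul_le_mul_of_nonneg_right hAξ.le hv
      have h2 : (A - 1) * ((1 + ξ) * supportNorm γ b) < (A - 1) * norm21 b :=
        mul_lt_mul_of_pos_left h (by linarith)
      have h3 : 2 * A * supportNorm γ b < (A - 1) * norm21 b := by linarith
      have h4 := mul_lt_mul_of_pos_left h3 hlam
      exact ⟨by linarith, fun _ => by linarith⟩
  have hpen : Continuous fun g : Coef p K t => penalty g := continuous_penalty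
  have hconv : ConvexOn ℝ Set.univ fun g : Coef p K t =>
      sampleMean o (calLoss f g) + A * lam * penalty g :=
    (convexOn_sampleMean fun z => convexOn_calLoss f z).add
      (convexOn_penalty.smul (mul_nonneg (by linarith) hlam.le))
  have hcont : Continuous fun g : Coef p K t => sampleMean o (calLoss f g) + A * lam * penalty g :=
    (continuous_sampleMean fun z => continuous_calLoss f z).add (hpen.const_mul _)
  obtain ⟨hex, hball⟩ := exists_minimizer_of_lt_on_sphere hconv hcont (g := γ) hr fun b hb => by
    refine sub_pos.1 (lt_of_lt_of_le ?_ (hbasic b hb.le))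
    have hQ := gramForm_nonneg o f γ b
    rcases hcoef b with h | ⟨-, h⟩
    · have hc := hcone b h
      rw [hb]
      set v := supportNorm γ b
      set Q := gramForm o f γ b
      have h1 : κ * v ^ 2 / 3 ≤ (1 - B * r / 3) / 2 * Q := by nlinarith
      -- Completing the square in `κ v` leaves the deficit `3A² lam²/κ`, which is what the lower
      -- bound imposed on `r` pays for.
      have h2 : 0 < κ * v ^ 2 / 3 + (A - 1) * lam * r - 2 * A * lam * v := by
        refine pos_of_mul_pos_right (a := κ) ?_ hκ.le
        nlinarith [sq_nonneg (κ * v - 3 * A * lam), mul_lt_mul_of_pos_left hrA hlam]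
      linarith
    · have h1 := h (hb ▸ hr)
      have h2 : 0 ≤ (1 - B * r / 3) / 2 * gramForm o f γ b := mul_nonneg (by linarith) hQ
      linarith
  refine ⟨hex, fun γ' hγ' => ?_⟩
  have hN := hball γ' hγ'
  refine ⟨hN, ?_⟩
  have h0 := hbasic (γ' - γ) hN
  rw [add_sub_cancel] at h0
  have h1 := hγ' γ
  set b := γ' - γ
  have hQ := gramForm_nonneg o f γ b
  have hN0 := norm21_nonneg b
  have hv0 := supportNorm_nonneg γ b
  have hvN := supportNorm_le_norm21 γ b
  have hr0 : 0 ≤ 6 * A * lam * r := by positivity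
  have hA0 : 0 ≤ (A - 1) * lam * norm21 b :=
    mul_nonneg (mul_nonneg (by linarith) hlam.le) hN0
  have hc3 : 1 / 3 ≤ (1 - B * r / 3) / 2 := by linarith
  rcases hcoef b with h | ⟨h, -⟩
  · have hc := hcone b h
    set v := supportNorm γ b
    set Q := gramForm o f γ b
    have h2 : (1 - B * r / 3) / 2 * Q ≤ 2 * A * lam * v := by linarith
    have h3 : 2 * A * lam * v ≤ 2 * A * lam * r :=
      mul_le_mul_of_nonneg_left (hvN.trans hN) (by positivity)
    refine ⟨by nlinarith, ?_⟩
    -- The sharper Gram bound: square the basic inequality, use `κ v² ≤ Q` on the cone, and divide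
    -- by `Q`.
    rcases hQ.eq_or_lt with hQ0 | hQ0
    · rw [← hQ0]; simp; positivity
    · have h4 : ((1 - B * r / 3) / 2 * Q) ^ 2 ≤ (2 * A * lam * v) ^ 2 :=
        pow_le_pow_left₀ (by positivity) h2 2
      have h5 : κ * ((1 - B * r / 3) / 2 * Q) ^ 2 ≤ 4 * A ^ 2 * lam ^ 2 * Q := by
        calc κ * ((1 - B * r / 3) / 2 * Q) ^ 2 ≤ κ * (2 * A * lam * v) ^ 2 :=
              mul_le_mul_of_nonneg_left h4 hκ.le
          _ = 4 * A ^ 2 * lam ^ 2 * (κ * v ^ 2) := by ring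
          _ ≤ _ := mul_le_mul_of_nonneg_left hc (by positivity)
      refine le_of_mul_le_mul_right ?_ hQ0
      nlinarith
  · have h2 : (1 - B * r / 3) / 2 * gramForm o f γ b ≤ 0 := by linarith
    have h3 : gramForm o f γ b ≤ 0 := by nlinarith
    have h4 : gramForm o f γ b = 0 := le_antisymm h3 hQ
    rw [h4]
    exact ⟨hr0, by rw [mul_zero]; positivity⟩

/-- With the weights taken at `γ + d`, the noise term is the score at `γ` plus a cross term `w
(e^{d_k} - 1) W u`. Young's inequality charges a fraction `θ` of the curvature for it and puts the
remainder into the residual-weighted form of `d`. -/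
theorem wlLoss_sub_ge {ψ : ℝ → ℝ} (hψ : Differentiable ℝ ψ) {f : Fin (p + 1) → 𝒳 → ℝ}
    {a C₂ C₃ θ : ℝ} (hC₂ : 0 < C₂) (hθ : 0 < θ)
    (hg : ∀ h h' : ℝ, deriv ψ h ≤ deriv ψ h' * Real.exp (C₃ * |h - h'|)) {z : Obs K 𝒳}
    (γ d α b : Coef p K t) (hd : ∀ k, |lin f d k z.2.2| ≤ a)
    (hα : ∀ k, C₂ ≤ deriv ψ (lin f α k z.2.2)) (hb : ∀ k, C₃ * |lin f b k z.2.2| ≤ 3 / 2) :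
    (1 - θ) * (Real.exp (-a) * C₂ / 4) *
        (∑ k, oddsWeight f γ k z * lin f b k z.2.2 ^ 2) -
      Real.exp (3 * a) / (θ * C₂) *
        (∑ k, (oddsWeight f γ k z * outcomeResid ψ f α k z ^ 2) * lin f d k z.2.2 ^ 2) -
      ∑ k, (oddsWeight f γ k z * outcomeResid ψ f α k z) * lin f b k z.2.2 ≤
    wlLoss ψ f (γ + d) (α + b) z - wlLoss ψ f (γ + d) α z := by
  rw [Finset.mul_sum, Finset.mul_sum, ← Finset.sum_sub_distrib, ← Finset.sum_sub_distrib,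
    wlLoss, wlLoss, ← Finset.sum_sub_distrib]
  refine Finset.sum_le_sum fun k _ => ?_
  have hw := oddsWeight_add f γ d k z
  rw [oddsWeight] at hw
  rw [hw, lin_add f α b]
  have hbreg := primitive_bregman_ge hψ hC₂ hg (hα k) (hb k)
  have hw0 := oddsWeight_nonneg f γ k z
  have hrd : z.1 = outcomeResid ψ f α k z + ψ (lin f α k z.2.2) := by rw [outcomeResid]; ring
  rw [hrd]
  set w := oddsWeight f γ k z
  set W := outcomeResid ψ f α k z
  set u := lin f b k z.2.2
  set h := lin f α k z.2.2
  set dk := lin f d k z.2.2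
  set I₁ := ∫ v in (0 : ℝ)..(h + u), ψ v
  set I₀ := ∫ v in (0 : ℝ)..h, ψ v
  have hdk := abs_le.1 (hd k)
  have e1 : Real.exp (-a) * (C₂ / 4 * u ^ 2) ≤ Real.exp dk * (I₁ - I₀ - ψ h * u) :=
    mul_le_mul (Real.exp_le_exp.2 hdk.1) hbreg (by positivity) (Real.exp_pos _).le
  have e2 : (Real.exp dk - 1) ^ 2 ≤ dk ^ 2 * Real.exp (2 * a) := by
    rw [← sq_abs (Real.exp dk - 1)]
    calc |Real.exp dk - 1| ^ 2 ≤ (|dk| * Real.exp |dk|) ^ 2 :=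
          pow_le_pow_left₀ (abs_nonneg _) (abs_exp_sub_one_le dk) 2
      _ = dk ^ 2 * Real.exp (2 * |dk|) := by
          rw [mul_pow, sq_abs, ← Real.exp_nat_mul]; norm_num
      _ ≤ _ := by gcongr; exact hd k
  have hexp : Real.exp (3 * a) = Real.exp (2 * a) * Real.exp a := by
    rw [← Real.exp_add]; congr 1; ring
  have hinv : Real.exp a * Real.exp (-a) = 1 := by rw [← Real.exp_add]; simp
  -- The factor `e^{3a}` combines `e^{2a}` from `(e^{d_k} - 1)²` with `e^{a}`, the inverse of the
  -- lower bound `e^{-a}` of the perturbed weight in the curvature.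
  have e3 : (Real.exp dk - 1) * W * u ≤ θ * (Real.exp (-a) * C₂ / 4) * u ^ 2 +
      Real.exp (3 * a) / (θ * C₂) * (W ^ 2 * dk ^ 2) := by
    have hc0 : 0 < θ * (Real.exp (-a) * C₂ / 4) := by positivity
    set q := θ * (Real.exp (-a) * C₂ / 4) with hq
    have e4 : (Real.exp dk - 1) * W * u ≤ q * u ^ 2 + ((Real.exp dk - 1) * W) ^ 2 / (4 * q) := by
      rw [← sub_nonneg]
      have : q * u ^ 2 + ((Real.exp dk - 1) * W) ^ 2 / (4 * q) - (Real.exp dk - 1) * W * u =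
          (2 * q * u - (Real.exp dk - 1) * W) ^ 2 / (4 * q) := by field_simp; ring
      rw [this]; positivity
    have e5 : ((Real.exp dk - 1) * W) ^ 2 / (4 * q) ≤
        Real.exp (3 * a) / (θ * C₂) * (W ^ 2 * dk ^ 2) := by
      have e6 : 1 / (4 * q) = Real.exp a / (θ * C₂) := by
        rw [hq, div_eq_div_iff (by positivity) (by positivity)]
        linear_combination (-(θ * C₂)) * hinv
      rw [div_eq_mul_one_div, e6, mul_pow, hexp]
      have : (Real.exp dk - 1) ^ 2 * W ^ 2 ≤ dk ^ 2 * Real.exp (2 * a) * W ^ 2 :=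
        mul_le_mul_of_nonneg_right e2 (sq_nonneg _)
      calc _ ≤ dk ^ 2 * Real.exp (2 * a) * W ^ 2 * (Real.exp a / (θ * C₂)) :=
            mul_le_mul_of_nonneg_right this (by positivity)
        _ = _ := by ring
    linarith
  have e7 : (1 - θ) * (Real.exp (-a) * C₂ / 4) * u ^ 2 -
      Real.exp (3 * a) / (θ * C₂) * (W ^ 2 * dk ^ 2) - W * u ≤
      Real.exp dk * (-(W * u) + (I₁ - I₀ - ψ h * u)) := by linarith
  have e8 := mul_le_mul_of_nonneg_left e7 hw0
  linarith

/-- Existence and localization of the regularized weighted likelihood estimator. -/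
theorem isRWL_localization {ψ : ℝ → ℝ} (hψ : Differentiable ℝ ψ) (hm : Monotone ψ)
    {o : Fin n → Obs K 𝒳} {f : Fin (p + 1) → 𝒳 → ℝ}
    {B a C₂ C₃ lam A ξ κ θ r : ℝ} (hB : ∀ i j, |f j (o i).2.2| ≤ B)
    (hC₂ : 0 < C₂) (hC₃ : 0 ≤ C₃)
    (hg : ∀ h h' : ℝ, deriv ψ h ≤ deriv ψ h' * Real.exp (C₃ * |h - h'|))
    {γ d α : Coef p K t} (hd : B * norm21 d ≤ a)
    (hα : ∀ i k, C₂ ≤ deriv ψ (lin f α k (o i).2.2))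
    (hG : ∀ j, rowNorm (wlScore ψ o f γ α) j ≤ lam) (hlam : 0 < lam) (hA : 1 < A) (hξ : 0 < ξ)
    (hθ : θ = 1 - 2 * A / ((ξ + 1) * (A - 1))) (hθ0 : 0 < θ) (hκ : 0 < κ)
    (hcone : ∀ b, norm21 b ≤ (1 + ξ) * supportNorm α b →
      κ * supportNorm α b ^ 2 ≤ gramForm o f γ b)
    (hr : 0 < r) (hBr : C₃ * (B * r) ≤ 3 / 2)
    (hrA : 4 * Real.exp a * A ^ 2 * lam ^ 2 / ((1 - θ) * C₂ * κ) +
      Real.exp (3 * a) / (θ * C₂) * residualForm ψ o f γ α d < (A - 1) * lam * r) :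
    (∃ α', IsRWL ψ f (A * lam) o (γ + d) α') ∧ ∀ α', IsRWL ψ f (A * lam) o (γ + d) α' →
      norm21 (α' - α) ≤ r := by
  have hθ1 : θ < 1 := by
    rw [hθ]; have : 0 < 2 * A / ((ξ + 1) * (A - 1)) := by
      have : 0 < A - 1 := by linarith
      positivity
    linarith
  have hH := residualForm_nonneg ψ o f γ α d
  have hbasic : ∀ b, norm21 b = r → ∀ τ : ℝ, 0 < τ →
      (1 - τ) * (Real.exp (-a) * C₂ / 4) * gramForm o f γ b -
        Real.exp (3 * a) / (τ * C₂) * residualForm ψ o f γ α d +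
        (A - 1) * lam * r - 2 * A * lam * supportNorm α b ≤
      (sampleMean o (wlLoss ψ f (γ + d) (α + b)) + A * lam * penalty (α + b)) -
        (sampleMean o (wlLoss ψ f (γ + d) α) + A * lam * penalty α) := fun b hb τ hτ => by
    have hnoise := (abs_le.1 (abs_sum_mul_le_of_rowNorm_le hG b)).2
    have e := sampleMean_sum_mul_lin o f b (fun k z => oddsWeight f γ k z * outcomeResid ψ f α k z)
    simp only [wlScore] at hnoise
    rw [← e] at hnoise
    have h1 : sampleMean o (fun z => (1 - τ) * (Real.exp (-a) * C₂ / 4) *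
        (∑ k, oddsWeight f γ k z * lin f b k z.2.2 ^ 2) -
      Real.exp (3 * a) / (τ * C₂) *
        (∑ k, (oddsWeight f γ k z * outcomeResid ψ f α k z ^ 2) * lin f d k z.2.2 ^ 2) -
      ∑ k, (oddsWeight f γ k z * outcomeResid ψ f α k z) * lin f b k z.2.2) ≤
      sampleMean o (fun z => wlLoss ψ f (γ + d) (α + b) z - wlLoss ψ f (γ + d) α z) :=
      sampleMean_mono fun i => wlLoss_sub_ge hψ hC₂ hτ hg γ d α b
        (fun k => (abs_lin_le (hB i) d k).trans hd) (hα i) fun k => by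
          refine le_trans (mul_le_mul_of_nonneg_left ?_ hC₃) hBr
          rw [← hb]
          exact abs_lin_le (hB i) b k
    rw [sampleMean_sub, sampleMean_sub, sampleMean_sub, sampleMean_const_mul,
      sampleMean_const_mul] at h1
    have h2 := mul_le_mul_of_nonneg_left (penalty_add_sub_ge α b)
      (mul_nonneg (by linarith : (0 : ℝ) ≤ A) hlam.le)
    rw [hb] at h2 hnoise
    simp only [gramForm, residualForm]
    linarith
  have hconv : ConvexOn ℝ Set.univ fun g : Coef p K t =>
      sampleMean o (wlLoss ψ f (γ + d) g) + A * lam * penalty g :=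
    (convexOn_sampleMean fun z => convexOn_wlLoss hψ hm f _ z).add
      (convexOn_penalty.smul (mul_nonneg (by linarith) hlam.le))
  have hpen : Continuous fun g : Coef p K t => penalty g := continuous_penalty
  have hcont : Continuous fun g : Coef p K t =>
      sampleMean o (wlLoss ψ f (γ + d) g) + A * lam * penalty g :=
    (continuous_sampleMean fun z => continuous_wlLoss hψ f _ z).add (hpen.const_mul _)
  refine exists_minimizer_of_lt_on_sphere hconv hcont hr fun b hb => ?_
  refine sub_pos.1 ?_
  have hv := supportNorm_nonneg α b
  have hAp : 0 < A - 1 := by linarith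
  -- In the cone the Young parameter is `θ`, which keeps the curvature `1 - θ`. Outside it is `1`:
  -- all curvature is given up, the residual form costs only the fraction `θ` of its previous bound,
  -- and the definition of `θ` makes the support term cost at most the fraction `1 - θ` of the
  -- penalty gain.
  rcases le_or_gt (norm21 b) ((1 + ξ) * supportNorm α b) with h | h
  · refine lt_of_lt_of_le ?_ (hbasic b hb θ hθ0)
    have hc := hcone b h
    set v := supportNorm α b
    set Q := gramForm o f γ b
    set c := (1 - θ) * (Real.exp (-a) * C₂ / 4) with hcdef
    have hc0 : 0 < c := by
      have : 0 < 1 - θ := by linarith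
      positivity
    have h1 : c * (κ * v ^ 2) ≤ c * Q := mul_le_mul_of_nonneg_left hc hc0.le
    have hinv : Real.exp a * Real.exp (-a) = 1 := by rw [← Real.exp_add]; simp
    have h2 : 4 * Real.exp a * A ^ 2 * lam ^ 2 / ((1 - θ) * C₂ * κ) =
        A ^ 2 * lam ^ 2 / (c * κ) := by
      have : 0 < 1 - θ := by linarith
      rw [hcdef, div_eq_div_iff (by positivity) (by positivity)]
      linear_combination A ^ 2 * lam ^ 2 * (1 - θ) * C₂ * κ * hinv
    have h3 : 2 * A * lam * v ≤ c * (κ * v ^ 2) + A ^ 2 * lam ^ 2 / (c * κ) := by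
      rw [← sub_nonneg]
      have : c * (κ * v ^ 2) + A ^ 2 * lam ^ 2 / (c * κ) - 2 * A * lam * v =
          (c * κ * v - A * lam) ^ 2 / (c * κ) := by field_simp; ring
      rw [this]; positivity
    rw [h2] at hrA
    linarith
  · refine lt_of_lt_of_le ?_ (hbasic b hb 1 one_pos)
    rw [hb] at h
    have h1 : 2 * A * lam * supportNorm α b ≤ (1 - θ) * ((A - 1) * lam * r) := by
      have h2 : (1 - θ) * (A - 1) * (1 + ξ) = 2 * A := by
        rw [hθ]; field_simp; ring
      have h3 : 0 ≤ (1 - θ) * (A - 1) * lam :=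
        mul_nonneg (mul_nonneg (by linarith) hAp.le) hlam.le
      calc 2 * A * lam * supportNorm α b
          = (1 - θ) * (A - 1) * lam * ((1 + ξ) * supportNorm α b) := by rw [← h2]; ring
        _ ≤ (1 - θ) * (A - 1) * lam * r := mul_le_mul_of_nonneg_left h.le h3
        _ = _ := by ring
    have h4 : Real.exp (3 * a) / (1 * C₂) * residualForm ψ o f γ α d =
        θ * (Real.exp (3 * a) / (θ * C₂) * residualForm ψ o f γ α d) := by field_simp
    have h5 : 0 < 4 * Real.exp a * A ^ 2 * lam ^ 2 / ((1 - θ) * C₂ * κ) := by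
      have : 0 < 1 - θ := by linarith
      positivity
    have h6 : θ * (Real.exp (3 * a) / (θ * C₂) * residualForm ψ o f γ α d) <
        θ * ((A - 1) * lam * r) := mul_lt_mul_of_pos_left (by linarith) hθ0
    rw [h4]
    linarith

end SampleBounds

/-! ### Change of the estimating function and of its sample variance. -/

section VarianceComparison

variable {p K n : ℕ} {t : Fin K} {𝒳 : Type*}

theorem linAll_of_ne (f : Fin (p + 1) → 𝒳 → ℝ) (γ : Coef p K t) (k : {k : Fin K // k ≠ t}) (x : 𝒳) :
    linAll f γ k.1 x = lin f γ k x := by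
  simp [linAll, k.2]

theorem linAll_self (f : Fin (p + 1) → 𝒳 → ℝ) (γ : Coef p K t) (x : 𝒳) : linAll f γ t x = 0 := by
  simp [linAll]

theorem sum_exp_linAll (f : Fin (p + 1) → 𝒳 → ℝ) (γ : Coef p K t) (x : 𝒳) :
    ∑ l, Real.exp (linAll f γ l x) = 1 + ∑ k : {k : Fin K // k ≠ t}, Real.exp (lin f γ k x) := by
  rw [Fintype.sum_eq_add_sum_subtype_ne _ t, linAll_self, Real.exp_zero]
  simp only [linAll_of_ne]

theorem oddsRatio_eq_exp (f : Fin (p + 1) → 𝒳 → ℝ) (γ : Coef p K t) (k : {k : Fin K // k ≠ t})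
    (x : 𝒳) : oddsRatio f γ k.1 x = Real.exp (lin f γ k x) := by
  have : 0 < ∑ l, Real.exp (linAll f γ l x) := by rw [sum_exp_linAll]; positivity
  rw [oddsRatio, propScore, propScore, linAll_self, linAll_of_ne, Real.exp_zero]
  field_simp

theorem R_mul_oddsRatio (f : Fin (p + 1) → 𝒳 → ℝ) (γ : Coef p K t) (k : {k : Fin K // k ≠ t})
    (z : Obs K 𝒳) : R t z * oddsRatio f γ k.1 z.2.2 = oddsWeight f γ k z := by
  rw [oddsRatio_eq_exp, oddsWeight]

theorem inv_propScore_eq (f : Fin (p + 1) → 𝒳 → ℝ) (γ : Coef p K t) (x : 𝒳) :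
    (propScore f γ t x)⁻¹ = 1 + ∑ k : {k : Fin K // k ≠ t}, Real.exp (lin f γ k x) := by
  rw [propScore, linAll_self, Real.exp_zero, one_div, inv_inv, sum_exp_linAll]

theorem sum_oddsWeight_le {f : Fin (p + 1) → 𝒳 → ℝ} {γ : Coef p K t} {z : Obs K 𝒳} {B₁ : ℝ}
    (h : ∑ k : {k : Fin K // k ≠ t}, Real.exp (lin f γ k z.2.2) ≤ B₁) :
    ∑ k, oddsWeight f γ k z ≤ B₁ := by
  refine le_trans (Finset.sum_le_sum fun k _ => ?_) h
  exact mul_le_of_le_one_left (Real.exp_pos _).le (R_le_one _ _)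

theorem sum_R_le_one (z : Obs K 𝒳) : ∑ k : {k : Fin K // k ≠ t}, R k.1 z ≤ 1 := by
  have h : ∑ k : Fin K, R k z = 1 := by simp [R]
  rw [Fintype.sum_eq_add_sum_subtype_ne _ t] at h
  linarith [R_nonneg t z]

/-- The odds are changed with the regression functions held at `α`, which produces the residuals;
then the regression functions are changed under the new odds. -/
theorem phi_sub_eq (ψ : ℝ → ℝ) (f : Fin (p + 1) → 𝒳 → ℝ) (α γ b d : Coef p K t) (z : Obs K 𝒳) :
    phi ψ f (α + b) (γ + d) z - phi ψ f α γ z =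
      ∑ k, oddsWeight f γ k z * (Real.exp (lin f d k z.2.2) - 1) * outcomeResid ψ f α k z -
      ∑ k, (oddsWeight f γ k z * Real.exp (lin f d k z.2.2) - R k.1 z) *
        (ψ (lin f α k z.2.2 + lin f b k z.2.2) - ψ (lin f α k z.2.2)) := by
  simp only [phi]
  rw [add_sub_add_left_eq_sub, ← Finset.sum_sub_distrib, ← Finset.sum_sub_distrib]
  refine Finset.sum_congr rfl fun k _ => ?_
  have e1 := R_mul_oddsRatio f γ k z
  have e2 := R_mul_oddsRatio f (γ + d) k z
  rw [oddsWeight_add] at e2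
  rw [e1, e2, lin_add, outcomeResid]
  linear_combination z.1 * e2 - z.1 * e1

/-- The odds part is handled by Cauchy–Schwarz with weights `w_k`, the regression part by the total
masses `∑ w_k ≤ B₁ - 1` and `∑ R^{(k)} ≤ 1`, so no factor `K` appears. From `e ≤ 3` and `e^{3/2} ≤
5` come `18 = 2·3²` and `450 = 2·15²`, the `2` being that of `(X - Y)² ≤ 2X² + 2Y²`. -/
theorem phi_sub_sq_le {ψ : ℝ → ℝ} (hψ : Differentiable ℝ ψ) (hm : Monotone ψ)
    {f : Fin (p + 1) → 𝒳 → ℝ} {B B₁ C₁ C₃ r₁ r₂ : ℝ} (hC₁ : 0 ≤ C₁) (hC₃ : 0 ≤ C₃)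
    (hg : ∀ h h' : ℝ, deriv ψ h ≤ deriv ψ h' * Real.exp (C₃ * |h - h'|)) {z : Obs K 𝒳}
    (hB : ∀ j, |f j z.2.2| ≤ B) {α γ b d : Coef p K t}
    (hodds : ∑ k : {k : Fin K // k ≠ t}, Real.exp (lin f γ k z.2.2) ≤ B₁ - 1)
    (hα : ∀ k, deriv ψ (lin f α k z.2.2) ≤ C₁)
    (hd : norm21 d ≤ r₁) (hb : norm21 b ≤ r₂) (hr₁ : B * r₁ ≤ 1) (hr₂ : C₃ * (B * r₂) ≤ 3 / 2) :
    (phi ψ f (α + b) (γ + d) z - phi ψ f α γ z) ^ 2 ≤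
      18 * (B * r₁) ^ 2 * B₁ * (∑ k, oddsWeight f γ k z * outcomeResid ψ f α k z ^ 2) +
      450 * (C₁ * B₁ * (B * r₂)) ^ 2 := by
  have hB0 : 0 ≤ B := (abs_nonneg _).trans (hB 0)
  have hr1 : 0 ≤ r₁ := (norm21_nonneg d).trans hd
  have hr2 : 0 ≤ r₂ := (norm21_nonneg b).trans hb
  have hdk : ∀ k, |lin f d k z.2.2| ≤ B * r₁ := fun k =>
    (abs_lin_le hB d k).trans (mul_le_mul_of_nonneg_left hd hB0)
  have hbk : ∀ k, |lin f b k z.2.2| ≤ B * r₂ := fun k =>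
    (abs_lin_le hB b k).trans (mul_le_mul_of_nonneg_left hb hB0)
  have hw0 := fun k => oddsWeight_nonneg f γ k z
  have hsw := sum_oddsWeight_le hodds
  have he3 : Real.exp 1 ≤ 3 := by linarith [Real.exp_one_lt_d9]
  have hek : ∀ k, Real.exp |lin f d k z.2.2| ≤ 3 := fun k =>
    (Real.exp_le_exp.2 ((hdk k).trans hr₁)).trans he3
  have he5 : Real.exp (3 / 2) ≤ 5 := by
    have h1 : Real.exp (3 / 2) ^ 2 = Real.exp 1 ^ 3 := by
      rw [← Real.exp_nat_mul, ← Real.exp_nat_mul]; norm_num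
    have h2 : Real.exp 1 ^ 3 ≤ 2.72 ^ 3 :=
      pow_le_pow_left₀ (Real.exp_pos _).le (by linarith [Real.exp_one_lt_d9]) 3
    refine (sq_le_sq₀ (Real.exp_pos _).le (by norm_num)).1 ?_
    rw [h1]; exact h2.trans (by norm_num)
  set S := ∑ k, oddsWeight f γ k z * outcomeResid ψ f α k z ^ 2 with hS
  have hS0 : 0 ≤ S := Finset.sum_nonneg fun k _ => mul_nonneg (hw0 k) (sq_nonneg _)
  have hA : (∑ k, oddsWeight f γ k z * (Real.exp (lin f d k z.2.2) - 1) *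
      outcomeResid ψ f α k z) ^ 2 ≤ 9 * (B * r₁) ^ 2 * B₁ * S := by
    have h1 := Finset.sum_mul_sq_le_sq_mul_sq Finset.univ (fun k => √(oddsWeight f γ k z) *
      (Real.exp (lin f d k z.2.2) - 1)) (fun k => √(oddsWeight f γ k z) * outcomeResid ψ f α k z)
    simp only [mul_pow, Real.sq_sqrt (hw0 _)] at h1
    have h2 : ∀ k, √(oddsWeight f γ k z) * (Real.exp (lin f d k z.2.2) - 1) *
        (√(oddsWeight f γ k z) * outcomeResid ψ f α k z) =
        oddsWeight f γ k z * (Real.exp (lin f d k z.2.2) - 1) * outcomeResid ψ f α k z := fun k => by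
      linear_combination (Real.exp (lin f d k z.2.2) - 1) * outcomeResid ψ f α k z *
        Real.mul_self_sqrt (hw0 k)
    simp only [h2] at h1
    refine h1.trans (mul_le_mul_of_nonneg_right ?_ hS0)
    calc ∑ k, oddsWeight f γ k z * (Real.exp (lin f d k z.2.2) - 1) ^ 2
        ≤ ∑ k, oddsWeight f γ k z * (9 * (B * r₁) ^ 2) := by
          refine Finset.sum_le_sum fun k _ => mul_le_mul_of_nonneg_left ?_ (hw0 k)
          have h3 : |Real.exp (lin f d k z.2.2) - 1| ≤ B * r₁ * 3 :=
            (abs_exp_sub_one_le _).trans (mul_le_mul (hdk k) (hek k) (Real.exp_pos _).le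
              (by positivity))
          rw [← sq_abs]
          calc _ ≤ (B * r₁ * 3) ^ 2 := pow_le_pow_left₀ (abs_nonneg _) h3 2
            _ = _ := by ring
      _ = (∑ k, oddsWeight f γ k z) * (9 * (B * r₁) ^ 2) := by rw [Finset.sum_mul]
      _ ≤ B₁ * (9 * (B * r₁) ^ 2) :=
          mul_le_mul_of_nonneg_right (by linarith) (by positivity)
      _ = _ := by ring
  have hBB : |∑ k, (oddsWeight f γ k z * Real.exp (lin f d k z.2.2) - R k.1 z) *
      (ψ (lin f α k z.2.2 + lin f b k z.2.2) - ψ (lin f α k z.2.2))| ≤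
      15 * (C₁ * B₁ * (B * r₂)) := by
    calc _ ≤ ∑ k, |(oddsWeight f γ k z * Real.exp (lin f d k z.2.2) - R k.1 z) *
          (ψ (lin f α k z.2.2 + lin f b k z.2.2) - ψ (lin f α k z.2.2))| :=
          Finset.abs_sum_le_sum_abs _ _
      _ ≤ ∑ k, (oddsWeight f γ k z * 3 + R k.1 z) * (C₁ * 5 * (B * r₂)) := by
          refine Finset.sum_le_sum fun k _ => ?_
          rw [abs_mul]
          refine mul_le_mul ?_ ?_ (abs_nonneg _) (add_nonneg (mul_nonneg (hw0 k) (by norm_num))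
            (R_nonneg _ _))
          · refine (abs_sub _ _).trans ?_
            rw [abs_of_nonneg (mul_nonneg (hw0 k) (Real.exp_pos _).le),
              abs_of_nonneg (R_nonneg _ _)]
            gcongr
            · exact hw0 k
            · exact (Real.exp_le_exp.2 (le_abs_self _)).trans (hek k)
          · refine (abs_sub_le_of_deriv_growth hψ hm hC₃ hg (hα k)).trans ?_
            have h5 : Real.exp (C₃ * |lin f b k z.2.2|) ≤ 5 :=
              (Real.exp_le_exp.2 ((mul_le_mul_of_nonneg_left (hbk k) hC₃).trans hr₂)).trans he5
            gcongr
            exact hbk k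
      _ = (3 * (∑ k, oddsWeight f γ k z) + ∑ k : {k : Fin K // k ≠ t}, R k.1 z) *
            (C₁ * 5 * (B * r₂)) := by
          rw [← Finset.sum_mul, Finset.sum_add_distrib, ← Finset.sum_mul]; ring
      _ ≤ (3 * B₁) * (C₁ * 5 * (B * r₂)) := by
          refine mul_le_mul_of_nonneg_right ?_ (by positivity)
          -- `3(B₁ - 1) + 1 ≤ 3B₁`.
          linarith [sum_R_le_one (t := t) z]
      _ = _ := by ring
  have hBB2 := pow_le_pow_left₀ (abs_nonneg _) hBB 2
  rw [sq_abs] at hBB2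
  rw [phi_sub_eq]
  set X := ∑ k, oddsWeight f γ k z * (Real.exp (lin f d k z.2.2) - 1) * outcomeResid ψ f α k z
  set Y := ∑ k, (oddsWeight f γ k z * Real.exp (lin f d k z.2.2) - R k.1 z) *
      (ψ (lin f α k z.2.2 + lin f b k z.2.2) - ψ (lin f α k z.2.2))
  nlinarith [sq_nonneg (X + Y)]

theorem sampleMean_mul_sq_le (o : Fin n → Obs K 𝒳) (g h : Obs K 𝒳 → ℝ) :
    |sampleMean o (fun z => g z * h z)| ≤
      √(sampleMean o fun z => g z ^ 2) * √(sampleMean o fun z => h z ^ 2) := by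
  rw [← Real.sqrt_mul (sampleMean_nonneg fun _ => sq_nonneg _)]
  refine Real.abs_le_sqrt ?_
  simp only [sampleMean]
  rw [div_pow, div_mul_div_comm, ← sq]
  exact div_le_div_of_nonneg_right (Finset.sum_mul_sq_le_sq_mul_sq _ _ _) (sq_nonneg _)

/-- Comparison of the sample variances of two estimating functions. -/
theorem abs_sampleMean_sq_sub_sq_le (hn : 1 ≤ n) (ψ : ℝ → ℝ) (f : Fin (p + 1) → 𝒳 → ℝ)
    (o : Fin n → Obs K 𝒳) (α γ α' γ' : Coef p K t) {V : ℝ}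
    (hV : sampleMean o (fun z => (phi ψ f α' γ' z - phi ψ f α γ z) ^ 2) ≤ V) :
    |sampleMean o (fun z => phiCentered ψ f o α' γ' z ^ 2 - phiCentered ψ f o α γ z ^ 2)| ≤
      2 * √(sampleMean o fun z => phiCentered ψ f o α γ z ^ 2) * √V + V := by
  set Δ : Obs K 𝒳 → ℝ := fun z => phi ψ f α' γ' z - phi ψ f α γ z with hΔ
  set m := sampleMean o Δ with hmdef
  have e1 : ∀ z, phiCentered ψ f o α' γ' z = phiCentered ψ f o α γ z + (Δ z - m) := fun z => by
    have : m = sampleMean o (phi ψ f α' γ') - sampleMean o (phi ψ f α γ) := sampleMean_sub o _ _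
    rw [this, phiCentered, phiCentered]; simp only [hΔ]; ring
  -- Centering can only decrease the second moment, so `V` also bounds the centered change.
  have e2 : sampleMean o (fun z => (Δ z - m) ^ 2) ≤ V := by
    have : sampleMean o (fun z => (Δ z - m) ^ 2) = sampleMean o (fun z => Δ z ^ 2) - m ^ 2 := by
      have h1 : (fun z => (Δ z - m) ^ 2) = fun z => Δ z ^ 2 - 2 * m * Δ z + m ^ 2 := by
        ext z; ring
      rw [h1, sampleMean_add, sampleMean_sub, sampleMean_const_mul, sampleMean_const hn, ← hmdef]
      ring
    rw [this]
    linarith [sq_nonneg m]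
  have e3 : (fun z => phiCentered ψ f o α' γ' z ^ 2 - phiCentered ψ f o α γ z ^ 2) =
      fun z => 2 * (phiCentered ψ f o α γ z * (Δ z - m)) + (Δ z - m) ^ 2 := by
    ext z; rw [e1]; ring
  rw [e3, sampleMean_add, sampleMean_const_mul]
  have h0 : 0 ≤ sampleMean o (fun z => (Δ z - m) ^ 2) := sampleMean_nonneg fun _ => sq_nonneg _
  refine (abs_add_le _ _).trans ?_
  rw [abs_mul, abs_two, abs_of_nonneg h0, mul_assoc]
  have h1 := sampleMean_mul_sq_le o (phiCentered ψ f o α γ) (fun z => Δ z - m)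
  have h2 : √(sampleMean o fun z => (Δ z - m) ^ 2) ≤ √V := Real.sqrt_le_sqrt e2
  have h3 := mul_le_mul_of_nonneg_left h2 (Real.sqrt_nonneg
    (sampleMean o fun z => phiCentered ψ f o α γ z ^ 2))
  linarith

end VarianceComparison

/-! ### Measurability of losses, weights and residuals. -/

section Measurability

variable {p K : ℕ} {t : Fin K} {𝒳 : Type*} [MeasurableSpace 𝒳]

theorem measurable_R (k : Fin K) : Measurable (R k : Obs K 𝒳 → ℝ) := by
  unfold R
  refine Measurable.ite ?_ measurable_const measurable_const
  exact (measurable_fst.comp measurable_snd) (measurableSet_singleton k)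

variable {f : Fin (p + 1) → 𝒳 → ℝ}

theorem measurable_lin (hf : ∀ j, Measurable (f j)) (b : Coef p K t) (k : {k : Fin K // k ≠ t}) :
    Measurable (lin f b k) := by
  unfold lin; fun_prop

theorem measurable_oddsWeight (hf : ∀ j, Measurable (f j)) (γ : Coef p K t)
    (k : {k : Fin K // k ≠ t}) : Measurable (oddsWeight f γ k) := by
  have h1 := measurable_lin hf γ k
  have h2 := measurable_R (𝒳 := 𝒳) t
  unfold oddsWeight; fun_prop

theorem measurable_outcomeResid {ψ : ℝ → ℝ} (hψ : Measurable ψ) (hf : ∀ j, Measurable (f j))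
    (α : Coef p K t) (k : {k : Fin K // k ≠ t}) : Measurable (outcomeResid ψ f α k) := by
  have h1 := measurable_lin hf α k
  unfold outcomeResid; fun_prop

theorem measurable_calLoss (hf : ∀ j, Measurable (f j)) (γ : Coef p K t) :
    Measurable (calLoss f γ) := by
  have h1 := fun k => measurable_lin hf γ k
  have h2 := fun k => measurable_R (𝒳 := 𝒳) (K := K) k
  unfold calLoss; fun_prop

theorem measurable_wlLoss {ψ : ℝ → ℝ} (hψ : Differentiable ℝ ψ) (hf : ∀ j, Measurable (f j))
    (γ α : Coef p K t) : Measurable (wlLoss ψ f γ α) := by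
  have h1 := fun k => measurable_lin hf γ k
  have h3 := fun k => measurable_lin hf α k
  have h2 := measurable_R (𝒳 := 𝒳) t
  have h4 : Measurable fun u => ∫ v in (0 : ℝ)..u, ψ v :=
    (continuous_iff_continuousAt.2 fun u => (hasDerivAt_primitive hψ u).continuousAt).measurable
  have h5 := fun k => h4.comp (h3 k)
  simp only [Function.comp_def] at h5
  unfold wlLoss; fun_prop

end Measurability

/-! ### First-order conditions for the population targets. -/

section FirstOrder

/-- Stationarity without differentiating under the integral: near a minimizer the expected loss
increment is nonnegative and at most linear plus quadratic in the step. The test step is `-g/D` with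
`D > C`. -/
theorem eq_zero_of_quadratic_nonneg {g C : ℝ}
    (h : ∀ τ : ℝ, |τ| ≤ 1 → 0 ≤ τ * g + C * τ ^ 2) : g = 0 := by
  by_contra hg
  have hg0 : 0 < |g| := abs_pos.2 hg
  set D := |C| + |g| + 1 with hD
  have hD0 : 0 < D := by positivity
  have h1 := h (-(g / D)) (by
    rw [abs_neg, abs_div, abs_of_pos hD0, div_le_one hD0, hD]
    linarith [abs_nonneg C])
  have h2 : -(g / D) * g + C * (-(g / D)) ^ 2 = g ^ 2 / D ^ 2 * (C - D) := by
    field_simp; ring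
  rw [h2] at h1
  have h3 : 0 < g ^ 2 / D ^ 2 := by positivity
  have h4 : C - D < 0 := by linarith [le_abs_self C]
  nlinarith

variable {p K : ℕ} {t : Fin K} {𝒳 Ω₀ : Type*} [MeasurableSpace 𝒳] [MeasurableSpace Ω₀]
  {P : Measure Ω₀} [IsProbabilityMeasure P] {Z : Ω₀ → Obs K 𝒳} {f : Fin (p + 1) → 𝒳 → ℝ}
  {B₀ B₁ : ℝ}

theorem integrable_comp_of_abs_le {g : Obs K 𝒳 → ℝ} (hZ : AEMeasurable Z P) (hg : Measurable g)
    {C : ℝ} (h : ∀ᵐ ω ∂P, |g (Z ω)| ≤ C) : Integrable (fun ω => g (Z ω)) P :=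
  Integrable.of_bound (hg.comp_aemeasurable hZ).aestronglyMeasurable C h

omit [MeasurableSpace 𝒳] in
theorem lin_single (f : Fin (p + 1) → 𝒳 → ℝ) (j : Fin (p + 1)) (k k' : {k : Fin K // k ≠ t})
    (x : 𝒳) : lin f (Pi.single j (Pi.single k 1)) k' x = if k' = k then f j x else 0 := by
  rw [lin, Finset.sum_eq_single j]
  · simp [Pi.single_apply]
  · intro i _ hi
    simp [hi]
  · simp

theorem integrable_calLoss (hZ : AEMeasurable Z P) (hf : ∀ j, Measurable (f j))
    (hB : ∀ᵐ ω ∂P, ∀ j, |f j (Z ω).2.2| ≤ B₀) (γ : Coef p K t) :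
    Integrable (fun ω => calLoss f γ (Z ω)) P := by
  refine integrable_comp_of_abs_le hZ (measurable_calLoss hf γ)
    (C := ∑ _k : {k : Fin K // k ≠ t}, (Real.exp (B₀ * norm21 γ) + B₀ * norm21 γ)) ?_
  filter_upwards [hB] with ω hω
  refine (Finset.abs_sum_le_sum_abs _ _).trans (Finset.sum_le_sum fun k _ => ?_)
  have h1 := abs_lin_le hω γ k
  refine (abs_sub _ _).trans (add_le_add ?_ ?_)
  · rw [abs_of_nonneg (mul_nonneg (R_nonneg _ _) (Real.exp_pos _).le)]
    exact (mul_le_of_le_one_left (Real.exp_pos _).le (R_le_one _ _)).trans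
      (Real.exp_le_exp.2 ((le_abs_self _).trans h1))
  · rw [abs_mul, abs_of_nonneg (R_nonneg _ _)]
    exact (mul_le_of_le_one_left (abs_nonneg _) (R_le_one _ _)).trans h1

omit [MeasurableSpace 𝒳] in
theorem oddsWeight_le {γ : Coef p K t} {z : Obs K 𝒳}
    (h : ∑ k : {k : Fin K // k ≠ t}, Real.exp (lin f γ k z.2.2) ≤ B₁ - 1)
    (k : {k : Fin K // k ≠ t}) : oddsWeight f γ k z ≤ B₁ - 1 :=
  (Finset.single_le_sum (f := fun k => oddsWeight f γ k z) (fun k _ => oddsWeight_nonneg f γ k z)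
    (Finset.mem_univ k)).trans (sum_oddsWeight_le h)

/-- First-order condition for the calibration target. -/
theorem integral_calScore_eq_zero (hZ : AEMeasurable Z P) (hf : ∀ j, Measurable (f j))
    (hB : ∀ᵐ ω ∂P, ∀ j, |f j (Z ω).2.2| ≤ B₀) {γ : Coef p K t}
    (hodds : ∀ᵐ ω ∂P, ∑ k : {k : Fin K // k ≠ t}, Real.exp (lin f γ k (Z ω).2.2) ≤ B₁ - 1)
    (hγ : IsTargetCAL P Z f γ) (j : Fin (p + 1)) (k : {k : Fin K // k ≠ t}) :
    ∫ ω, (oddsWeight f γ k (Z ω) - R k.1 (Z ω)) * f j (Z ω).2.2 ∂P = 0 := by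
  have hi : Integrable (fun ω => (oddsWeight f γ k (Z ω) - R k.1 (Z ω)) * f j (Z ω).2.2) P := by
    have h1 := measurable_oddsWeight hf γ k
    have h2 := measurable_R (𝒳 := 𝒳) k.1
    have h3 := hf j
    refine integrable_comp_of_abs_le (g := fun z => (oddsWeight f γ k z - R k.1 z) * f j z.2.2)
      hZ (by fun_prop) (C := (B₁ - 1 + 1) * B₀) ?_
    filter_upwards [hB, hodds] with ω hω hω'
    rw [abs_mul]
    refine mul_le_mul ((abs_sub _ _).trans (add_le_add ?_ ?_)) (hω j) (abs_nonneg _) ?_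
    · rw [abs_of_nonneg (oddsWeight_nonneg _ _ _ _)]; exact oddsWeight_le hω' k
    · rw [abs_of_nonneg (R_nonneg _ _)]; exact R_le_one _ _
    · linarith [oddsWeight_nonneg f γ k (Z ω), oddsWeight_le hω' k]
  refine eq_zero_of_quadratic_nonneg (C := (B₁ - 1) * (B₀ ^ 2 * Real.exp B₀)) fun τ hτ => ?_
  -- Perturbing the single entry `(j, k)` isolates one component of the gradient.
  set b : Coef p K t := Pi.single j (Pi.single k 1)
  have h1 := hγ (γ + τ • b)
  have hpt : ∀ᵐ ω ∂P, calLoss f (γ + τ • b) (Z ω) - calLoss f γ (Z ω) ≤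
      τ * ((oddsWeight f γ k (Z ω) - R k.1 (Z ω)) * f j (Z ω).2.2) +
        (B₁ - 1) * (B₀ ^ 2 * Real.exp B₀) * τ ^ 2 := by
    filter_upwards [hB, hodds] with ω hω hω'
    rw [calLoss, calLoss, ← Finset.sum_sub_distrib, Finset.sum_eq_single k]
    · set u := τ * f j (Z ω).2.2 with hu
      have e1 : lin f (γ + τ • b) k (Z ω).2.2 = lin f γ k (Z ω).2.2 + u := by
        rw [lin_add, lin_smul, lin_single, if_pos rfl]
      have hub : |u| ≤ B₀ := by
        rw [hu, abs_mul]
        nlinarith [hω j, abs_nonneg (f j (Z ω).2.2)]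
      have hu2 : u ^ 2 ≤ B₀ ^ 2 * τ ^ 2 := by
        have : f j (Z ω).2.2 ^ 2 ≤ B₀ ^ 2 := by
          rw [← sq_abs (f j _)]; exact pow_le_pow_left₀ (abs_nonneg _) (hω j) 2
        rw [hu]; nlinarith [sq_nonneg τ]
      have e2 := (abs_le.1 (abs_exp_sub_one_sub_le u)).2
      have e3 : u ^ 2 * Real.exp |u| ≤ B₀ ^ 2 * τ ^ 2 * Real.exp B₀ := by gcongr
      have e4 : R t (Z ω) * Real.exp (lin f γ k (Z ω).2.2) = oddsWeight f γ k (Z ω) := rfl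
      have e5 := mul_le_mul_of_nonneg_left (e2.trans e3) (oddsWeight_nonneg f γ k (Z ω))
      have e6 := mul_le_mul_of_nonneg_right (oddsWeight_le hω' k)
        (by positivity : 0 ≤ B₀ ^ 2 * τ ^ 2 * Real.exp B₀)
      rw [e1, Real.exp_add, ← mul_assoc, e4]
      have e7 : τ * ((oddsWeight f γ k (Z ω) - R k.1 (Z ω)) * f j (Z ω).2.2) =
        (oddsWeight f γ k (Z ω) - R k.1 (Z ω)) * u := by rw [hu]; ring
      rw [e7]
      linarith
    · intro k' _ hk'
      rw [lin_add, lin_smul, lin_single, if_neg hk']; simp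
    · simp
  have h2 := integral_mono_ae ((integrable_calLoss hZ hf hB _).sub (integrable_calLoss hZ hf hB γ))
    ((hi.const_mul τ).add (integrable_const _)) hpt
  rw [integral_sub' (integrable_calLoss hZ hf hB _) (integrable_calLoss hZ hf hB γ),
    integral_add' (hi.const_mul τ) (integrable_const _), integral_const_mul] at h2
  simp only [integral_const, probReal_univ, one_smul] at h2
  linarith

/-- The outcome itself is not assumed integrable. It appears only with the weight, and is rewritten
as residual plus fitted value at the reference `α₀`; linear predictors are bounded, so continuous
functions of them are too. -/
theorem integrable_wlLoss {ψ : ℝ → ℝ} (hψ : Differentiable ℝ ψ) (hZ : AEMeasurable Z P)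
    (hf : ∀ j, Measurable (f j))
    (hB : ∀ᵐ ω ∂P, ∀ j, |f j (Z ω).2.2| ≤ B₀) {γ : Coef p K t}
    (hodds : ∀ᵐ ω ∂P, ∑ k : {k : Fin K // k ≠ t}, Real.exp (lin f γ k (Z ω).2.2) ≤ B₁ - 1)
    (α₀ α : Coef p K t)
    (hres : ∀ k, Integrable (fun ω => oddsWeight f γ k (Z ω) * outcomeResid ψ f α₀ k (Z ω)) P) :
    Integrable (fun ω => wlLoss ψ f γ α (Z ω)) P := by
  have hB0 : 0 ≤ B₀ := by
    obtain ⟨ω, hω⟩ := hB.exists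
    exact (abs_nonneg _).trans (hω 0)
  have hbd : ∀ φ : ℝ → ℝ, Continuous φ → ∀ L : ℝ, ∃ C, 0 ≤ C ∧ ∀ u, |u| ≤ L → |φ u| ≤ C :=
    fun φ hφ L => by
      obtain ⟨C, hC⟩ := (isCompact_Icc (a := -L) (b := L)).exists_bound_of_continuousOn
        hφ.continuousOn
      exact ⟨max C 0, le_max_right _ _, fun u hu => (hC u (abs_le.1 hu)).trans (le_max_left _ _)⟩
  obtain ⟨C₁, hC₁0, hC₁⟩ := hbd _ hψ.continuous (B₀ * norm21 α₀)
  obtain ⟨C₂, hC₂0, hC₂⟩ := hbd (fun u => ∫ v in (0 : ℝ)..u, ψ v)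
    (continuous_iff_continuousAt.2 fun u => (hasDerivAt_primitive hψ u).continuousAt)
    (B₀ * norm21 α)
  have hdom : Integrable (fun ω => ∑ k, (|oddsWeight f γ k (Z ω) * outcomeResid ψ f α₀ k (Z ω)| *
      (B₀ * norm21 α) + (B₁ - 1) * (C₁ * (B₀ * norm21 α) + C₂))) P :=
    integrable_finsetSum _ fun k _ => ((hres k).abs.mul_const _).add (integrable_const _)
  refine hdom.mono' ((measurable_wlLoss hψ hf γ α).comp_aemeasurable hZ).aestronglyMeasurable ?_
  filter_upwards [hB, hodds] with ω hω hω'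
  refine (Finset.abs_sum_le_sum_abs _ _).trans (Finset.sum_le_sum fun k _ => ?_)
  have h1 := abs_lin_le hω α k
  have h0 := hC₁ _ (abs_lin_le hω α₀ k)
  have h2 := hC₂ _ h1
  have hw0 := oddsWeight_nonneg f γ k (Z ω)
  have hw1 := oddsWeight_le hω' k
  have e4 : R t (Z ω) * Real.exp (lin f γ k (Z ω).2.2) = oddsWeight f γ k (Z ω) := rfl
  have e5 : (Z ω).1 = outcomeResid ψ f α₀ k (Z ω) + ψ (lin f α₀ k (Z ω).2.2) := by
    rw [outcomeResid]; ring
  rw [e4, e5, abs_mul, abs_mul, abs_of_nonneg hw0]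
  set w := oddsWeight f γ k (Z ω)
  set W := outcomeResid ψ f α₀ k (Z ω)
  set l := lin f α k (Z ω).2.2
  set q := ψ (lin f α₀ k (Z ω).2.2)
  have hl0 : 0 ≤ B₀ * norm21 α := mul_nonneg hB0 (norm21_nonneg α)
  have h3 : |-((W + q) * l) + ∫ u in (0 : ℝ)..l, ψ u| ≤
      |W| * (B₀ * norm21 α) + (C₁ * (B₀ * norm21 α) + C₂) := by
    refine (abs_add_le _ _).trans ?_
    rw [abs_neg, abs_mul, ← add_assoc, ← add_mul]
    exact add_le_add (mul_le_mul ((abs_add_le _ _).trans (add_le_add le_rfl h0)) h1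
      (abs_nonneg _) (by positivity)) h2
  calc _ ≤ w * (|W| * (B₀ * norm21 α) + (C₁ * (B₀ * norm21 α) + C₂)) :=
        mul_le_mul_of_nonneg_left h3 hw0
    _ ≤ _ := by
        rw [mul_add, ← mul_assoc]
        gcongr

/-- First-order condition for the weighted likelihood target. -/
theorem integral_wlScore_eq_zero {ψ : ℝ → ℝ} (hψ : Differentiable ℝ ψ) (hm : Monotone ψ)
    {C₁ C₃ : ℝ} (hC₃ : 0 ≤ C₃)
    (hg : ∀ h h' : ℝ, deriv ψ h ≤ deriv ψ h' * Real.exp (C₃ * |h - h'|))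
    (hZ : AEMeasurable Z P) (hf : ∀ j, Measurable (f j))
    (hB : ∀ᵐ ω ∂P, ∀ j, |f j (Z ω).2.2| ≤ B₀) {γ α : Coef p K t}
    (hodds : ∀ᵐ ω ∂P, ∑ k : {k : Fin K // k ≠ t}, Real.exp (lin f γ k (Z ω).2.2) ≤ B₁ - 1)
    (hd : ∀ᵐ ω ∂P, ∀ k : {k : Fin K // k ≠ t}, deriv ψ (lin f α k (Z ω).2.2) ≤ C₁)
    (hres : ∀ k, Integrable (fun ω => oddsWeight f γ k (Z ω) * outcomeResid ψ f α k (Z ω)) P)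
    (hα : IsTargetWL P Z ψ f γ α) (j : Fin (p + 1)) (k : {k : Fin K // k ≠ t}) :
    ∫ ω, oddsWeight f γ k (Z ω) * outcomeResid ψ f α k (Z ω) * f j (Z ω).2.2 ∂P = 0 := by
  have hi : Integrable (fun ω => oddsWeight f γ k (Z ω) * outcomeResid ψ f α k (Z ω) *
      f j (Z ω).2.2) P := by
    refine (hres k).mul_bdd (c := B₀) ?_ ?_
    · exact ((hf j).comp (measurable_snd.comp measurable_snd)).comp_aemeasurable hZ
        |>.aestronglyMeasurable
    · filter_upwards [hB] with ω hω using hω j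
  have hC₁ : 0 ≤ C₁ := by
    obtain ⟨ω, hω⟩ := hd.exists
    exact hm.deriv_nonneg.trans (hω k)
  rw [← neg_eq_zero, ← integral_neg]
  refine eq_zero_of_quadratic_nonneg (C := (B₁ - 1) * (C₁ * Real.exp (C₃ * B₀) * B₀ ^ 2))
    fun τ hτ => ?_
  set b : Coef p K t := Pi.single j (Pi.single k 1)
  have h1 := hα (α + τ • b)
  have hI := fun a => integrable_wlLoss hψ hZ hf hB hodds α a hres
  have hpt : ∀ᵐ ω ∂P, wlLoss ψ f γ (α + τ • b) (Z ω) - wlLoss ψ f γ α (Z ω) ≤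
      τ * -(oddsWeight f γ k (Z ω) * outcomeResid ψ f α k (Z ω) * f j (Z ω).2.2) +
        (B₁ - 1) * (C₁ * Real.exp (C₃ * B₀) * B₀ ^ 2) * τ ^ 2 := by
    filter_upwards [hB, hodds, hd] with ω hω hω' hωd
    rw [wlLoss, wlLoss, ← Finset.sum_sub_distrib, Finset.sum_eq_single k]
    · set u := τ * f j (Z ω).2.2 with hu
      have e1 : lin f (α + τ • b) k (Z ω).2.2 = lin f α k (Z ω).2.2 + u := by
        rw [lin_add, lin_smul, lin_single, if_pos rfl]
      have hub : |u| ≤ B₀ := by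
        rw [hu, abs_mul]
        nlinarith [hω j, abs_nonneg (f j (Z ω).2.2)]
      have hu2 : u ^ 2 ≤ B₀ ^ 2 * τ ^ 2 := by
        have : f j (Z ω).2.2 ^ 2 ≤ B₀ ^ 2 := by
          rw [← sq_abs (f j _)]; exact pow_le_pow_left₀ (abs_nonneg _) (hω j) 2
        rw [hu]; nlinarith [sq_nonneg τ]
      have e2 := (abs_le.1 (abs_primitive_bregman_le hψ hm hC₃ hg (u := u) (hωd k))).2
      have e3 : C₁ * Real.exp (C₃ * |u|) * u ^ 2 ≤
          C₁ * Real.exp (C₃ * B₀) * (B₀ ^ 2 * τ ^ 2) := by gcongr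
      have e4 : R t (Z ω) * Real.exp (lin f γ k (Z ω).2.2) = oddsWeight f γ k (Z ω) := rfl
      have e5 := mul_le_mul_of_nonneg_left (e2.trans e3) (oddsWeight_nonneg f γ k (Z ω))
      have e6 := mul_le_mul_of_nonneg_right (oddsWeight_le hω' k)
        (by positivity : 0 ≤ C₁ * Real.exp (C₃ * B₀) * (B₀ ^ 2 * τ ^ 2))
      have e7 : (Z ω).1 = outcomeResid ψ f α k (Z ω) + ψ (lin f α k (Z ω).2.2) := by
        rw [outcomeResid]; ring
      have e8 : τ * -(oddsWeight f γ k (Z ω) * outcomeResid ψ f α k (Z ω) * f j (Z ω).2.2) =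
        -(oddsWeight f γ k (Z ω) * outcomeResid ψ f α k (Z ω) * u) := by rw [hu]; ring
      rw [e1, e4, e7, e8]
      linarith
    · intro k' _ hk'
      rw [lin_add, lin_smul, lin_single, if_neg hk']; simp
    · simp
  have h2 := integral_mono_ae ((hI _).sub (hI α))
    ((hi.neg.const_mul τ).add (integrable_const _)) hpt
  rw [integral_sub' (hI _) (hI α), integral_add' (hi.neg.const_mul τ) (integrable_const _),
    integral_const_mul] at h2
  simp only [Pi.neg_apply, integral_const, probReal_univ, one_smul] at h2
  linarith

end FirstOrder

/-! ### Consequences of unconfoundedness. -/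

section Causal

variable {K : ℕ} {𝒳 Ω₀ : Type*} [mX : MeasurableSpace 𝒳] [mΩ : MeasurableSpace Ω₀]
  {P : Measure Ω₀} [IsProbabilityMeasure P] {Ypot : Fin K → Ω₀ → ℝ} {T : Ω₀ → Fin K} {X : Ω₀ → 𝒳}

/-- A bounded function of `X` can be pulled out of the conditional expectation. -/
theorem integral_mul_exp_le_of_subGaussianGiven (hX : Measurable X) {W : Ω₀ → ℝ} {σ : ℝ}
    (hW : SubGaussianGiven P X W σ) {g : Ω₀ → ℝ} {C : ℝ} (hg : StronglyMeasurable[mX.comap X] g)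
    (hb : ∀ᵐ ω ∂P, 0 ≤ g ω ∧ g ω ≤ C) :
    Integrable (fun ω => g ω * Real.exp (W ω ^ 2 / σ ^ 2)) P ∧
      ∫ ω, g ω * Real.exp (W ω ^ 2 / σ ^ 2) ∂P ≤ 2 * ∫ ω, g ω ∂P := by
  have hm : mX.comap X ≤ mΩ := hX.comap_le
  obtain ⟨hi, h2⟩ := hW
  have hgb : ∀ᵐ ω ∂P, ‖g ω‖ ≤ C := hb.mono fun ω h => by
    rw [Real.norm_eq_abs, abs_of_nonneg h.1]; exact h.2
  have hgm : AEStronglyMeasurable g P := (hg.mono hm).aestronglyMeasurable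
  have hge : Integrable (fun ω => g ω * Real.exp (W ω ^ 2 / σ ^ 2)) P := hi.bdd_mul hgm hgb
  refine ⟨hge, ?_⟩
  have hpull := condExp_mul_of_stronglyMeasurable_left hg hge hi
  have hgi : Integrable g P := Integrable.of_bound hgm C hgb
  calc ∫ ω, g ω * Real.exp (W ω ^ 2 / σ ^ 2) ∂P
      = ∫ ω, (P[fun ω => g ω * Real.exp (W ω ^ 2 / σ ^ 2) | mX.comap X]) ω ∂P :=
        (integral_condExp hm).symm
    _ ≤ ∫ ω, 2 * g ω ∂P := by
        refine integral_mono_ae integrable_condExp (hgi.const_mul 2) ?_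
        filter_upwards [hpull, h2, hb] with ω h h2 hb
        refine h.trans_le ?_
        simp only [Pi.mul_apply]
        nlinarith [hb.1]
    _ = _ := integral_const_mul _ _

/-- Unconfoundedness: conditionally on `X`, the indicator of `T = t` may be replaced by its
conditional probability in integrals of functions of `(Y^{(t)}, X)`. -/
theorem setIntegral_eq_integral_condExp_mul (h : CausalAssumptions P Ypot T X) (t : Fin K)
    {G : ℝ × 𝒳 → ℝ} (hG : Measurable G) :
    ∫ ω in {ω | T ω = t}, G (Ypot t ω, X ω) ∂P =
      ∫ ω, (P[({ω | T ω = t}).indicator (fun _ => (1 : ℝ)) | mX.comap X]) ω *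
        G (Ypot t ω, X ω) ∂P := by
  have hX := h.measurable_X
  have hY := h.measurable_Ypot t
  have hm : mX.comap X ≤ mΩ := hX.comap_le
  set S : Set Ω₀ := {ω | T ω = t} with hS
  have hSm : MeasurableSet S := h.measurable_T (measurableSet_singleton t)
  set π : Ω₀ → ℝ := P[S.indicator (fun _ => (1 : ℝ)) | mX.comap X] with hπ
  have hiS : Integrable (S.indicator (fun _ => (1 : ℝ))) P :=
    (integrable_const 1).indicator hSm
  have hπ0 : 0 ≤ᵐ[P] π := condExp_nonneg (ae_of_all _ fun ω => by
    simp only [Pi.zero_apply]; exact Set.indicator_nonneg (fun _ _ => zero_le_one) ω)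
  have hπm : StronglyMeasurable[mX.comap X] π := stronglyMeasurable_condExp
  have hπi : Integrable π P := integrable_condExp
  have hpair : Measurable fun ω => (Ypot t ω, X ω) := hY.prodMk hX
  -- The identity is one of measures on `ℝ × 𝒳`, so rectangles suffice; there it is unconfoundedness
  -- integrated over an event of `X`.
  have hmeas : (P.restrict S).map (fun ω => (Ypot t ω, X ω)) =
      (P.withDensity fun ω => ENNReal.ofReal (π ω)).map (fun ω => (Ypot t ω, X ω)) := by
    have : IsFiniteMeasure ((P.restrict S).map (fun ω => (Ypot t ω, X ω))) :=
      Measure.isFiniteMeasure_map _ _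
    refine Measure.ext_prod fun {A B} hA hB => ?_
    have hAY : MeasurableSet {ω | Ypot t ω ∈ A} := hY hA
    have hBX : MeasurableSet[mX.comap X] (X ⁻¹' B) := ⟨B, hB, rfl⟩
    have hpre : (fun ω => (Ypot t ω, X ω)) ⁻¹' (A ×ˢ B) = X ⁻¹' B ∩ {ω | Ypot t ω ∈ A} := by
      ext ω; simp [and_comm]
    have hprem : MeasurableSet (X ⁻¹' B ∩ {ω | Ypot t ω ∈ A}) := (hX hB).inter hAY
    rw [Measure.map_apply hpair (hA.prod hB), Measure.map_apply hpair (hA.prod hB), hpre,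
      Measure.restrict_apply hprem, withDensity_apply _ hprem,
      ← ofReal_integral_eq_lintegral_ofReal hπi.integrableOn (ae_restrict_of_ae hπ0),
      ← ofReal_measureReal]
    congr 1
    have hiSA : Integrable ((S ∩ {ω | Ypot t ω ∈ A}).indicator (fun _ => (1 : ℝ))) P :=
      (integrable_const 1).indicator (hSm.inter hAY)
    have hiA : Integrable (({ω | Ypot t ω ∈ A}).indicator (fun _ => (1 : ℝ))) P :=
      (integrable_const 1).indicator hAY
    have hmul : π * ({ω | Ypot t ω ∈ A}).indicator (fun _ => (1 : ℝ)) =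
        ({ω | Ypot t ω ∈ A}).indicator π := by
      ext ω; by_cases hω : ω ∈ {ω | Ypot t ω ∈ A} <;> simp [hω]
    have hiπA : Integrable (π * ({ω | Ypot t ω ∈ A}).indicator (fun _ => (1 : ℝ))) P := by
      rw [hmul]; exact hπi.indicator hAY
    have hpull := condExp_mul_of_stronglyMeasurable_left hπm hiπA hiA
    calc P.real (X ⁻¹' B ∩ {ω | Ypot t ω ∈ A} ∩ S)
        = ∫ ω in X ⁻¹' B, (S ∩ {ω | Ypot t ω ∈ A}).indicator (fun _ => (1 : ℝ)) ω ∂P := by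
          rw [setIntegral_indicator (hSm.inter hAY), setIntegral_const, smul_eq_mul, mul_one]
          congr 1
          ext ω; simp only [Set.mem_inter_iff]; tauto
      _ = ∫ ω in X ⁻¹' B,
            (P[(S ∩ {ω | Ypot t ω ∈ A}).indicator (fun _ => (1 : ℝ)) | mX.comap X]) ω ∂P :=
          (setIntegral_condExp hm hiSA hBX).symm
      _ = ∫ ω in X ⁻¹' B,
            (P[π * ({ω | Ypot t ω ∈ A}).indicator (fun _ => (1 : ℝ)) | mX.comap X]) ω ∂P := by
          refine setIntegral_congr_ae (hX hB) ?_
          filter_upwards [h.unconfounded t A hA, hpull] with ω h1 h2 _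
          rw [h1, h2]
      _ = ∫ ω in X ⁻¹' B, ({ω | Ypot t ω ∈ A}).indicator π ω ∂P := by
          rw [setIntegral_condExp hm hiπA hBX, hmul]
      _ = _ := by rw [setIntegral_indicator hAY]
  calc ∫ ω in S, G (Ypot t ω, X ω) ∂P
      = ∫ z, G z ∂((P.restrict S).map (fun ω => (Ypot t ω, X ω))) :=
        (integral_map hpair.aemeasurable hG.aestronglyMeasurable).symm
    _ = ∫ ω, G (Ypot t ω, X ω) ∂(P.withDensity fun ω => ENNReal.ofReal (π ω)) := by
        rw [hmeas, integral_map hpair.aemeasurable hG.aestronglyMeasurable]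
    _ = _ := by
        rw [integral_withDensity_eq_integral_toReal_smul₀
          hπi.aestronglyMeasurable.aemeasurable.ennreal_ofReal
          (ae_of_all _ fun _ => ENNReal.ofReal_lt_top)]
        refine integral_congr_ae ?_
        filter_upwards [hπ0] with ω hω
        rw [ENNReal.toReal_ofReal hω, smul_eq_mul]

/-- Under unconfoundedness the conditional second moment of a sub-Gaussian residual is bounded on
the treated. -/
theorem setIntegral_mul_sq_le (h : CausalAssumptions P Ypot T X) (t : Fin K) {q : 𝒳 → ℝ}
    (hq : Measurable q) {σ : ℝ} (hσ : 0 < σ)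
    (hW : SubGaussianGiven P X (fun ω => Ypot t ω - q (X ω)) σ) {g : 𝒳 → ℝ} (hg : Measurable g)
    {C : ℝ} (hb : ∀ᵐ ω ∂P, 0 ≤ g (X ω) ∧ g (X ω) ≤ C) :
    ∫ ω in {ω | T ω = t}, g (X ω) * (Ypot t ω - q (X ω)) ^ 2 ∂P ≤
      σ ^ 2 * Real.log 2 * ∫ ω in {ω | T ω = t}, g (X ω) ∂P := by
  have hX := h.measurable_X
  have hm : mX.comap X ≤ mΩ := hX.comap_le
  have hSm : MeasurableSet {ω | T ω = t} := h.measurable_T (measurableSet_singleton t)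
  have hgc : StronglyMeasurable[mX.comap X] fun ω => g (X ω) :=
    (hg.comp (comap_measurable X)).stronglyMeasurable
  obtain ⟨hge, -⟩ := integral_mul_exp_le_of_subGaussianGiven hX hW hgc hb
  have hgi : Integrable (fun ω => g (X ω)) P :=
    Integrable.of_bound (hgc.mono hm).aestronglyMeasurable C (hb.mono fun ω h => by
      rw [Real.norm_eq_abs, abs_of_nonneg h.1]; exact h.2)
  set π : Ω₀ → ℝ := P[({ω | T ω = t}).indicator (fun _ => (1 : ℝ)) | mX.comap X] with hπ
  have hiS : Integrable (({ω | T ω = t}).indicator (fun _ => (1 : ℝ))) P :=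
    (integrable_const 1).indicator hSm
  have hπ0 : 0 ≤ᵐ[P] π := condExp_nonneg (ae_of_all _ fun ω => by
    simp only [Pi.zero_apply]; exact Set.indicator_nonneg (fun _ _ => zero_le_one) ω)
  have hπ1 : π ≤ᵐ[P] fun _ => 1 := by
    have := condExp_mono (m := mX.comap X) hiS (integrable_const (1 : ℝ)) (ae_of_all P fun ω =>
      Set.indicator_le_self' (f := fun _ => (1 : ℝ)) (fun _ _ => zero_le_one) ω)
    rwa [condExp_const hm] at this
  -- Restriction to the treated amounts to replacing `g` by `π g`, still a bounded nonnegative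
  -- function of `X`.
  have hπg : StronglyMeasurable[mX.comap X] fun ω => π ω * g (X ω) :=
    stronglyMeasurable_condExp.mul hgc
  have hπb : ∀ᵐ ω ∂P, 0 ≤ π ω * g (X ω) ∧ π ω * g (X ω) ≤ C := by
    filter_upwards [hb, hπ0, hπ1] with ω h1 h2 h3
    exact ⟨mul_nonneg h2 h1.1, (mul_le_of_le_one_left h1.1 h3).trans h1.2⟩
  have hexp := (integral_mul_exp_le_of_subGaussianGiven hX hW hπg hπb).2
  have e1 := setIntegral_eq_integral_condExp_mul h t
    (G := fun z => g z.2 * Real.exp ((z.1 - q z.2) ^ 2 / σ ^ 2)) (by fun_prop)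
  have e2 := setIntegral_eq_integral_condExp_mul h t (G := fun z => g z.2) (by fun_prop)
  simp only [← hπ] at e1 e2
  have e3 : ∫ ω in {ω | T ω = t}, g (X ω) * Real.exp ((Ypot t ω - q (X ω)) ^ 2 / σ ^ 2) ∂P ≤
      2 * ∫ ω in {ω | T ω = t}, g (X ω) ∂P := by
    rw [e1, e2]
    simpa only [mul_assoc] using hexp
  have hσ2 : 0 < σ ^ 2 := by positivity
  calc ∫ ω in {ω | T ω = t}, g (X ω) * (Ypot t ω - q (X ω)) ^ 2 ∂P
      ≤ ∫ ω in {ω | T ω = t}, (σ ^ 2 * (Real.log 2 - 1) * g (X ω) + σ ^ 2 / 2 *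
          (g (X ω) * Real.exp ((Ypot t ω - q (X ω)) ^ 2 / σ ^ 2))) ∂P := by
        refine integral_mono_of_nonneg (ae_restrict_of_ae ?_)
          ((hgi.const_mul _).add (hge.const_mul _)).integrableOn (ae_restrict_of_ae ?_)
        · filter_upwards [hb] with ω h1 using mul_nonneg h1.1 (sq_nonneg _)
        · filter_upwards [hb] with ω h1
          set y := (Ypot t ω - q (X ω)) ^ 2 / σ ^ 2 with hy
          have h2 : (Ypot t ω - q (X ω)) ^ 2 = σ ^ 2 * y := by rw [hy]; field_simp
          -- The tangent to `exp` at `log 2`, in place of Jensen: an exponential moment of at most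
          -- `2` forces a mean of at most `log 2`.
          have h3 : y ≤ Real.log 2 - 1 + Real.exp y / 2 := by
            have := Real.add_one_le_exp (y - Real.log 2)
            rw [Real.exp_sub, Real.exp_log two_pos] at this
            linarith
          rw [h2]
          have := mul_le_mul_of_nonneg_left h3 (mul_nonneg h1.1 hσ2.le)
          linarith
    _ = σ ^ 2 * (Real.log 2 - 1) * ∫ ω in {ω | T ω = t}, g (X ω) ∂P + σ ^ 2 / 2 *
          ∫ ω in {ω | T ω = t}, g (X ω) * Real.exp ((Ypot t ω - q (X ω)) ^ 2 / σ ^ 2) ∂P := by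
        rw [integral_add (hgi.const_mul _).integrableOn (hge.const_mul _).integrableOn,
          integral_const_mul, integral_const_mul]
    _ ≤ _ := by nlinarith

end Causal

/-! ### Exponential and second moments of scores and Gram entries. -/

section Moments

/-- Jensen for a sub-probability, the missing mass being placed at `0`. -/
theorem exp_sum_mul_le {ι : Type*} [Fintype ι] {w y : ι → ℝ} (hw : ∀ i, 0 ≤ w i)
    (hw1 : ∑ i, w i ≤ 1) :
    Real.exp (∑ i, w i * y i) ≤ ∑ i, w i * Real.exp (y i) + (1 - ∑ i, w i) := by
  have h := convexOn_exp.map_sum_le (t := (Finset.univ : Finset (Option ι)))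
    (w := fun i => i.elim (1 - ∑ i, w i) w) (p := fun i => i.elim 0 y)
    (fun i _ => by cases i with
      | none => exact sub_nonneg.2 hw1
      | some i => exact hw i)
    (by simp [Fintype.sum_option]) (fun _ _ => Set.mem_univ _)
  simp only [Fintype.sum_option, Option.elim, smul_eq_mul, mul_zero, zero_add, Real.exp_zero,
    mul_one] at h
  linarith

variable {p K : ℕ} {t : Fin K} {𝒳 Ω₀ : Type*} [MeasurableSpace 𝒳] [MeasurableSpace Ω₀]
  {P : Measure Ω₀} [IsProbabilityMeasure P] {Ypot : Fin K → Ω₀ → ℝ} {T : Ω₀ → Fin K} {X : Ω₀ → 𝒳}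
  {f : Fin (p + 1) → 𝒳 → ℝ} {ψ : ℝ → ℝ} {γ α : Coef p K t} {B₀ B₁ σ : ℝ}

omit [MeasurableSpace 𝒳] [MeasurableSpace Ω₀] in
-- On the treated the observed outcome is `Y^{(t)}`, elsewhere the weight vanishes. This is how
-- bounds on the potential outcome reach the data.
theorem oddsWeight_mul_outcomeResid (k : {k : Fin K // k ≠ t}) (ω : Ω₀) (F : ℝ → ℝ) :
    oddsWeight f γ k (observed Ypot T X ω) * F (outcomeResid ψ f α k (observed Ypot T X ω)) =
      oddsWeight f γ k (observed Ypot T X ω) * F (Ypot t ω - ψ (lin f α k (X ω))) := by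
  by_cases h : T ω = t
  · simp [outcomeResid, observed, h]
  · simp [oddsWeight, R, observed, h]

omit [IsProbabilityMeasure P] in
theorem integrable_oddsWeight_mul_outcomeResid (hσ : 0 < σ)
    (hZ : AEMeasurable (observed Ypot T X) P) (hψ : Measurable ψ) (hf : ∀ j, Measurable (f j))
    (hodds : ∀ᵐ ω ∂P, ∑ k : {k : Fin K // k ≠ t}, Real.exp (lin f γ k (X ω)) ≤ B₁ - 1)
    (k : {k : Fin K // k ≠ t})
    (hW : SubGaussianGiven P X (fun ω => Ypot t ω - ψ (lin f α k (X ω))) σ) :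
    Integrable (fun ω => oddsWeight f γ k (observed Ypot T X ω) *
      outcomeResid ψ f α k (observed Ypot T X ω)) P := by
  have h1 := measurable_oddsWeight hf γ k
  have h2 := measurable_outcomeResid hψ hf α k
  refine ((hW.1.const_mul ((B₁ - 1) * σ)).mono'
    ((h1.mul h2).comp_aemeasurable hZ).aestronglyMeasurable ?_)
  filter_upwards [hodds] with ω hω
  have e := oddsWeight_mul_outcomeResid (f := f) (ψ := ψ) (γ := γ) (α := α) (Ypot := Ypot) (T := T)
    (X := X) k ω id
  simp only [id] at e ⊢
  have hw0 := oddsWeight_nonneg f γ k (observed Ypot T X ω)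
  have hw1 := oddsWeight_le (z := observed Ypot T X ω) hω k
  rw [e, Real.norm_eq_abs, abs_mul, abs_of_nonneg hw0]
  set W := Ypot t ω - ψ (lin f α k (X ω))
  have h3 : |W| ≤ σ * Real.exp (W ^ 2 / σ ^ 2) := by
    have h4 := Real.add_one_le_exp (W ^ 2 / σ ^ 2)
    have h5 : |W| ≤ σ * (W ^ 2 / σ ^ 2 + 1) := by
      have h6 : σ * (W ^ 2 / σ ^ 2 + 1) = (W ^ 2 + σ ^ 2) / σ := by field_simp
      rw [h6, le_div_iff₀ hσ, ← sq_abs W]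
      nlinarith [sq_nonneg (|W| - σ), abs_nonneg W]
    exact h5.trans (mul_le_mul_of_nonneg_left h4 hσ.le)
  calc _ ≤ (B₁ - 1) * (σ * Real.exp (W ^ 2 / σ ^ 2)) :=
        mul_le_mul hw1 h3 (abs_nonneg _) (hw0.trans hw1)
    _ = _ := by ring

/-- Exponential moment of the score of the weighted likelihood. -/
theorem integral_exp_wlScore_le (hσ : 0 < σ) (hB₀ : 0 < B₀) (hB₁ : 1 < B₁) (hX : Measurable X)
    (hZ : AEMeasurable (observed Ypot T X) P) (hψ : Measurable ψ) (hf : ∀ j, Measurable (f j))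
    (hB : ∀ᵐ ω ∂P, ∀ j, |f j (X ω)| ≤ B₀)
    (hodds : ∀ᵐ ω ∂P, ∑ k : {k : Fin K // k ≠ t}, Real.exp (lin f γ k (X ω)) ≤ B₁ - 1)
    (hW : ∀ k, SubGaussianGiven P X (fun ω => Ypot t ω - ψ (lin f α k (X ω))) σ)
    (j : Fin (p + 1)) :
    Integrable (fun ω => Real.exp ((∑ k, (oddsWeight f γ k (observed Ypot T X ω) *
      outcomeResid ψ f α k (observed Ypot T X ω) * f j (X ω)) ^ 2) /
        (B₀ * (B₁ - 1) * σ) ^ 2)) P ∧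
    ∫ ω, Real.exp ((∑ k, (oddsWeight f γ k (observed Ypot T X ω) *
      outcomeResid ψ f α k (observed Ypot T X ω) * f j (X ω)) ^ 2) /
        (B₀ * (B₁ - 1) * σ) ^ 2) ∂P ≤ 2 := by
  have hβ : 0 < B₁ - 1 := by linarith
  -- These are sub-probability weights measurable in `X`. Jensen gives `E exp ≤ 2 ∑ E w_k + 1 - ∑ E
  -- w_k ≤ 2`, so the number of treatments does not enter the sub-Gaussian parameter.
  set w : {k : Fin K // k ≠ t} → Ω₀ → ℝ := fun k ω => Real.exp (lin f γ k (X ω)) / (B₁ - 1) with hw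
  set y : {k : Fin K // k ≠ t} → Ω₀ → ℝ := fun k ω =>
    (Ypot t ω - ψ (lin f α k (X ω))) ^ 2 / σ ^ 2 with hy
  have hw0 : ∀ k ω, 0 ≤ w k ω := fun k ω => by positivity
  have hwsum : ∀ᵐ ω ∂P, ∑ k, w k ω ≤ 1 := by
    filter_upwards [hodds] with ω hω
    simp only [hw, ← Finset.sum_div]
    rwa [div_le_one hβ]
  have hwb : ∀ k, ∀ᵐ ω ∂P, 0 ≤ w k ω ∧ w k ω ≤ 1 := fun k => by
    filter_upwards [hwsum] with ω hω
    exact ⟨hw0 k ω, (Finset.single_le_sum (f := fun k => w k ω) (fun k _ => hw0 k ω)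
      (Finset.mem_univ k)).trans hω⟩
  have hwm : ∀ k, StronglyMeasurable[(inferInstance : MeasurableSpace 𝒳).comap X] (w k) := fun k =>
    ((((measurable_lin hf γ k).exp).div_const (B₁ - 1)).comp
      (comap_measurable X)).stronglyMeasurable
  have hkey := fun k => integral_mul_exp_le_of_subGaussianGiven hX (hW k) (hwm k) (hwb k)
  have hwi : ∀ k, Integrable (w k) P := fun k =>
    Integrable.of_bound ((hwm k).mono hX.comap_le).aestronglyMeasurable 1 ((hwb k).mono fun ω h => by
      rw [Real.norm_eq_abs, abs_of_nonneg h.1]; exact h.2)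
  have hi1 : Integrable (fun ω => ∑ k, w k ω * Real.exp (y k ω)) P :=
    integrable_finsetSum _ fun k _ => (hkey k).1
  have hi2 : Integrable (fun ω => 1 - ∑ k, w k ω) P :=
    (integrable_const _).sub (integrable_finsetSum _ fun k _ => hwi k)
  have hpt : ∀ᵐ ω ∂P, Real.exp ((∑ k, (oddsWeight f γ k (observed Ypot T X ω) *
      outcomeResid ψ f α k (observed Ypot T X ω) * f j (X ω)) ^ 2) / (B₀ * (B₁ - 1) * σ) ^ 2) ≤
      ∑ k, w k ω * Real.exp (y k ω) + (1 - ∑ k, w k ω) := by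
    filter_upwards [hodds, hwsum, hB] with ω h1 h2 h3
    refine (Real.exp_le_exp.2 ?_).trans (exp_sum_mul_le (fun k => hw0 k ω) h2)
    rw [Finset.sum_div]
    refine Finset.sum_le_sum fun k _ => ?_
    have e := oddsWeight_mul_outcomeResid (f := f) (ψ := ψ) (γ := γ) (α := α) (Ypot := Ypot)
      (T := T) (X := X) k ω id
    simp only [id] at e
    rw [e]
    have hv0 := oddsWeight_nonneg f γ k (observed Ypot T X ω)
    have hv1 := oddsWeight_le (z := observed Ypot T X ω) h1 k
    have hv2 : oddsWeight f γ k (observed Ypot T X ω) ≤ Real.exp (lin f γ k (X ω)) :=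
      mul_le_of_le_one_left (Real.exp_pos _).le (R_le_one _ _)
    set v := oddsWeight f γ k (observed Ypot T X ω)
    set W := Ypot t ω - ψ (lin f α k (X ω)) with hWdef
    have hf2 : f j (X ω) ^ 2 ≤ B₀ ^ 2 := by
      rw [← sq_abs]; exact pow_le_pow_left₀ (abs_nonneg _) (h3 j) 2
    -- One factor is bounded by `B₁ - 1`; the other is kept to form the Jensen weight.
    have hv3 : v ^ 2 ≤ (B₁ - 1) * Real.exp (lin f γ k (X ω)) := by
      rw [sq]; exact mul_le_mul hv1 hv2 hv0 hβ.le
    have hfinal : (v * W * f j (X ω)) ^ 2 ≤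
        (B₁ - 1) * Real.exp (lin f γ k (X ω)) * W ^ 2 * B₀ ^ 2 := by
      rw [mul_pow, mul_pow]
      exact mul_le_mul (mul_le_mul_of_nonneg_right hv3 (sq_nonneg _)) hf2 (sq_nonneg _)
        (by positivity)
    simp only [hw, hy, ← hWdef]
    rw [div_le_iff₀ (by positivity)]
    refine hfinal.trans (le_of_eq ?_)
    field_simp
  have hmeas : AEStronglyMeasurable (fun ω => Real.exp ((∑ k,
      (oddsWeight f γ k (observed Ypot T X ω) * outcomeResid ψ f α k (observed Ypot T X ω) *
        f j (X ω)) ^ 2) / (B₀ * (B₁ - 1) * σ) ^ 2)) P := by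
    have h1 := fun k => measurable_oddsWeight hf γ k
    have h2 := fun k => measurable_outcomeResid hψ hf α k
    have h3 := hf j
    have : Measurable fun z : Obs K 𝒳 => Real.exp ((∑ k, (oddsWeight f γ k z *
      outcomeResid ψ f α k z * f j z.2.2) ^ 2) / (B₀ * (B₁ - 1) * σ) ^ 2) := by fun_prop
    exact (this.comp_aemeasurable hZ).aestronglyMeasurable
  have hint := (hi1.add hi2).mono' hmeas (hpt.mono fun ω h => by
    rw [Real.norm_eq_abs, abs_of_pos (Real.exp_pos _)]; exact h)
  refine ⟨hint, ?_⟩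
  calc _ ≤ ∫ ω, (∑ k, w k ω * Real.exp (y k ω) + (1 - ∑ k, w k ω)) ∂P :=
        integral_mono_ae hint (hi1.add hi2) hpt
    _ = ∑ k, ∫ ω, w k ω * Real.exp (y k ω) ∂P + (1 - ∑ k, ∫ ω, w k ω ∂P) := by
        rw [integral_add hi1 hi2, integral_finsetSum _ fun k _ => (hkey k).1,
          integral_sub (integrable_const _) (integrable_finsetSum _ fun k _ => hwi k),
          integral_finsetSum _ fun k _ => hwi k]
        simp [hy]
    _ ≤ ∑ k, 2 * ∫ ω, w k ω ∂P + (1 - ∑ k, ∫ ω, w k ω ∂P) := by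
        gcongr with k _
        exact (hkey k).2
    _ = 1 + ∫ ω, ∑ k, w k ω ∂P := by
        rw [← Finset.mul_sum, integral_finsetSum _ fun k _ => hwi k]; ring
    _ ≤ 1 + 1 := by
        gcongr
        calc ∫ ω, ∑ k, w k ω ∂P ≤ ∫ _, (1 : ℝ) ∂P :=
              integral_mono_ae (integrable_finsetSum _ fun k _ => hwi k) (integrable_const _) hwsum
          _ = 1 := by simp
    _ = 2 := by norm_num

/-- Exponential moment of the entries of the residual-weighted Gram matrix. -/
theorem integral_exp_residGram_le (hσ : 0 < σ) (hB₀ : 0 < B₀) (hB₁ : 1 < B₁) (hX : Measurable X)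
    (hZ : AEMeasurable (observed Ypot T X) P) (hψ : Measurable ψ) (hf : ∀ j, Measurable (f j))
    (hB : ∀ᵐ ω ∂P, ∀ j, |f j (X ω)| ≤ B₀)
    (hodds : ∀ᵐ ω ∂P, ∑ k : {k : Fin K // k ≠ t}, Real.exp (lin f γ k (X ω)) ≤ B₁ - 1)
    (k : {k : Fin K // k ≠ t})
    (hW : SubGaussianGiven P X (fun ω => Ypot t ω - ψ (lin f α k (X ω))) σ)
    (i j : Fin (p + 1)) :
    Integrable (fun ω => Real.exp |(oddsWeight f γ k (observed Ypot T X ω) *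
      outcomeResid ψ f α k (observed Ypot T X ω) ^ 2 * (f i (X ω) * f j (X ω))) /
        (B₀ ^ 2 * (B₁ - 1) * σ ^ 2)|) P ∧
    ∫ ω, Real.exp |(oddsWeight f γ k (observed Ypot T X ω) *
      outcomeResid ψ f α k (observed Ypot T X ω) ^ 2 * (f i (X ω) * f j (X ω))) /
        (B₀ ^ 2 * (B₁ - 1) * σ ^ 2)| ∂P ≤ 2 := by
  have hβ : 0 < B₁ - 1 := by linarith
  have hpt : ∀ᵐ ω ∂P, Real.exp |(oddsWeight f γ k (observed Ypot T X ω) *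
      outcomeResid ψ f α k (observed Ypot T X ω) ^ 2 * (f i (X ω) * f j (X ω))) /
        (B₀ ^ 2 * (B₁ - 1) * σ ^ 2)| ≤
      Real.exp ((Ypot t ω - ψ (lin f α k (X ω))) ^ 2 / σ ^ 2) := by
    filter_upwards [hodds, hB] with ω h1 h3
    refine Real.exp_le_exp.2 ?_
    rw [oddsWeight_mul_outcomeResid (f := f) (ψ := ψ) (γ := γ) (α := α) (Ypot := Ypot)
      (T := T) (X := X) k ω (fun x => x ^ 2)]
    have hv0 := oddsWeight_nonneg f γ k (observed Ypot T X ω)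
    have hv1 := oddsWeight_le (z := observed Ypot T X ω) h1 k
    set v := oddsWeight f γ k (observed Ypot T X ω)
    set W := Ypot t ω - ψ (lin f α k (X ω)) with hWdef
    rw [abs_div, abs_of_pos (by positivity : 0 < B₀ ^ 2 * (B₁ - 1) * σ ^ 2), abs_mul, abs_mul,
      abs_of_nonneg hv0, abs_of_nonneg (sq_nonneg W), abs_mul, div_le_div_iff₀ (by positivity)
      (by positivity)]
    have hff : |f i (X ω)| * |f j (X ω)| ≤ B₀ * B₀ :=
      mul_le_mul (h3 i) (h3 j) (abs_nonneg _) hB₀.le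
    have : v * W ^ 2 * (|f i (X ω)| * |f j (X ω)|) ≤ (B₁ - 1) * W ^ 2 * (B₀ * B₀) :=
      mul_le_mul (mul_le_mul_of_nonneg_right hv1 (sq_nonneg _)) hff (by positivity) (by positivity)
    nlinarith [mul_le_mul_of_nonneg_right this (sq_nonneg σ)]
  have hmeas : AEStronglyMeasurable (fun ω => Real.exp |(oddsWeight f γ k (observed Ypot T X ω) *
      outcomeResid ψ f α k (observed Ypot T X ω) ^ 2 * (f i (X ω) * f j (X ω))) /
        (B₀ ^ 2 * (B₁ - 1) * σ ^ 2)|) P := by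
    have h1 := measurable_oddsWeight hf γ k
    have h2 := measurable_outcomeResid hψ hf α k
    have h3 := hf
    have : Measurable fun z : Obs K 𝒳 => (oddsWeight f γ k z *
      outcomeResid ψ f α k z ^ 2 * (f i z.2.2 * f j z.2.2)) / (B₀ ^ 2 * (B₁ - 1) * σ ^ 2) := by
      fun_prop
    exact ((continuous_abs.measurable.comp this).exp.comp_aemeasurable hZ).aestronglyMeasurable
  have hint := hW.1.mono' hmeas (hpt.mono fun ω h => by
    rw [Real.norm_eq_abs, abs_of_pos (Real.exp_pos _)]; exact h)
  refine ⟨hint, (integral_mono_ae hint hW.1 hpt).trans ?_⟩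
  have := (integral_mul_exp_le_of_subGaussianGiven hX hW (g := fun _ => 1) (C := 1)
    stronglyMeasurable_const (ae_of_all _ fun _ => ⟨zero_le_one, le_rfl⟩)).2
  simpa using this

omit [MeasurableSpace 𝒳] [IsProbabilityMeasure P] in
theorem integral_quadForm {g : Ω₀ → {k : Fin K // k ≠ t} → ℝ} (x : Ω₀ → 𝒳) (b : Coef p K t)
    (hi : ∀ i j k, Integrable (fun ω => g ω k * (f i (x ω) * f j (x ω))) P) :
    ∫ ω, ∑ k, g ω k * lin f b k (x ω) ^ 2 ∂P =
      ∑ k, ∑ i, ∑ j, b i k * (∫ ω, g ω k * (f i (x ω) * f j (x ω)) ∂P) * b j k := by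
  have hi' : ∀ i j k, Integrable (fun ω => b i k * (g ω k * (f i (x ω) * f j (x ω))) * b j k) P :=
    fun i j k => ((hi i j k).const_mul _).mul_const _
  simp only [sum_mul_lin_sq]
  rw [integral_finsetSum _ fun k _ => integrable_finsetSum _ fun i _ =>
    integrable_finsetSum _ fun j _ => hi' i j k]
  refine Finset.sum_congr rfl fun k _ => ?_
  rw [integral_finsetSum _ fun i _ => integrable_finsetSum _ fun j _ => hi' i j k]
  refine Finset.sum_congr rfl fun i _ => ?_
  rw [integral_finsetSum _ fun j _ => hi' i j k]
  exact Finset.sum_congr rfl fun j _ => by rw [integral_mul_const, integral_const_mul]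

/-- The residual-weighted population quadratic form is bounded by the unweighted one. -/
theorem integral_residualForm_le (h : CausalAssumptions P Ypot T X) (hσ : 0 < σ)
    (hψ : Measurable ψ) (hf : ∀ j, Measurable (f j))
    (hB : ∀ᵐ ω ∂P, ∀ j, |f j (X ω)| ≤ B₀)
    (hodds : ∀ᵐ ω ∂P, ∑ k : {k : Fin K // k ≠ t}, Real.exp (lin f γ k (X ω)) ≤ B₁ - 1)
    (k : {k : Fin K // k ≠ t})
    (hW : SubGaussianGiven P X (fun ω => Ypot t ω - ψ (lin f α k (X ω))) σ) (b : Coef p K t) :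
    ∫ ω, oddsWeight f γ k (observed Ypot T X ω) *
        outcomeResid ψ f α k (observed Ypot T X ω) ^ 2 * lin f b k (X ω) ^ 2 ∂P ≤
      σ ^ 2 * Real.log 2 *
        ∫ ω, oddsWeight f γ k (observed Ypot T X ω) * lin f b k (X ω) ^ 2 ∂P := by
  have hS : MeasurableSet {ω | T ω = t} := h.measurable_T (measurableSet_singleton t)
  have hm1 := measurable_lin hf γ k
  have hm2 := measurable_lin hf α k
  have hm3 := measurable_lin hf b k
  have key := setIntegral_mul_sq_le h t (q := fun x => ψ (lin f α k x)) (hψ.comp hm2) hσ hW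
    (g := fun x => Real.exp (lin f γ k x) * lin f b k x ^ 2) (by fun_prop)
    (C := (B₁ - 1) * (B₀ * norm21 b) ^ 2) (by
      filter_upwards [hB, hodds] with ω h1 h2
      have h3 : lin f b k (X ω) ^ 2 ≤ (B₀ * norm21 b) ^ 2 := by
        rw [← sq_abs]; exact pow_le_pow_left₀ (abs_nonneg _) (abs_lin_le h1 b k) 2
      have h4 : Real.exp (lin f γ k (X ω)) ≤ B₁ - 1 :=
        (Finset.single_le_sum (f := fun k => Real.exp (lin f γ k (X ω)))
          (fun k _ => (Real.exp_pos _).le) (Finset.mem_univ k)).trans h2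
      exact ⟨by positivity, mul_le_mul h4 h3 (sq_nonneg _) ((Real.exp_pos _).le.trans h4)⟩)
  rw [← integral_indicator hS, ← integral_indicator hS] at key
  refine le_trans (le_of_eq ?_) (key.trans (le_of_eq ?_))
  · refine integral_congr_ae (ae_of_all _ fun ω => ?_)
    by_cases hω : T ω = t
    · simp only [oddsWeight, outcomeResid, R, observed, hω, Set.indicator, Set.mem_ofPred_eq, if_true]
      ring
    · simp [oddsWeight, R, observed, hω, Set.indicator]
  · congr 1
    refine integral_congr_ae (ae_of_all _ fun ω => ?_)
    by_cases hω : T ω = t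
    · simp [oddsWeight, R, observed, hω, Set.indicator]
    · simp [oddsWeight, R, observed, hω, Set.indicator]

end Moments

/-! ### Tail bounds for i.i.d. sample means and union bounds. -/

section SampleConcentration

variable {p K n : ℕ} {t : Fin K} {𝒳 Ω₀ Ω : Type*} [MeasurableSpace 𝒳] [MeasurableSpace Ω₀]
  [MeasurableSpace Ω] {P : Measure Ω₀} {μ : Measure Ω} [IsProbabilityMeasure μ]
  {Z : Ω₀ → Obs K 𝒳} {O : Fin n → Ω → Obs K 𝒳}

/-- One row of a score is a vector indexed by `k`; treating it in Euclidean norm avoids a union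
bound over `k`. -/
theorem measure_vector_sampleMean_gt_le (hn : 1 ≤ n) (hind : iIndepFun O μ)
    (hid : ∀ i, IdentDistrib (O i) Z μ P) {h : {k : Fin K // k ≠ t} → Obs K 𝒳 → ℝ}
    (hh : ∀ k, Measurable (h k)) (hint : ∀ k, Integrable (fun ω => h k (Z ω)) P)
    (h0 : ∀ k, ∫ ω, h k (Z ω) ∂P = 0) {σ : ℝ} (hσ : 0 < σ)
    (hi : Integrable (fun ω => Real.exp ((∑ k, h k (Z ω) ^ 2) / σ ^ 2)) P)
    (h2 : ∫ ω, Real.exp ((∑ k, h k (Z ω) ^ 2) / σ ^ 2) ∂P ≤ 2) {x lam : ℝ} (hlam : 0 ≤ lam)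
    (hx : 3 * (1 + x) * σ ^ 2 ≤ n * lam ^ 2) :
    μ {ω | lam < √(∑ k, sampleMean (fun i => O i ω) (h k) ^ 2)} ≤
      ENNReal.ofReal (2 * Real.exp (-x)) := by
  have hn0 : (0 : ℝ) < n := by exact_mod_cast hn
  set v : Obs K 𝒳 → EuclideanSpace ℝ {k : Fin K // k ≠ t} := fun z => WithLp.toLp 2 fun k => h k z
    with hv
  have hvm : Measurable v := by
    refine (PiLp.continuous_toLp 2 _).measurable.comp (measurable_pi_iff.2 fun k => hh k)
  have hnorm : ∀ z, ‖v z‖ ^ 2 = ∑ k, h k z ^ 2 := fun z => by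
    rw [EuclideanSpace.norm_sq_eq]; simp [hv]
  have hm := fun i => (hid i).aemeasurable_fst
  have hexp : Measurable fun z => Real.exp ((∑ k, h k z ^ 2) / σ ^ 2) := by fun_prop
  have key := measure_norm_sum_sq_ge_le hn (V := fun i ω => v (O i ω))
    (fun i => hvm.comp_aemeasurable (hm i)) (hind.comp (fun _ => v) fun _ => hvm) hσ
    (fun i => by
      simp only [hnorm]
      exact ((hid i).comp hexp).integrable_iff.2 hi)
    (fun i => by
      simp only [hnorm]
      exact ((hid i).comp hexp).integral_eq.trans_le h2)
    (fun i u => by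
      have hk : ∀ k, ∫ ω, h k (O i ω) ∂μ = 0 := fun k =>
        ((hid i).comp (hh k)).integral_eq.trans (h0 k)
      have hik : ∀ k, Integrable (fun ω => h k (O i ω)) μ := fun k =>
        ((hid i).comp (hh k)).integrable_iff.2 (hint k)
      simp only [hv, PiLp.inner_apply, RCLike.inner_apply, conj_trivial]
      rw [integral_finsetSum _ fun k _ => (hik k).mul_const _]
      simp only [integral_mul_const, hk, zero_mul, Finset.sum_const_zero]) x
  refine (measure_mono fun ω hω => ?_).trans key
  simp only [Set.mem_ofPred_eq] at hω ⊢
  have e : ‖∑ i, v (O i ω)‖ ^ 2 = n ^ 2 * ∑ k, sampleMean (fun i => O i ω) (h k) ^ 2 := by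
    rw [EuclideanSpace.norm_sq_eq, Finset.mul_sum]
    refine Finset.sum_congr rfl fun k _ => ?_
    simp only [hv, sampleMean]
    rw [WithLp.ofLp_sum, Finset.sum_apply, Real.norm_eq_abs, sq_abs]
    field_simp
  rw [Real.lt_sqrt hlam] at hω
  rw [e]
  calc 3 * n * (1 + x) * σ ^ 2 = n * (3 * (1 + x) * σ ^ 2) := by ring
    _ ≤ n * (n * lam ^ 2) := mul_le_mul_of_nonneg_left hx hn0.le
    _ = n ^ 2 * lam ^ 2 := by ring
    _ ≤ _ := mul_le_mul_of_nonneg_left hω.le (by positivity)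

theorem measure_sampleMean_sub_gt_le_of_bounded (hn : 1 ≤ n) (hind : iIndepFun O μ)
    (hid : ∀ i, IdentDistrib (O i) Z μ P) {g : Obs K 𝒳 → ℝ} (hg : Measurable g) {L : ℝ}
    (hL : 0 < L) (hb : ∀ᵐ ω ∂P, |g (Z ω)| ≤ L) {y : ℝ} (hy : 0 ≤ y) :
    μ {ω | y < |sampleMean (fun i => O i ω) g - ∫ ω, g (Z ω) ∂P|} ≤
      ENNReal.ofReal (2 * Real.exp (-(n * y ^ 2 / (2 * L ^ 2)))) := by
  have hn0 : (0 : ℝ) < n := by exact_mod_cast hn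
  have key := measure_abs_sum_sub_ge_le_of_bounded (ζ := fun i ω => g (O i ω))
    (fun i => hg.comp_aemeasurable (hid i).aemeasurable_fst) (hind.comp (fun _ => g) fun _ => hg)
    hL (fun i => (hid i).symm.ae_snd (p := fun z => |g z| ≤ L)
      (measurableSet_le (continuous_abs.measurable.comp hg) measurable_const) hb)
    (fun i => ((hid i).comp hg).integral_eq) hy hn
  refine (measure_mono fun ω hω => ?_).trans key
  simp only [Set.mem_ofPred_eq] at hω ⊢
  set m := ∫ ω, g (Z ω) ∂P
  have e : ∑ i, g (O i ω) - n * m = n * (sampleMean (fun i => O i ω) g - m) := by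
    rw [sampleMean]; field_simp
  have em : ∫ ω, (g ∘ Z) ω ∂P = m := rfl
  rw [em, e, abs_mul, abs_of_pos hn0]
  exact mul_le_mul_of_nonneg_left hω.le hn0.le

theorem measure_sampleMean_sub_gt_le_of_exp (hn : 1 ≤ n) (hind : iIndepFun O μ)
    (hid : ∀ i, IdentDistrib (O i) Z μ P) {g : Obs K 𝒳 → ℝ} (hg : Measurable g) {s : ℝ}
    (hs : 0 < s) (hi : Integrable (fun ω => Real.exp |g (Z ω) / s|) P)
    (h2 : ∫ ω, Real.exp |g (Z ω) / s| ∂P ≤ 2) {ρ : ℝ} (hρ0 : 0 ≤ ρ) (hρ1 : ρ ≤ 1) :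
    μ {ω | 16 * ρ * s < |sampleMean (fun i => O i ω) g - ∫ ω, g (Z ω) ∂P|} ≤
      ENNReal.ofReal (2 * Real.exp (-(3 * n * ρ ^ 2))) := by
  have hn0 : (0 : ℝ) < n := by exact_mod_cast hn
  have hgs : Measurable fun z => g z / s := hg.div_const s
  have hexp : Measurable fun z => Real.exp |g z / s| := (continuous_abs.measurable.comp hgs).exp
  have key := measure_abs_sum_sub_ge_le (ζ := fun i ω => g (O i ω) / s)
    (fun i => hgs.comp_aemeasurable (hid i).aemeasurable_fst)
    (hind.comp (fun _ z => g z / s) fun _ => hgs)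
    (fun i => ((hid i).comp hexp).integrable_iff.2 hi)
    (fun i => ((hid i).comp hexp).integral_eq.trans_le h2)
    (fun i => ((hid i).comp hgs).integral_eq) hρ0 hρ1
  refine (measure_mono fun ω hω => ?_).trans key
  simp only [Set.mem_ofPred_eq] at hω ⊢
  have em : ∫ ω, ((fun z => g z / s) ∘ Z) ω ∂P = (∫ ω, g (Z ω) ∂P) / s := integral_div _ _
  set m := ∫ ω, g (Z ω) ∂P
  have e : ∑ i, g (O i ω) / s - n * (m / s) = n * (sampleMean (fun i => O i ω) g - m) / s := by
    rw [sampleMean, ← Finset.sum_div]; field_simp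
  rw [em, e, abs_div, abs_mul, abs_of_pos hn0, abs_of_pos hs, le_div_iff₀ hs]
  have := mul_le_mul_of_nonneg_left hω.le hn0.le
  linarith

omit [IsProbabilityMeasure μ] in
theorem measure_iUnion_le_card_mul {ι : Type*} [Fintype ι] {S : ι → Set Ω} {c : ℝ}
    (h : ∀ i, μ (S i) ≤ ENNReal.ofReal c) {d : ℝ} (hd : Fintype.card ι * c ≤ d) :
    μ (⋃ i, S i) ≤ ENNReal.ofReal d := by
  calc μ (⋃ i, S i) ≤ ∑ i, μ (S i) := measure_iUnion_fintype_le μ S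
    _ ≤ ∑ _i : ι, ENNReal.ofReal c := Finset.sum_le_sum fun i _ => h i
    _ = ENNReal.ofReal (Fintype.card ι * c) := by
        rw [Finset.sum_const, Finset.card_univ, nsmul_eq_mul,
          ENNReal.ofReal_mul (Nat.cast_nonneg _), ENNReal.ofReal_natCast]
    _ ≤ _ := ENNReal.ofReal_le_ofReal hd

end SampleConcentration

/-! ### The rate and the cost of the union bounds. -/

section Rate

theorem natCast_mul_rate_sq {K p n : ℕ} {ε : ℝ} (hK : 2 ≤ K) (hn : 1 ≤ n) (hε : 0 < ε)
    (hε1 : ε < 1) :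
    n * Constants.rate K p n ε ^ 2 = ((K : ℝ) - 1) + Real.log (((p : ℝ) + 1) / ε) := by
  have hn0 : (0 : ℝ) < n := by exact_mod_cast hn
  have hK2 : (2 : ℝ) ≤ K := by exact_mod_cast hK
  have hlog : 0 ≤ Real.log (((p : ℝ) + 1) / ε) := by
    refine Real.log_nonneg ?_
    rw [le_div_iff₀ hε]
    have : (0 : ℝ) ≤ p := Nat.cast_nonneg p
    linarith
  have hK1 : (0 : ℝ) ≤ K - 1 := by linarith
  rw [Constants.rate, Real.sq_sqrt (by positivity)]
  field_simp

theorem exp_neg_log_rate {p : ℕ} {ε : ℝ} (hε : 0 < ε) :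
    Real.exp (-Real.log (((p : ℝ) + 1) / ε)) = ε / (p + 1) := by
  rw [Real.exp_neg, Real.exp_log (by positivity), inv_div]

theorem card_ne (K : ℕ) (t : Fin K) (hK : 2 ≤ K) :
    (Fintype.card {k : Fin K // k ≠ t} : ℝ) = (K : ℝ) - 1 := by
  have h : Fintype.card {k : Fin K // k ≠ t} = K - 1 := by
    rw [Fintype.card_subtype_compl]; simp
  rw [h, Nat.cast_sub (by omega), Nat.cast_one]

/-- The `(p+1)²` pairs are absorbed by `(ε/(p+1))²` and the `K - 1` columns by `e^{-2(K-1)}`; there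
remains `2ε² ≤ 2ε`. -/
theorem card_mul_exp_le {K p : ℕ} (t : Fin K) {ε : ℝ} (hK : 2 ≤ K) (hε : 0 < ε) (hε1 : ε < 1)
    {y : ℝ} (hy : 2 * (((K : ℝ) - 1) + Real.log (((p : ℝ) + 1) / ε)) ≤ y) :
    (Fintype.card (Fin (p + 1) × Fin (p + 1) × {k : Fin K // k ≠ t}) : ℝ) *
      (2 * Real.exp (-y)) ≤ 2 * ε := by
  rw [Fintype.card_prod, Fintype.card_prod, Fintype.card_fin]
  push_cast
  rw [card_ne K t hK]
  have hK2 : (2 : ℝ) ≤ K := by exact_mod_cast hK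
  set N : ℝ := (K : ℝ) - 1 with hN
  set x := Real.log (((p : ℝ) + 1) / ε)
  have hN0 : 0 ≤ N := by linarith
  have h1 : Real.exp (-y) ≤ Real.exp (-(2 * N)) * (ε / (p + 1)) ^ 2 := by
    rw [← exp_neg_log_rate hε, ← Real.exp_nat_mul, ← Real.exp_add]
    refine Real.exp_le_exp.2 ?_
    push_cast
    linarith
  have h2 : N * Real.exp (-(2 * N)) ≤ 1 := by
    rw [Real.exp_neg, ← div_eq_mul_inv, div_le_one (Real.exp_pos _)]
    linarith [Real.add_one_le_exp (2 * N)]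
  have hp : (0 : ℝ) < p + 1 := by positivity
  calc (p + 1) * ((p + 1) * N) * (2 * Real.exp (-y))
      ≤ (p + 1) * ((p + 1) * N) * (2 * (Real.exp (-(2 * N)) * (ε / (p + 1)) ^ 2)) := by
        gcongr
    _ = 2 * ε ^ 2 * (N * Real.exp (-(2 * N))) := by field_simp
    _ ≤ 2 * ε ^ 2 * 1 := mul_le_mul_of_nonneg_left h2 (by positivity)
    _ ≤ 2 * ε := by nlinarith

end Rate

/-! ### Probability of each family of deviations. -/

section GoodEvent

variable {p K n : ℕ} {t : Fin K} {𝒳 Ω₀ Ω : Type*} [MeasurableSpace 𝒳] [MeasurableSpace Ω₀]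
  [MeasurableSpace Ω] {P : Measure Ω₀} [IsProbabilityMeasure P] {μ : Measure Ω}
  [IsProbabilityMeasure μ] {Z : Ω₀ → Obs K 𝒳} {O : Fin n → Ω → Obs K 𝒳}
  {f : Fin (p + 1) → 𝒳 → ℝ} {ψ : ℝ → ℝ} {γ α : Coef p K t} {B₀ B₁ σ ε : ℝ}


theorem card_mul_exp_neg_log_le (hε : 0 < ε) :
    (Fintype.card (Fin (p + 1)) : ℝ) * (2 * Real.exp (-Real.log (((p : ℝ) + 1) / ε))) ≤
      2 * ε := by
  rw [exp_neg_log_rate hε, Fintype.card_fin]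
  push_cast
  have : (0 : ℝ) < p + 1 := by positivity
  refine le_of_eq ?_
  field_simp

theorem measure_calScore_gt_le (hn : 1 ≤ n) (hε : 0 < ε) (hind : iIndepFun O μ)
    (hid : ∀ i, IdentDistrib (O i) Z μ P) (hf : ∀ j, Measurable (f j)) (hB₀ : 0 < B₀)
    (hB₁ : 1 < B₁) (hB : ∀ᵐ ω ∂P, ∀ j, |f j (Z ω).2.2| ≤ B₀)
    (hodds : ∀ᵐ ω ∂P, ∑ k : {k : Fin K // k ≠ t}, Real.exp (lin f γ k (Z ω).2.2) ≤ B₁ - 1)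
    (hγ : IsTargetCAL P Z f γ) {lam : ℝ} (hlam : 0 ≤ lam)
    (hl : 6 * (1 + Real.log (((p : ℝ) + 1) / ε)) * (B₀ * B₁) ^ 2 ≤ n * lam ^ 2) :
    μ (⋃ j, {ω | lam < rowNorm (calScore (fun i => O i ω) f γ) j}) ≤ ENNReal.ofReal (2 * ε) := by
  have hZ : AEMeasurable Z P := (hid ⟨0, hn⟩).aemeasurable_snd
  refine measure_iUnion_le_card_mul (fun j => ?_) (card_mul_exp_neg_log_le hε)
  set h : {k : Fin K // k ≠ t} → Obs K 𝒳 → ℝ := fun k z =>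
    (oddsWeight f γ k z - R k.1 z) * f j z.2.2 with hh
  have hm : ∀ k, Measurable (h k) := fun k => by
    have h1 := measurable_oddsWeight hf γ k
    have h2 := measurable_R (𝒳 := 𝒳) k.1
    have h3 := hf j
    simp only [hh]; fun_prop
  -- The factor `√2` makes the exponent at most `1/2`, and `e^{1/2} ≤ 2` is the required moment
  -- bound.
  set s : ℝ := √2 * (B₀ * B₁) with hs
  have hs0 : 0 < s := by positivity
  have hs2 : s ^ 2 = 2 * (B₀ * B₁) ^ 2 := by rw [hs, mul_pow, Real.sq_sqrt zero_le_two]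
  -- The Euclidean norm over `k` is at most the `ℓ¹` norm, and the masses of the weights and of the
  -- indicators add up to at most `B₁`.
  have hsum : ∀ᵐ ω ∂P, ∑ k, h k (Z ω) ^ 2 ≤ (B₀ * B₁) ^ 2 := by
    filter_upwards [hB, hodds] with ω h1 h2
    have h3 := sum_oddsWeight_le h2
    have h4 := sum_R_le_one (t := t) (Z ω)
    have h5 : ∀ k, |h k (Z ω)| ≤ (oddsWeight f γ k (Z ω) + R k.1 (Z ω)) * B₀ := fun k => by
      simp only [hh, abs_mul]
      refine mul_le_mul ((abs_sub _ _).trans ?_) (h1 j) (abs_nonneg _)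
        (add_nonneg (oddsWeight_nonneg _ _ _ _) (R_nonneg _ _))
      rw [abs_of_nonneg (oddsWeight_nonneg _ _ _ _), abs_of_nonneg (R_nonneg _ _)]
    have h6 : ∑ k, |h k (Z ω)| ≤ B₀ * B₁ := by
      refine (Finset.sum_le_sum fun k _ => h5 k).trans ?_
      rw [← Finset.sum_mul, Finset.sum_add_distrib]
      nlinarith
    calc ∑ k, h k (Z ω) ^ 2 = ∑ k, |h k (Z ω)| ^ 2 := by simp only [sq_abs]
      _ ≤ (∑ k, |h k (Z ω)|) ^ 2 :=
        Finset.sum_sq_le_sq_sum_of_nonneg fun k _ => abs_nonneg _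
      _ ≤ _ := pow_le_pow_left₀ (Finset.sum_nonneg fun k _ => abs_nonneg _) h6 2
  have hexpb : ∀ᵐ ω ∂P, |Real.exp ((∑ k, h k (Z ω) ^ 2) / s ^ 2)| ≤ 2 := by
    filter_upwards [hsum] with ω hω
    rw [abs_of_pos (Real.exp_pos _)]
    have h1 : (∑ k, h k (Z ω) ^ 2) / s ^ 2 ≤ 1 / 2 := by
      rw [div_le_iff₀ (by positivity), hs2]; linarith
    have h2 : Real.exp (1 / 2) ^ 2 = Real.exp 1 := by rw [← Real.exp_nat_mul]; norm_num
    have h3 : Real.exp (1 / 2) ≤ 2 := by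
      nlinarith [Real.exp_one_lt_d9, Real.exp_pos (1 / 2)]
    exact (Real.exp_le_exp.2 h1).trans h3
  have hexpi : Integrable (fun ω => Real.exp ((∑ k, h k (Z ω) ^ 2) / s ^ 2)) P :=
    integrable_comp_of_abs_le (g := fun z => Real.exp ((∑ k, h k z ^ 2) / s ^ 2)) hZ
      (by fun_prop) hexpb
  refine measure_vector_sampleMean_gt_le hn hind hid (h := h) hm (fun k => ?_)
    (fun k => integral_calScore_eq_zero hZ hf hB hodds hγ j k) hs0 hexpi ?_ hlam ?_
  · refine integrable_comp_of_abs_le (g := h k) hZ (hm k) (C := B₀ * B₁) ?_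
    filter_upwards [hsum] with ω hω
    refine abs_le_of_sq_le_sq ((Finset.single_le_sum (f := fun k => h k (Z ω) ^ 2)
      (fun k _ => sq_nonneg _) (Finset.mem_univ k)).trans hω) (by positivity)
  · calc _ ≤ ∫ _ω, (2 : ℝ) ∂P := integral_mono_ae hexpi (integrable_const _)
          (hexpb.mono fun ω h => (le_abs_self _).trans h)
      _ = 2 := by simp
  · rw [hs2]; linarith

omit [IsProbabilityMeasure P] in
theorem measure_gram_sub_gt_le (hK : 2 ≤ K) (hn : 1 ≤ n) (hε : 0 < ε) (hε1 : ε < 1)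
    (hind : iIndepFun O μ) (hid : ∀ i, IdentDistrib (O i) Z μ P) (hf : ∀ j, Measurable (f j))
    (hB₀ : 0 < B₀) (hB₁ : 1 < B₁) (hB : ∀ᵐ ω ∂P, ∀ j, |f j (Z ω).2.2| ≤ B₀)
    (hodds : ∀ᵐ ω ∂P, ∑ k : {k : Fin K // k ≠ t}, Real.exp (lin f γ k (Z ω).2.2) ≤ B₁ - 1)
    {y : ℝ} (hy : 0 ≤ y)
    (hl : 4 * (((K : ℝ) - 1) + Real.log (((p : ℝ) + 1) / ε)) * (B₀ ^ 2 * B₁) ^ 2 ≤ n * y ^ 2) :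
    μ (⋃ q : Fin (p + 1) × Fin (p + 1) × {k : Fin K // k ≠ t}, {ω | y < |sampleMean
      (fun i => O i ω) (fun z => oddsWeight f γ q.2.2 z * (f q.1 z.2.2 * f q.2.1 z.2.2)) -
        ∫ ω, oddsWeight f γ q.2.2 (Z ω) * (f q.1 (Z ω).2.2 * f q.2.1 (Z ω).2.2) ∂P|}) ≤
      ENNReal.ofReal (2 * ε) := by
  have hL : 0 < B₀ ^ 2 * B₁ := by positivity
  refine measure_iUnion_le_card_mul (fun q => ?_) (card_mul_exp_le t hK hε hε1
    (y := n * y ^ 2 / (2 * (B₀ ^ 2 * B₁) ^ 2)) ?_)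
  · refine measure_sampleMean_sub_gt_le_of_bounded hn hind hid
      (g := fun z => oddsWeight f γ q.2.2 z * (f q.1 z.2.2 * f q.2.1 z.2.2)) ?_ hL ?_ hy
    · have h1 := measurable_oddsWeight hf γ q.2.2
      have h2 := hf q.1
      have h3 := hf q.2.1
      fun_prop
    · filter_upwards [hB, hodds] with ω h1 h2
      rw [abs_mul, abs_mul, abs_of_nonneg (oddsWeight_nonneg _ _ _ _)]
      have h3 : oddsWeight f γ q.2.2 (Z ω) ≤ B₁ := (oddsWeight_le h2 _).trans (by linarith)
      calc _ ≤ B₁ * (B₀ * B₀) := by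
            gcongr
            · exact h1 _
            · exact h1 _
        _ = _ := by ring
  · rw [le_div_iff₀ (by positivity)]
    linarith

variable {Ypot : Fin K → Ω₀ → ℝ} {T : Ω₀ → Fin K} {X : Ω₀ → 𝒳}

/-- The residuals are not centered given `X`; the score has mean zero only because `α` minimizes the
expected loss. -/
theorem measure_wlScore_gt_le (hn : 1 ≤ n) (hε : 0 < ε) (hind : iIndepFun O μ)
    (hid : ∀ i, IdentDistrib (O i) (observed Ypot T X) μ P) (hX : Measurable X)
    (hf : ∀ j, Measurable (f j)) (hB₀ : 0 < B₀) (hB₁ : 1 < B₁) (hσ : 0 < σ)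
    (hB : ∀ᵐ ω ∂P, ∀ j, |f j (X ω)| ≤ B₀)
    (hodds : ∀ᵐ ω ∂P, ∑ k : {k : Fin K // k ≠ t}, Real.exp (lin f γ k (X ω)) ≤ B₁ - 1)
    (hψ : Differentiable ℝ ψ) (hm : Monotone ψ) {C₁ C₃ : ℝ} (hC₃ : 0 ≤ C₃)
    (hg : ∀ h h' : ℝ, deriv ψ h ≤ deriv ψ h' * Real.exp (C₃ * |h - h'|))
    (hd : ∀ᵐ ω ∂P, ∀ k : {k : Fin K // k ≠ t}, deriv ψ (lin f α k (X ω)) ≤ C₁)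
    (hW : ∀ k, SubGaussianGiven P X (fun ω => Ypot t ω - ψ (lin f α k (X ω))) σ)
    (hα : IsTargetWL P (observed Ypot T X) ψ f γ α) {lam : ℝ} (hlam : 0 ≤ lam)
    (hl : 3 * (1 + Real.log (((p : ℝ) + 1) / ε)) * (B₀ * (B₁ - 1) * σ) ^ 2 ≤ n * lam ^ 2) :
    μ (⋃ j, {ω | lam < rowNorm (wlScore ψ (fun i => O i ω) f γ α) j}) ≤
      ENNReal.ofReal (2 * ε) := by
  have hZ : AEMeasurable (observed Ypot T X) P := (hid ⟨0, hn⟩).aemeasurable_snd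
  have hψm : Measurable ψ := hψ.continuous.measurable
  have hres := fun k => integrable_oddsWeight_mul_outcomeResid (t := t) hσ hZ hψm hf hodds k (hW k)
  refine measure_iUnion_le_card_mul (fun j => ?_) (card_mul_exp_neg_log_le hε)
  obtain ⟨h1, h2⟩ := integral_exp_wlScore_le hσ hB₀ hB₁ hX hZ hψm hf hB hodds hW j
  have hβ : 0 < B₁ - 1 := by linarith
  refine measure_vector_sampleMean_gt_le hn hind hid
    (h := fun k z => (oddsWeight f γ k z * outcomeResid ψ f α k z) * f j z.2.2)
    (fun k => ?_) (fun k => ?_)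
    (fun k => integral_wlScore_eq_zero hψ hm hC₃ hg hZ hf hB hodds hd hres hα j k)
    (by positivity : 0 < B₀ * (B₁ - 1) * σ) h1 h2 hlam hl
  · have h1 := measurable_oddsWeight hf γ k
    have h2 := measurable_outcomeResid hψm hf α k
    have h3 := hf j
    fun_prop
  · refine (hres k).mul_bdd (c := B₀) ?_ ?_
    · exact ((hf j).comp (measurable_snd.comp measurable_snd)).comp_aemeasurable hZ
        |>.aestronglyMeasurable
    · filter_upwards [hB] with ω hω using hω j

/-- Squared sub-Gaussian residuals are only sub-exponential, hence the Bernstein bound, for which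
the rate must be at most `1`. -/
theorem measure_residGram_sub_gt_le (hK : 2 ≤ K) (hn : 1 ≤ n) (hε : 0 < ε) (hε1 : ε < 1)
    (hind : iIndepFun O μ) (hid : ∀ i, IdentDistrib (O i) (observed Ypot T X) μ P)
    (hX : Measurable X) (hf : ∀ j, Measurable (f j)) (hB₀ : 0 < B₀) (hB₁ : 1 < B₁) (hσ : 0 < σ)
    (hB : ∀ᵐ ω ∂P, ∀ j, |f j (X ω)| ≤ B₀)
    (hodds : ∀ᵐ ω ∂P, ∑ k : {k : Fin K // k ≠ t}, Real.exp (lin f γ k (X ω)) ≤ B₁ - 1)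
    (hψ : Measurable ψ)
    (hW : ∀ k, SubGaussianGiven P X (fun ω => Ypot t ω - ψ (lin f α k (X ω))) σ)
    (hρ : Constants.rate K p n ε ≤ 1) {y : ℝ}
    (hy : 16 * Constants.rate K p n ε * (B₀ ^ 2 * (B₁ - 1) * σ ^ 2) ≤ y) :
    μ (⋃ q : Fin (p + 1) × Fin (p + 1) × {k : Fin K // k ≠ t}, {ω | y < |sampleMean
      (fun i => O i ω) (fun z => oddsWeight f γ q.2.2 z * outcomeResid ψ f α q.2.2 z ^ 2 *
        (f q.1 z.2.2 * f q.2.1 z.2.2)) -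
        ∫ ω, oddsWeight f γ q.2.2 (observed Ypot T X ω) *
          outcomeResid ψ f α q.2.2 (observed Ypot T X ω) ^ 2 *
            (f q.1 (X ω) * f q.2.1 (X ω)) ∂P|}) ≤ ENNReal.ofReal (2 * ε) := by
  have hZ : AEMeasurable (observed Ypot T X) P := (hid ⟨0, hn⟩).aemeasurable_snd
  have hβ : 0 < B₁ - 1 := by linarith
  have hr := natCast_mul_rate_sq (p := p) hK hn hε hε1
  refine measure_iUnion_le_card_mul (fun q => ?_) (card_mul_exp_le t hK hε hε1
    (y := 3 * n * Constants.rate K p n ε ^ 2) ?_)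
  · obtain ⟨h1, h2⟩ := integral_exp_residGram_le hσ hB₀ hB₁ hX hZ hψ hf hB hodds q.2.2 (hW q.2.2)
      q.1 q.2.1
    refine (measure_mono fun ω hω => ?_).trans (measure_sampleMean_sub_gt_le_of_exp hn hind hid
      (g := fun z => oddsWeight f γ q.2.2 z * outcomeResid ψ f α q.2.2 z ^ 2 *
        (f q.1 z.2.2 * f q.2.1 z.2.2)) ?_
      (by positivity : 0 < B₀ ^ 2 * (B₁ - 1) * σ ^ 2) h1 h2 (Real.sqrt_nonneg _) hρ)
    · exact hy.trans_lt hω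
    · have h1 := measurable_oddsWeight hf γ q.2.2
      have h2 := measurable_outcomeResid hψ hf α q.2.2
      have h3 := hf q.1
      have h4 := hf q.2.1
      fun_prop
  · rw [mul_assoc, hr]
    have : 0 ≤ (n : ℝ) * Constants.rate K p n ε ^ 2 := by positivity
    linarith

/-- The bounds at the sample points and the concentration bounds under which the deterministic
analysis of the two penalized estimators goes through. -/
structure IsRegularSample (c : Constants) (l₁ l₂ : ℝ) (P : Measure Ω₀) (Z : Ω₀ → Obs K 𝒳)
    (ψ : ℝ → ℝ) (f : Fin (p + 1) → 𝒳 → ℝ) (γ α : Coef p K t) (o : Fin n → Obs K 𝒳) : Prop where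
  bounded : ∀ i j, |f j (o i).2.2| ≤ c.B₀
  odds : ∀ i, ∑ k : {k : Fin K // k ≠ t}, Real.exp (lin f γ k (o i).2.2) ≤ c.B₁ - 1
  le_deriv : ∀ i (k : {k : Fin K // k ≠ t}), c.C₂ ≤ deriv ψ (lin f α k (o i).2.2)
  deriv_le : ∀ i (k : {k : Fin K // k ≠ t}), deriv ψ (lin f α k (o i).2.2) ≤ c.C₁
  calScore_le : ∀ j, rowNorm (calScore o f γ) j ≤ l₁
  wlScore_le : ∀ j, rowNorm (wlScore ψ o f γ α) j ≤ l₂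
  gram_sub_le : ∀ i j k, |sampleMean o (fun z => oddsWeight f γ k z * (f i z.2.2 * f j z.2.2)) -
    ∫ ω, oddsWeight f γ k (Z ω) * (f i (Z ω).2.2 * f j (Z ω).2.2) ∂P| ≤ l₁ / 2
  residGram_sub_le : ∀ i j k, |sampleMean o (fun z => oddsWeight f γ k z *
      outcomeResid ψ f α k z ^ 2 * (f i z.2.2 * f j z.2.2)) -
    ∫ ω, oddsWeight f γ k (Z ω) * outcomeResid ψ f α k (Z ω) ^ 2 *
      (f i (Z ω).2.2 * f j (Z ω).2.2) ∂P| ≤ 3 * c.σ₀ ^ 2 * l₁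

omit [IsProbabilityMeasure P] in
-- The set of regular samples is not shown to be measurable; the complement of a measurable hull of
-- its complement takes its place.
theorem exists_measurableSet_of_measure_compl_le {S : Set Ω} {δ : ℝ} (hδ : 0 ≤ δ)
    (h : μ Sᶜ ≤ ENNReal.ofReal δ) : ∃ E, MeasurableSet E ∧ 1 - δ ≤ μ.real E ∧ E ⊆ S := by
  refine ⟨(toMeasurable μ Sᶜ)ᶜ, (measurableSet_toMeasurable _ _).compl, ?_, ?_⟩
  · rw [probReal_compl_eq_one_sub (measurableSet_toMeasurable _ _), measureReal_def,
      measure_toMeasurable]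
    have := ENNReal.toReal_mono ENNReal.ofReal_ne_top h
    rw [ENNReal.toReal_ofReal hδ] at this
    linarith
  · exact Set.compl_subset_comm.1 (subset_toMeasurable μ Sᶜ)

end GoodEvent

/-! ### The regular event and its probability. -/

section RegularSample

variable {p K n : ℕ} {t : Fin K} {𝒳 Ω₀ Ω : Type*} [MeasurableSpace 𝒳] [MeasurableSpace Ω₀]
  [MeasurableSpace Ω] {P : Measure Ω₀} [IsProbabilityMeasure P] {μ : Measure Ω}
  [IsProbabilityMeasure μ] {O : Fin n → Ω → Obs K 𝒳}
  {f : Fin (p + 1) → 𝒳 → ℝ} {ψ : ℝ → ℝ} {γ α : Coef p K t} {ε η₁₁ η₁₂ : ℝ} {c : Constants}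
  {Ypot : Fin K → Ω₀ → ℝ} {T : Ω₀ → Fin K} {X : Ω₀ → 𝒳}

theorem rate_le_one
    (h : (((K : ℝ) - 1) + Real.log (((p : ℝ) + 1) / ε)) / n ≤ 1) : Constants.rate K p n ε ≤ 1 := by
  rw [Constants.rate, ← add_div]
  exact Real.sqrt_le_one.2 h

theorem log_rate_nonneg (p : ℕ) (hε : 0 < ε) (hε1 : ε < 1) :
    0 ≤ Real.log (((p : ℝ) + 1) / ε) := by
  refine Real.log_nonneg ?_
  rw [le_div_iff₀ hε]
  have : (0 : ℝ) ≤ p := Nat.cast_nonneg p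
  linarith

theorem rate_pos (p : ℕ) (hK : 2 ≤ K) (hn : 1 ≤ n) (hε : 0 < ε) (hε1 : ε < 1) :
    0 < Constants.rate K p n ε := by
  have h := natCast_mul_rate_sq (p := p) hK hn hε hε1
  have hK2 : (2 : ℝ) ≤ K := by exact_mod_cast hK
  have hx := log_rate_nonneg p hε hε1
  refine lt_of_le_of_ne (Real.sqrt_nonneg _) fun h0 => ?_
  rw [← h0] at h
  norm_num at h
  linarith

theorem natCast_mul_lam₁_sq (c : Constants) (p : ℕ) (hK : 2 ≤ K) (hn : 1 ≤ n) (hε : 0 < ε)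
    (hε1 : ε < 1) : n * c.lam₁ K p n ε ^ 2 =
      32 * (c.B₀ ^ 2 * c.B₁) ^ 2 * (((K : ℝ) - 1) + Real.log (((p : ℝ) + 1) / ε)) := by
  rw [← natCast_mul_rate_sq hK hn hε hε1, Constants.lam₁]
  have : √(2 : ℝ) ^ 2 = 2 := Real.sq_sqrt zero_le_two
  linear_combination 16 * n * (c.B₀ ^ 2 * c.B₁ * Constants.rate K p n ε) ^ 2 * this

omit [MeasurableSpace 𝒳] [IsProbabilityMeasure P] in
theorem MultiTreat.AssumptionPS.ae_bounded {Z : Ω₀ → Obs K 𝒳} (h : AssumptionPS c η₁₁ η₁₂ n ε P Z f γ)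
    (hf0 : ∀ x, f 0 x = 1) : ∀ᵐ ω ∂P, ∀ j, |f j (Z ω).2.2| ≤ c.B₀ := by
  filter_upwards [h.bounded] with ω hω j
  refine Fin.cases ?_ hω j
  rw [hf0, abs_one]
  exact h.one_le_B₀

omit [MeasurableSpace 𝒳] [IsProbabilityMeasure P] in
theorem MultiTreat.AssumptionPS.ae_odds {Z : Ω₀ → Obs K 𝒳} (h : AssumptionPS c η₁₁ η₁₂ n ε P Z f γ) :
    ∀ᵐ ω ∂P, ∑ k : {k : Fin K // k ≠ t}, Real.exp (lin f γ k (Z ω).2.2) ≤ c.B₁ - 1 := by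
  filter_upwards [h.inv_propScore_le] with ω hω
  rw [inv_propScore_eq] at hω
  linarith

/-- Since `K ≥ 2` there is some `k ≠ t`, hence a point where the derivative is at least `C₂ > 0`. -/
theorem MultiTreat.AssumptionOR.monotone (h : AssumptionOR c η₁₁ η₁₂ n ε P Ypot T X ψ f γ α) (hK : 2 ≤ K)
    (hψ : Differentiable ℝ ψ) : Monotone ψ := by
  obtain ⟨ω, hω⟩ := h.le_deriv.exists
  have hcard : 0 < Fintype.card {k : Fin K // k ≠ t} := by
    have h1 := card_ne K t hK
    have hK2 : (2 : ℝ) ≤ K := by exact_mod_cast hK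
    exact_mod_cast (by linarith : (0 : ℝ) < Fintype.card {k : Fin K // k ≠ t})
  obtain ⟨k⟩ := Fintype.card_pos_iff.1 hcard
  exact monotone_of_deriv_growth hψ h.deriv_growth (h.C₂_pos.trans_le (hω k))

/-- Four families of deviations with probability at most `2ε` each, and a null set where an almost
sure bound fails at some sample point: `8ε ≤ 9ε`. Both Gram levels are multiples of `λ̃₁`, chosen to
fit the later absorption steps. -/
theorem exists_event_isRegularSample (hK : 2 ≤ K) (hn : 1 ≤ n) (hε : 0 < ε) (hε1 : ε < 1)
    (hC : CausalAssumptions P Ypot T X) (hf : ∀ j, Measurable (f j)) (hf0 : ∀ x, f 0 x = 1)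
    (hψ : Differentiable ℝ ψ) (hind : iIndepFun O μ)
    (hid : ∀ i, IdentDistrib (O i) (observed Ypot T X) μ P)
    (hγ : IsTargetCAL P (observed Ypot T X) f γ) (hα : IsTargetWL P (observed Ypot T X) ψ f γ α)
    (hPS : AssumptionPS c η₁₁ η₁₂ n ε P (observed Ypot T X) f γ)
    (hOR : AssumptionOR c η₁₁ η₁₂ n ε P Ypot T X ψ f γ α)
    (hrate : (((K : ℝ) - 1) + Real.log (((p : ℝ) + 1) / ε)) / n ≤ 1) :
    ∃ E : Set Ω, MeasurableSet E ∧ 1 - 9 * ε ≤ μ.real E ∧ ∀ ω ∈ E,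
      IsRegularSample c (c.lam₁ K p n ε) (c.lam₂ K p n ε) P (observed Ypot T X) ψ f γ α
        (fun i => O i ω) := by
  have hB := hPS.ae_bounded hf0
  have hodds := hPS.ae_odds
  have hm := hOR.monotone hK hψ
  have hB₀1 := hPS.one_le_B₀
  have hB₀ : 0 < c.B₀ := by linarith
  have hB₁ := hPS.one_lt_B₁
  have hβ : 0 < c.B₁ - 1 := by linarith
  have hσ := hOR.σ₀_pos
  have hK2 : (2 : ℝ) ≤ K := by exact_mod_cast hK
  have hx := log_rate_nonneg p hε hε1
  have hρ1 := rate_le_one hrate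
  have hρ0 := rate_pos p hK hn hε hε1
  have hnρ := natCast_mul_rate_sq (p := p) hK hn hε hε1
  have hnl := natCast_mul_lam₁_sq c p hK hn hε hε1
  set x := Real.log (((p : ℝ) + 1) / ε) with hxdef
  set l₁ := c.lam₁ K p n ε with hl₁
  set l₂ := c.lam₂ K p n ε with hl₂
  have hl₁0 : 0 ≤ l₁ := by rw [hl₁, Constants.lam₁]; positivity
  have hl₂0 : 0 ≤ l₂ := hl₁0.trans (le_max_left _ _)
  have hN : 1 + x ≤ (K : ℝ) - 1 + x := by linarith
  have e1 := measure_calScore_gt_le hn hε hind hid hf hB₀ hB₁ hB hodds hγ hl₁0 (by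
    rw [hnl]
    have h1 : (c.B₀ * c.B₁) ^ 2 ≤ (c.B₀ ^ 2 * c.B₁) ^ 2 := by
      refine pow_le_pow_left₀ (by positivity) ?_ 2
      exact mul_le_mul_of_nonneg_right (by nlinarith) (by linarith)
    calc 6 * (1 + x) * (c.B₀ * c.B₁) ^ 2 ≤ 6 * (1 + x) * (c.B₀ ^ 2 * c.B₁) ^ 2 := by gcongr
      _ = 6 * (c.B₀ ^ 2 * c.B₁) ^ 2 * (1 + x) := by ring
      _ ≤ 32 * (c.B₀ ^ 2 * c.B₁) ^ 2 * ((K : ℝ) - 1 + x) := by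
        gcongr
        norm_num)
  have e2 := measure_gram_sub_gt_le hK hn hε hε1 hind hid hf hB₀ hB₁ hB hodds
    (y := l₁ / 2) (by positivity) (by
      rw [div_pow, mul_div_assoc', hnl, ← hxdef]
      have : 0 ≤ (c.B₀ ^ 2 * c.B₁) ^ 2 * ((K : ℝ) - 1 + x) := by
        have : 0 ≤ (K : ℝ) - 1 + x := by linarith
        positivity
      linarith)
  have e3 := measure_wlScore_gt_le hn hε hind hid hC.measurable_X hf hB₀ hB₁ hσ hB hodds hψ hm
    hOR.C₃_nonneg hOR.deriv_growth hOR.deriv_le hOR.subGaussian hα hl₂0 (by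
      rw [← hxdef]
      have h1 : √3 * c.B₀ * (c.B₁ - 1) * c.σ₀ * Constants.rate K p n ε ≤ l₂ := le_max_right _ _
      have h2 := pow_le_pow_left₀ (by positivity) h1 2
      have h3 : √(3 : ℝ) ^ 2 = 3 := Real.sq_sqrt (by norm_num)
      have hn0 : (0 : ℝ) ≤ n := Nat.cast_nonneg n
      have h4 := mul_le_mul_of_nonneg_left h2 hn0
      have h5 : n * (√3 * c.B₀ * (c.B₁ - 1) * c.σ₀ * Constants.rate K p n ε) ^ 2 =
          3 * (c.B₀ * (c.B₁ - 1) * c.σ₀) ^ 2 * ((K : ℝ) - 1 + x) := by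
        rw [← hnρ]
        linear_combination n * (c.B₀ * (c.B₁ - 1) * c.σ₀ * Constants.rate K p n ε) ^ 2 * h3
      rw [h5] at h4
      refine le_trans ?_ h4
      have := mul_le_mul_of_nonneg_left hN
        (by positivity : 0 ≤ 3 * (c.B₀ * (c.B₁ - 1) * c.σ₀) ^ 2)
      linarith)
  have e4 := measure_residGram_sub_gt_le hK hn hε hε1 hind hid hC.measurable_X hf hB₀ hB₁ hσ hB
    hodds hψ.continuous.measurable hOR.subGaussian hρ1 (y := 3 * c.σ₀ ^ 2 * l₁) (by
      rw [hl₁, Constants.lam₁]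
      have h1 : (1.4 : ℝ) ≤ √2 := Real.le_sqrt_of_sq_le (by norm_num)
      have h2 : 0 ≤ Constants.rate K p n ε * c.B₀ ^ 2 * c.σ₀ ^ 2 := by positivity
      -- Compares the Bernstein level `16ρ` with the factor `4√2` in `λ̃₁`, multiplied by `3`: `12√2
      -- > 16`.
      have h3 : 16 * (c.B₁ - 1) ≤ 12 * √2 * c.B₁ := by nlinarith
      have := mul_le_mul_of_nonneg_left h3 h2
      linarith)
  have h0 : ∀ᵐ ω ∂μ, ∀ i, (∀ j, |f j (O i ω).2.2| ≤ c.B₀) ∧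
      (∑ k : {k : Fin K // k ≠ t}, Real.exp (lin f γ k (O i ω).2.2) ≤ c.B₁ - 1) ∧
      (∀ k : {k : Fin K // k ≠ t}, c.C₂ ≤ deriv ψ (lin f α k (O i ω).2.2)) ∧
      ∀ k : {k : Fin K // k ≠ t}, deriv ψ (lin f α k (O i ω).2.2) ≤ c.C₁ := by
    refine ae_all_iff.2 fun i => ?_
    have hlγ := fun k => measurable_lin hf γ k
    have hz : Measurable fun z : Obs K 𝒳 => z.2.2 := measurable_snd.comp measurable_snd
    have hsum : Measurable fun z : Obs K 𝒳 =>
        ∑ k : {k : Fin K // k ≠ t}, Real.exp (lin f γ k z.2.2) :=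
      Finset.measurable_fun_sum _ fun k _ => ((hlγ k).comp hz).exp
    have hlα : ∀ k, Measurable fun z : Obs K 𝒳 => deriv ψ (lin f α k z.2.2) := fun k =>
      (measurable_deriv ψ).comp ((measurable_lin hf α k).comp hz)
    refine (hid i).symm.ae_snd (p := fun z : Obs K 𝒳 => (∀ j, |f j z.2.2| ≤ c.B₀) ∧
      (∑ k : {k : Fin K // k ≠ t}, Real.exp (lin f γ k z.2.2) ≤ c.B₁ - 1) ∧
      (∀ k : {k : Fin K // k ≠ t}, c.C₂ ≤ deriv ψ (lin f α k z.2.2)) ∧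
      ∀ k : {k : Fin K // k ≠ t}, deriv ψ (lin f α k z.2.2) ≤ c.C₁) ?_ ?_
    · refine MeasurableSet.inter ?_ (MeasurableSet.inter ?_ (MeasurableSet.inter ?_ ?_))
      · exact measurableSet_setOfPred.2 (Measurable.forall fun j => measurableSet_setOfPred.1
          (measurableSet_le (by fun_prop) measurable_const))
      · exact measurableSet_le hsum measurable_const
      · exact measurableSet_setOfPred.2 (Measurable.forall fun j => measurableSet_setOfPred.1
          (measurableSet_le measurable_const (hlα j)))
      · exact measurableSet_setOfPred.2 (Measurable.forall fun j => measurableSet_setOfPred.1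
          (measurableSet_le (hlα j) measurable_const))
    · filter_upwards [hB, hodds, hOR.deriv_le, hOR.le_deriv] with ω h1 h2 h3 h4
      exact ⟨h1, h2, h4, h3⟩
  set S : Set Ω := {ω | IsRegularSample c l₁ l₂ P (observed Ypot T X) ψ f γ α (fun i => O i ω)}
  have hS : μ Sᶜ ≤ ENNReal.ofReal (9 * ε) := by
    have h1 := measure_union_le (μ := μ) _ _ |>.trans (add_le_add e1 e2)
    have h2 := measure_union_le (μ := μ) _ _ |>.trans (add_le_add h1 e3)
    have h3 := measure_union_le (μ := μ) _ _ |>.trans (add_le_add h2 e4)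
    have h4 := measure_union_le (μ := μ) _ _ |>.trans (add_le_add h3 (ae_iff.1 h0).le)
    refine (measure_mono ?_).trans (h4.trans ?_)
    · intro ω hω
      by_contra hcon
      refine hω ?_
      simp only [Set.mem_union, Set.mem_iUnion, Set.mem_ofPred_eq, not_or, not_exists, not_lt,
        not_not] at hcon
      obtain ⟨⟨⟨⟨h1, h2⟩, h3⟩, h4⟩, h5⟩ := hcon
      exact ⟨fun i => (h5 i).1, fun i => (h5 i).2.1, fun i => (h5 i).2.2.1,
        fun i => (h5 i).2.2.2, h1, h3, fun i j k => h2 (i, j, k), fun i j k => h4 (i, j, k)⟩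
    · rw [add_zero, ← ENNReal.ofReal_add (by positivity) (by positivity),
        ← ENNReal.ofReal_add (by positivity) (by positivity),
        ← ENNReal.ofReal_add (by positivity) (by positivity)]
      exact ENNReal.ofReal_le_ofReal (by linarith)
  obtain ⟨E, hE, hE1, hE2⟩ := exists_measurableSet_of_measure_compl_le (by positivity) hS
  exact ⟨E, hE, hE1, fun ω hω => hE2 hω⟩

end RegularSample

/-! ### Sample quadratic forms against population ones. -/

section SampleForms

variable {p K n : ℕ} {t : Fin K} {𝒳 Ω₀ : Type*} [MeasurableSpace 𝒳] [MeasurableSpace Ω₀]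
  {P : Measure Ω₀} [IsProbabilityMeasure P]
  {f : Fin (p + 1) → 𝒳 → ℝ} {ψ : ℝ → ℝ} {γ α : Coef p K t} {c : Constants} {l₁ l₂ : ℝ}
  {o : Fin n → Obs K 𝒳}

theorem quadForm_sub (D D' : Fin (p + 1) → Fin (p + 1) → {k : Fin K // k ≠ t} → ℝ)
    (b : Coef p K t) :
    ∑ k, ∑ i, ∑ j, b i k * (D i j k - D' i j k) * b j k =
      ∑ k, ∑ i, ∑ j, b i k * D i j k * b j k - ∑ k, ∑ i, ∑ j, b i k * D' i j k * b j k := by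
  simp only [← Finset.sum_sub_distrib]
  refine Finset.sum_congr rfl fun k _ => Finset.sum_congr rfl fun i _ =>
    Finset.sum_congr rfl fun j _ => by ring

/-- The population version of `gramForm`. -/
noncomputable def popGramForm (P : Measure Ω₀) (Z : Ω₀ → Obs K 𝒳) (f : Fin (p + 1) → 𝒳 → ℝ)
    (γ b : Coef p K t) : ℝ :=
  ∑ k, ∑ i, ∑ j, b i k *
    (∫ ω, oddsWeight f γ k (Z ω) * (f i (Z ω).2.2 * f j (Z ω).2.2) ∂P) * b j k

/-- The population version of `residualForm`. -/
noncomputable def popResidualForm (P : Measure Ω₀) (Z : Ω₀ → Obs K 𝒳) (ψ : ℝ → ℝ)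
    (f : Fin (p + 1) → 𝒳 → ℝ) (γ α b : Coef p K t) : ℝ :=
  ∑ k, ∑ i, ∑ j, b i k * (∫ ω, oddsWeight f γ k (Z ω) * outcomeResid ψ f α k (Z ω) ^ 2 *
    (f i (Z ω).2.2 * f j (Z ω).2.2) ∂P) * b j k

omit [MeasurableSpace 𝒳] [IsProbabilityMeasure P] in
theorem IsRegularSample.abs_gramForm_sub_le {Z : Ω₀ → Obs K 𝒳}
    (hs : IsRegularSample c l₁ l₂ P Z ψ f γ α o) (b : Coef p K t) :
    |gramForm o f γ b - popGramForm P Z f γ b| ≤ l₁ / 2 * norm21 b ^ 2 := by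
  rw [gramForm, sampleMean_sum_mul_lin_sq, popGramForm, ← quadForm_sub]
  exact abs_quadForm_le hs.gram_sub_le b

omit [MeasurableSpace 𝒳] [IsProbabilityMeasure P] in
theorem IsRegularSample.abs_residualForm_sub_le {Z : Ω₀ → Obs K 𝒳}
    (hs : IsRegularSample c l₁ l₂ P Z ψ f γ α o) (b : Coef p K t) :
    |residualForm ψ o f γ α b - popResidualForm P Z ψ f γ α b| ≤
      3 * c.σ₀ ^ 2 * l₁ * norm21 b ^ 2 := by
  rw [residualForm, sampleMean_sum_mul_lin_sq o f b
    (fun k z => oddsWeight f γ k z * outcomeResid ψ f α k z ^ 2), popResidualForm, ← quadForm_sub]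
  exact abs_quadForm_le hs.residGram_sub_le b

omit [MeasurableSpace 𝒳] [IsProbabilityMeasure P] in
/-- The empirical compatibility condition. -/
theorem IsRegularSample.le_gramForm {Z : Ω₀ → Obs K 𝒳}
    (hs : IsRegularSample c l₁ l₂ P Z ψ f γ α o) {g : Coef p K t} {ν ξ a : ℝ} (hl : 0 ≤ l₁)
    (hcomp : Compatibility P Z f γ (support g) ν ξ)
    (ha : (support g).card * (l₁ / 2) * (1 + ξ) ^ 2 ≤ a * ν ^ 2) (b : Coef p K t)
    (hb : norm21 b ≤ (1 + ξ) * supportNorm g b) :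
    ν ^ 2 * (1 - a) / (support g).card * supportNorm g b ^ 2 ≤ gramForm o f γ b := by
  have hS : (0 : ℝ) < (support g).card := zero_lt_one.trans_le (one_le_card_support g)
  have h1 := hcomp b (by
    have e := sum_compl_support g b
    rw [e]
    change _ ≤ ξ * supportNorm g b
    linarith)
  simp only [R_mul_oddsRatio] at h1
  change ν ^ 2 * supportNorm g b ^ 2 ≤ (support g).card * popGramForm P Z f γ b at h1
  have h2 := (abs_le.1 (hs.abs_gramForm_sub_le b)).1
  have h3 := pow_le_pow_left₀ (norm21_nonneg b) hb 2
  -- On the cone the sampling error is at most `(l₁/2)(1+ξ)²` times the squared support norm, a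
  -- fraction `a` of the population bound by `ha`.
  have h4 := mul_le_mul_of_nonneg_left h3 (by positivity : 0 ≤ l₁ / 2)
  have h5 := mul_le_mul_of_nonneg_right ha (sq_nonneg (supportNorm g b))
  have h6 := mul_le_mul_of_nonneg_left
    (by linarith : popGramForm P Z f γ b - l₁ / 2 * ((1 + ξ) * supportNorm g b) ^ 2 ≤
      gramForm o f γ b) hS.le
  rw [div_mul_eq_mul_div, div_le_iff₀ hS]
  nlinarith

variable {Ypot : Fin K → Ω₀ → ℝ} {T : Ω₀ → Fin K} {X : Ω₀ → 𝒳} {B₀ B₁ σ : ℝ}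

/-- Both forms are integrals of sums over `k` of weighted squares of linear predictors, so the
conditional second-moment bound applies for each `k` separately. -/
theorem popResidualForm_le (h : CausalAssumptions P Ypot T X)
    (hZ : AEMeasurable (observed Ypot T X) P) (hσ : 0 < σ) (hB₀ : 0 < B₀) (hB₁ : 1 < B₁)
    (hψ : Measurable ψ) (hf : ∀ j, Measurable (f j))
    (hB : ∀ᵐ ω ∂P, ∀ j, |f j (X ω)| ≤ B₀)
    (hodds : ∀ᵐ ω ∂P, ∑ k : {k : Fin K // k ≠ t}, Real.exp (lin f γ k (X ω)) ≤ B₁ - 1)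
    (hW : ∀ k, SubGaussianGiven P X (fun ω => Ypot t ω - ψ (lin f α k (X ω))) σ)
    (b : Coef p K t) :
    popResidualForm P (observed Ypot T X) ψ f γ α b ≤
      σ ^ 2 * Real.log 2 * popGramForm P (observed Ypot T X) f γ b := by
  have hβ : 0 < B₁ - 1 := by linarith
  have hi1 : ∀ i j k, Integrable (fun ω => oddsWeight f γ k (observed Ypot T X ω) *
      (f i (X ω) * f j (X ω))) P := fun i j k => by
    have h1 := measurable_oddsWeight hf γ k
    have h2 := hf i
    have h3 := hf j
    refine integrable_comp_of_abs_le (g := fun z => oddsWeight f γ k z *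
      (f i z.2.2 * f j z.2.2)) hZ (by fun_prop) (C := (B₁ - 1) * (B₀ * B₀)) ?_
    filter_upwards [hB, hodds] with ω h1 h2
    rw [abs_mul, abs_mul, abs_of_nonneg (oddsWeight_nonneg _ _ _ _)]
    exact mul_le_mul (oddsWeight_le (z := observed Ypot T X ω) h2 k)
      (mul_le_mul (h1 i) (h1 j) (abs_nonneg _) hB₀.le)
      (mul_nonneg (abs_nonneg _) (abs_nonneg _)) hβ.le
  have hi2 : ∀ i j k, Integrable (fun ω => oddsWeight f γ k (observed Ypot T X ω) *
      outcomeResid ψ f α k (observed Ypot T X ω) ^ 2 * (f i (X ω) * f j (X ω))) P :=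
    fun i j k => by
    have h1 := measurable_oddsWeight hf γ k
    have h2 := hf i
    have h3 := hf j
    have h4 := measurable_outcomeResid hψ hf α k
    have hs : 0 < B₀ ^ 2 * (B₁ - 1) * σ ^ 2 := by positivity
    have hm : Measurable fun z => oddsWeight f γ k z * outcomeResid ψ f α k z ^ 2 *
      (f i z.2.2 * f j z.2.2) := by fun_prop
    refine ((integral_exp_residGram_le hσ hB₀ hB₁ h.measurable_X hZ hψ hf hB hodds k (hW k)
      i j).1.const_mul (B₀ ^ 2 * (B₁ - 1) * σ ^ 2)).mono'
      (hm.comp_aemeasurable hZ).aestronglyMeasurable (ae_of_all _ fun ω => ?_)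
    set y := oddsWeight f γ k (observed Ypot T X ω) *
      outcomeResid ψ f α k (observed Ypot T X ω) ^ 2 * (f i (X ω) * f j (X ω))
    have h5 := Real.add_one_le_exp |y / (B₀ ^ 2 * (B₁ - 1) * σ ^ 2)|
    rw [abs_div, abs_of_pos hs] at h5 ⊢
    have h6 : |y| / (B₀ ^ 2 * (B₁ - 1) * σ ^ 2) ≤
        Real.exp (|y| / (B₀ ^ 2 * (B₁ - 1) * σ ^ 2)) := by linarith
    rw [div_le_iff₀ hs, mul_comm] at h6
    exact h6
  have e1 := integral_quadForm (P := P) (g := fun ω k => oddsWeight f γ k (observed Ypot T X ω))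
    (f := f) X b hi1
  have e2 := integral_quadForm (P := P) (g := fun ω k => oddsWeight f γ k (observed Ypot T X ω) *
    outcomeResid ψ f α k (observed Ypot T X ω) ^ 2) (f := f) X b hi2
  have hsq : ∀ (g : Ω₀ → {k : Fin K // k ≠ t} → ℝ) (k : {k : Fin K // k ≠ t}),
      (∀ i j k, Integrable (fun ω => g ω k * (f i (X ω) * f j (X ω))) P) →
      Integrable (fun ω => g ω k * lin f b k (X ω) ^ 2) P := fun g k hi => by
    have : (fun ω => g ω k * lin f b k (X ω) ^ 2) = fun ω => ∑ i, ∑ j,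
        b i k * (g ω k * (f i (X ω) * f j (X ω))) * b j k := by
      ext ω
      rw [lin, sq, Finset.sum_mul_sum, Finset.mul_sum]
      refine Finset.sum_congr rfl fun i _ => ?_
      rw [Finset.mul_sum]
      exact Finset.sum_congr rfl fun j _ => by ring
    rw [this]
    exact integrable_finsetSum _ fun i _ => integrable_finsetSum _ fun j _ =>
      ((hi i j k).const_mul _).mul_const _
  rw [integral_finsetSum _ fun k _ => hsq _ k hi1] at e1
  rw [integral_finsetSum _ fun k _ => hsq (fun ω k => oddsWeight f γ k (observed Ypot T X ω) *
    outcomeResid ψ f α k (observed Ypot T X ω) ^ 2) k hi2] at e2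
  change _ = popGramForm P (observed Ypot T X) f γ b at e1
  change _ = popResidualForm P (observed Ypot T X) ψ f γ α b at e2
  rw [← e1, ← e2, Finset.mul_sum]
  exact Finset.sum_le_sum fun k _ => integral_residualForm_le h hσ hψ hf hB hodds k (hW k) b

omit [MeasurableSpace 𝒳] [IsProbabilityMeasure P] in
-- From the sample residual form to the population, then to the population Gram form, and back to
-- the sample. The constants come from `log 2 ≤ 7/10` and `3 + 7/20 ≤ 7/2`.
theorem IsRegularSample.residualForm_le
    (hs : IsRegularSample c l₁ l₂ P (observed Ypot T X) ψ f γ α o) (hl : 0 ≤ l₁)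
    {b : Coef p K t} (hpop : popResidualForm P (observed Ypot T X) ψ f γ α b ≤
      c.σ₀ ^ 2 * Real.log 2 * popGramForm P (observed Ypot T X) f γ b) {r : ℝ}
    (hb : norm21 b ≤ r) :
    residualForm ψ o f γ α b ≤
      c.σ₀ ^ 2 * (7 / 10 * gramForm o f γ b + 7 / 2 * (l₁ * r ^ 2)) := by
  have h1 := (abs_le.1 (hs.abs_gramForm_sub_le b)).1
  have h2 := (abs_le.1 (hs.abs_residualForm_sub_le b)).2
  have h3 := pow_le_pow_left₀ (norm21_nonneg b) hb 2
  have h4 := mul_le_mul_of_nonneg_left h3 hl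
  have hlog : Real.log 2 ≤ 7 / 10 := by linarith [Real.log_two_lt_d9]
  have hlog0 : 0 ≤ Real.log 2 := Real.log_nonneg one_le_two
  have hG := gramForm_nonneg o f γ b
  have h5 : popGramForm P (observed Ypot T X) f γ b ≤ gramForm o f γ b + l₁ / 2 * r ^ 2 := by
    linarith
  have hr2 : 0 ≤ l₁ * r ^ 2 := by positivity
  have h6 : Real.log 2 * popGramForm P (observed Ypot T X) f γ b ≤
      7 / 10 * (gramForm o f γ b + l₁ / 2 * r ^ 2) :=
    (mul_le_mul_of_nonneg_left h5 hlog0).trans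
      (mul_le_mul_of_nonneg_right hlog (by linarith))
  have h7 := mul_le_mul_of_nonneg_left h6 (sq_nonneg c.σ₀)
  have h8 := mul_le_mul_of_nonneg_left h4 (sq_nonneg c.σ₀)
  nlinarith [mul_nonneg (sq_nonneg c.σ₀) hr2]

/-- As `f₀ = 1`, each summand is the `(0,0)` entry of the residual-weighted Gram matrix. Adding the
`K - 1` entries produces the factor `K - 1` of the theorem. -/
theorem IsRegularSample.sampleMean_resid_le (hK : 2 ≤ K)
    (hs : IsRegularSample c l₁ l₂ P (observed Ypot T X) ψ f γ α o)
    (h : CausalAssumptions P Ypot T X) (hσ : 0 < c.σ₀) (hψ : Measurable ψ)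
    (hf : ∀ j, Measurable (f j)) (hf0 : ∀ x, f 0 x = 1)
    (hB : ∀ᵐ ω ∂P, ∀ j, |f j (X ω)| ≤ B₀)
    (hodds : ∀ᵐ ω ∂P, ∑ k : {k : Fin K // k ≠ t}, Real.exp (lin f γ k (X ω)) ≤ B₁ - 1)
    (hW : ∀ k, SubGaussianGiven P X (fun ω => Ypot t ω - ψ (lin f α k (X ω))) c.σ₀) :
    sampleMean o (fun z => ∑ k, oddsWeight f γ k z * outcomeResid ψ f α k z ^ 2) ≤
      ((K : ℝ) - 1) * (c.σ₀ ^ 2 * (B₁ + 3 * l₁)) := by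
  rw [sampleMean_sum, ← card_ne K t hK, ← nsmul_eq_mul, ← Finset.card_univ]
  refine Finset.sum_le_card_nsmul _ _ _ fun k _ => ?_
  have h1 := (abs_le.1 (hs.residGram_sub_le 0 0 k)).2
  have h2 := integral_residualForm_le h hσ hψ hf hB hodds k (hW k) (Pi.single 0 (Pi.single k 1))
  simp only [lin_single, if_true, hf0, mul_one, one_pow] at h1 h2
  have hB₁ : 0 ≤ B₁ - 1 := by
    obtain ⟨ω, hω⟩ := hodds.exists
    exact (Finset.sum_nonneg fun k _ => (Real.exp_pos _).le).trans hω
  have h3 : ∫ ω, oddsWeight f γ k (observed Ypot T X ω) ∂P ≤ B₁ := by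
    calc _ ≤ ∫ _ω, (B₁ - 1) ∂P :=
          integral_mono_of_nonneg (ae_of_all _ fun ω => oddsWeight_nonneg _ _ _ _)
            (integrable_const _)
            (hodds.mono fun ω h => oddsWeight_le (z := observed Ypot T X ω) h k)
      _ ≤ B₁ := by simp
  have hlog : Real.log 2 ≤ 1 := by linarith [Real.log_two_lt_d9]
  have hlog0 : 0 ≤ Real.log 2 := Real.log_nonneg one_le_two
  have h4 : Real.log 2 * ∫ ω, oddsWeight f γ k (observed Ypot T X ω) ∂P ≤ B₁ :=
    (mul_le_mul_of_nonneg_left h3 hlog0).trans (mul_le_of_le_one_left (by linarith) hlog)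
  have h5 := mul_le_mul_of_nonneg_left h4 (sq_nonneg c.σ₀)
  linarith

end SampleForms

/-! ### Radii and numerical constants. -/

section Arithmetic

/-- The second form is the one in which the penalty beats the support term outside the cone. -/
theorem one_lt_and_two_mul_lt_of_div_lt {A ξ : ℝ} (hξ : 1 < ξ) (h : (ξ + 1) / (ξ - 1) < A) :
    1 < A ∧ 2 * A < (ξ + 1) * (A - 1) := by
  have h0 : 0 < ξ - 1 := by linarith
  rw [div_lt_iff₀ h0] at h
  constructor
  · by_contra hA
    nlinarith
  · linarith

/-- Localization needs a radius strictly above `Q`, the curvature bound needs `L r ≤ m`, and the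
final constant needs `r` comparable to `Q`. -/
theorem exists_between_le_two_mul {Q L m : ℝ} (hQ : 0 < Q) (h : L * Q < m) :
    ∃ r, Q < r ∧ r ≤ 2 * Q ∧ L * r ≤ m := by
  by_cases h2 : L * (2 * Q) ≤ m
  · exact ⟨2 * Q, by linarith, le_rfl, h2⟩
  · have hL : 0 < L := by
      by_contra hL
      nlinarith
    refine ⟨m / L, ?_, ?_, ?_⟩
    · rw [lt_div_iff₀ hL]; linarith
    · rw [div_le_iff₀ hL]; linarith
    · rw [mul_div_cancel₀ _ hL.ne']

/-- The radius of the ball in which the regularized calibrated estimator is localized. -/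
noncomputable def calRadius (A ξ ν s : ℝ) : ℝ :=
  4 * A ^ 2 * s / ((A - 1) * (ν ^ 2 * (1 - (ξ + 1) ^ 2 * s / ν ^ 2)))

variable {A B ξ ν s e₁ e₂ : ℝ}

theorem calRadius_pos (hA : 1 < A) (hν : 0 < ν) (hs : 0 < s) (ha : (ξ + 1) ^ 2 * s / ν ^ 2 < 1) :
    0 < calRadius A ξ ν s := by
  have h1 : 0 < A - 1 := by linarith
  have h2 : 0 < 1 - (ξ + 1) ^ 2 * s / ν ^ 2 := by linarith
  unfold calRadius
  positivity

theorem calRadius_le_div (hA : 1 < A) (hAξ : 2 * A < (ξ + 1) * (A - 1)) (hν : 0 < ν) (hs : 0 < s)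
    (he₁ : e₁ < 1) (ha : (ξ + 1) ^ 2 * s / ν ^ 2 ≤ e₁) :
    calRadius A ξ ν s ≤ (ξ + 1) ^ 2 * (A - 1) * s / (ν ^ 2 * (1 - e₁)) := by
  have h1 : 0 < A - 1 := by linarith
  have h2 : 0 < 1 - e₁ := by linarith
  have h3 : (2 * A) ^ 2 ≤ ((ξ + 1) * (A - 1)) ^ 2 := pow_le_pow_left₀ (by linarith) hAξ.le 2
  calc calRadius A ξ ν s ≤ 4 * A ^ 2 * s / ((A - 1) * (ν ^ 2 * (1 - e₁))) := by
        unfold calRadius; gcongr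
    _ ≤ ((ξ + 1) * (A - 1)) ^ 2 * s / ((A - 1) * (ν ^ 2 * (1 - e₁))) := by
        gcongr; linarith
    _ = _ := by field_simp

theorem mul_calRadius_le (hA : 1 < A) (hAξ : 2 * A < (ξ + 1) * (A - 1)) (hν : 0 < ν) (hs : 0 < s)
    (he₁ : e₁ < 1) (ha : (ξ + 1) ^ 2 * s / ν ^ 2 ≤ e₁) (hB : 0 ≤ B)
    (hb : B * (ξ + 1) ^ 2 * (A - 1) / (1 - e₁) / ν ^ 2 * s ≤ e₂) :
    B * calRadius A ξ ν s ≤ e₂ := by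
  refine le_trans (mul_le_mul_of_nonneg_left (calRadius_le_div hA hAξ hν hs he₁ ha) hB) ?_
  refine le_of_eq_of_le ?_ hb
  have h2 : 0 < 1 - e₁ := by linarith
  field_simp

/-- The radius blows up as `a = (ξ+1)²s/ν²` tends to `1`, yet its bound must be free of `e₁`. For `a
≤ 1/2` the denominator is harmless; for `a > 1/2` the hypothesis `B r ≤ 1` with `B ≥ 1` gives `r ≤ 1
≤ 2a`. -/
theorem calRadius_le_mul (hA : 1 < A) (hν : 0 < ν) (hs : 0 < s) (hB : 1 ≤ B)
    (ha : (ξ + 1) ^ 2 * s / ν ^ 2 < 1) (hr : B * calRadius A ξ ν s ≤ 1) :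
    calRadius A ξ ν s ≤ (8 * A ^ 2 / ((A - 1) * ν ^ 2) + 2 * (ξ + 1) ^ 2 / ν ^ 2) * s := by
  have h1 : 0 < A - 1 := by linarith
  have h0 := calRadius_pos hA hν hs ha
  by_cases h : (ξ + 1) ^ 2 * s / ν ^ 2 ≤ 1 / 2
  · have h2 : 0 ≤ 2 * (ξ + 1) ^ 2 / ν ^ 2 * s := by positivity
    calc calRadius A ξ ν s ≤ 4 * A ^ 2 * s / ((A - 1) * (ν ^ 2 * (1 / 2))) := by
          unfold calRadius; gcongr; linarith
      _ = 8 * A ^ 2 / ((A - 1) * ν ^ 2) * s := by field_simp; norm_num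
      _ ≤ _ := by linarith
  · have h2 : 0 ≤ 8 * A ^ 2 / ((A - 1) * ν ^ 2) * s := by positivity
    have h3 : calRadius A ξ ν s ≤ 1 := by nlinarith
    have h4 : 2 * ((ξ + 1) ^ 2 * s / ν ^ 2) = 2 * (ξ + 1) ^ 2 / ν ^ 2 * s := by ring
    linarith

/-- Recasts the sharp Gram bound as `4 M₁ s λ̃₁`, the form in which the sparsity condition with
`M₁₁` can be used. The factor `1 - e₂` arises from `(1 - e₂/3)² ≥ 1 - e₂`. -/
theorem gram_le_of_mul_sq_le {lam S G : ℝ} (hA : 1 < A) (hAξ : 2 * A < (ξ + 1) * (A - 1))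
    (hν : 0 < ν) (hS : 0 < S) (hG : 0 ≤ G) (hl : 0 < lam) (hs : s = S * lam) (he₁ : e₁ < 1)
    (he₂ : e₂ < 1) (he₂0 : 0 ≤ e₂)
    (ha : (ξ + 1) ^ 2 * s / ν ^ 2 ≤ e₁) {r : ℝ} (hr : B * r ≤ e₂)
    (h : ν ^ 2 * (1 - (ξ + 1) ^ 2 * s / ν ^ 2) / S * (1 - B * r / 3) ^ 2 * G ≤
      16 * A ^ 2 * lam ^ 2) :
    G ≤ 4 * (((ξ + 1) * (A - 1)) ^ 2 / (ν ^ 2 * (1 - e₁) * (1 - e₂))) * s * lam := by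
  have h1 : 0 < 1 - e₁ := by linarith
  have h2 : 0 < 1 - e₂ := by linarith
  have h3 : (2 * A) ^ 2 ≤ ((ξ + 1) * (A - 1)) ^ 2 := pow_le_pow_left₀ (by linarith) hAξ.le 2
  have h4 : 1 - e₂ ≤ (1 - B * r / 3) ^ 2 := by
    have : (1 - e₂ / 3) ^ 2 ≤ (1 - B * r / 3) ^ 2 :=
      pow_le_pow_left₀ (by linarith) (by linarith) 2
    nlinarith
  have h5 : ν ^ 2 * (1 - e₁) / S * (1 - e₂) * G ≤ 16 * A ^ 2 * lam ^ 2 := by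
    refine le_trans ?_ h
    have : 0 ≤ 1 - (ξ + 1) ^ 2 * s / ν ^ 2 := by linarith
    gcongr
  have h6 : 4 * (((ξ + 1) * (A - 1)) ^ 2 / (ν ^ 2 * (1 - e₁) * (1 - e₂))) * s * lam =
      4 * ((ξ + 1) * (A - 1)) ^ 2 * lam ^ 2 / (ν ^ 2 * (1 - e₁) / S * (1 - e₂)) := by
    rw [hs]; field_simp
  rw [h6, le_div_iff₀ (by positivity)]
  nlinarith [sq_nonneg lam]

/-- The sharp version, matched to `M₁₁`: `4 · 7/10 ≤ 3` and `7/2 ≤ 9/2` leave the overhead `3/2`. It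
serves to check the curvature range through `η₂₂`. -/
theorem le_of_le_gram_add {σ M η E l r G H D : ℝ} (hl : 0 ≤ l) (hr : 0 ≤ r) (hs : 0 ≤ s)
    (hM : 0 ≤ M) (hE : 1 ≤ E) (hη : s ≤ η) (hrD : r ≤ D * s)
    (hG : G ≤ 4 * M * s * l) (hH : H ≤ σ ^ 2 * (7 / 10 * G + 7 / 2 * (l * r ^ 2))) :
    H ≤ 3 / 2 * (3 * σ ^ 2 * D ^ 2 * η + 2 * σ ^ 2 * E * M) * s * l := by
  have hsl : 0 ≤ s * l := mul_nonneg hs hl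
  have h1 : r ^ 2 ≤ D ^ 2 * η * s := by
    calc r ^ 2 ≤ (D * s) ^ 2 := pow_le_pow_left₀ hr hrD 2
      _ = D ^ 2 * s * s := by ring
      _ ≤ D ^ 2 * η * s := by gcongr
  have h2 := mul_le_mul_of_nonneg_left h1 hl
  have h3 : M * (s * l) ≤ E * (M * (s * l)) := le_mul_of_one_le_left (mul_nonneg hM hsl) hE
  have h4 : 0 ≤ M * (s * l) := mul_nonneg hM hsl
  have h5 : 0 ≤ l * (D ^ 2 * η * s) := (mul_nonneg hl (sq_nonneg r)).trans h2
  calc H ≤ σ ^ 2 * (7 / 10 * G + 7 / 2 * (l * r ^ 2)) := hH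
    _ ≤ σ ^ 2 * (3 * (E * (M * (s * l))) + 9 / 2 * (l * (D ^ 2 * η * s))) :=
        mul_le_mul_of_nonneg_left (by linarith) (sq_nonneg σ)
    _ = _ := by ring

/-- The crude version: its constant involves neither `η₁₁` nor `η₁₂`, so it may enter the final
constant. -/
theorem le_of_le_gram_add' {σ l r C G H : ℝ} (hl : 0 ≤ l) (hA : 0 ≤ A) (hr : 0 ≤ r) (hr1 : r ≤ 1)
    (hrC : r ≤ C * s) (hG : G ≤ 6 * A * l * r)
    (hH : H ≤ σ ^ 2 * (7 / 10 * G + 7 / 2 * (l * r ^ 2))) :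
    H ≤ σ ^ 2 * (21 / 5 * A + 7 / 2) * C * s * l := by
  have h1 : r ^ 2 ≤ r := by nlinarith
  have h2 := mul_le_mul_of_nonneg_left h1 hl
  have h3 : 0 ≤ 21 / 5 * A + 7 / 2 := by positivity
  calc H ≤ σ ^ 2 * (7 / 10 * G + 7 / 2 * (l * r ^ 2)) := hH
    _ ≤ σ ^ 2 * ((21 / 5 * A + 7 / 2) * (l * r)) :=
        mul_le_mul_of_nonneg_left (by linarith) (sq_nonneg σ)
    _ ≤ σ ^ 2 * ((21 / 5 * A + 7 / 2) * (l * (C * s))) := by gcongr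
    _ = _ := by ring

/-- The required radius is `q₁ + q₂`, from compatibility and from the estimated weights. The
sparsity conditions keep it in the range where the Bregman bound holds; `CH` and `a ≤ 1` bound it by
a constant independent of `e`. -/
theorem le_wlRadius_bound {C₂ C₃ a s₁ s₂ H M l₁ l₂ e e₂₁ e₂₂ η θ S CH : ℝ} (hA : 1 < A)
    (hξ : 0 < ξ) (hν : 0 < ν) (hC₂ : 0 < C₂) (hC₃ : 0 ≤ C₃) (hB : 0 ≤ B)
    (hθ : θ = 1 - 2 * A / ((ξ + 1) * (A - 1))) (hθ0 : 0 < θ) (hη : η < 1) (hS : 0 < S)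
    (hl₁ : 0 < l₁) (hl : l₁ ≤ l₂) (hs₂ : s₂ = S * l₂) (hs₁ : 0 ≤ s₁) (ha : a ≤ e) (ha1 : a ≤ 1)
    (hH0 : 0 ≤ H) (hM : 0 ≤ M)
    (hH : H ≤ 3 / 2 * M * s₁ * l₁) (hH' : H ≤ CH * s₁ * l₁) (hCH : 0 ≤ CH)
    (hb : Real.exp e * B * C₃ / C₂ / ν ^ 2 * (ξ + 1) ^ 2 * (A - 1) / (1 - η) * S * l₂ ≤ e₂₁)
    (hc : Real.exp (3 * e) * B * C₃ / C₂ / θ ^ 2 / (A - 1) * M * s₁ ≤ e₂₂)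
    (he₂₁ : e₂₁ < 1) (he₂₂ : e₂₂ < 1) :
    ∃ r, 0 < r ∧ C₃ * (B * r) ≤ 3 / 2 ∧
      r ≤ 2 * (3 * (ξ + 1) ^ 2 * (A - 1) / (C₂ * ν ^ 2 * (1 - η)) +
        27 * CH / (θ * C₂ * (A - 1))) * (s₁ + s₂) ∧
      4 * Real.exp a * A ^ 2 * l₂ ^ 2 / ((1 - θ) * C₂ * (ν ^ 2 * (1 - η) / S)) +
        Real.exp (3 * a) / (θ * C₂) * H < (A - 1) * l₂ * r := by
  have h1 : 0 < A - 1 := by linarith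
  have h2 : 0 < 1 - η := by linarith
  have hl₂ : 0 < l₂ := hl₁.trans_le hl
  have h1θ : 1 - θ = 2 * A / ((ξ + 1) * (A - 1)) := by rw [hθ]; ring
  have hξ1 : 0 < ξ + 1 := by linarith
  have h1θ0 : 0 < 1 - θ := by rw [h1θ]; positivity
  set q₁ := Real.exp a * (1 - θ) * ((ξ + 1) ^ 2 * (A - 1) / (C₂ * ν ^ 2 * (1 - η)) * s₂) with hq₁
  set q₂ := Real.exp (3 * a) / (θ * C₂) * H / ((A - 1) * l₂) with hq₂
  have hs₂0 : 0 < s₂ := by rw [hs₂]; positivity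
  have hq₁0 : 0 < q₁ := by positivity
  have hq₂0 : 0 ≤ q₂ := by positivity
  have e1 : 4 * Real.exp a * A ^ 2 * l₂ ^ 2 / ((1 - θ) * C₂ * (ν ^ 2 * (1 - η) / S)) =
      (A - 1) * l₂ * q₁ := by
    rw [hq₁, h1θ, hs₂]; field_simp; norm_num
  have e2 : Real.exp (3 * a) / (θ * C₂) * H = (A - 1) * l₂ * q₂ := by
    rw [hq₂]; field_simp
  have b1 : C₃ * B * q₁ ≤ (1 - θ) * e₂₁ := by
    calc C₃ * B * q₁ ≤ C₃ * B * (Real.exp e * (1 - θ) *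
          ((ξ + 1) ^ 2 * (A - 1) / (C₂ * ν ^ 2 * (1 - η)) * s₂)) := by
          rw [hq₁]; gcongr
      _ = (1 - θ) * (Real.exp e * B * C₃ / C₂ / ν ^ 2 * (ξ + 1) ^ 2 * (A - 1) / (1 - η) *
          S * l₂) := by rw [hs₂]; field_simp
      _ ≤ _ := mul_le_mul_of_nonneg_left hb h1θ0.le
  have b2 : C₃ * B * q₂ ≤ 3 / 2 * (θ * e₂₂) := by
    calc C₃ * B * q₂ ≤ C₃ * B * (Real.exp (3 * e) / (θ * C₂) * (3 / 2 * M * s₁ * l₂) /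
          ((A - 1) * l₂)) := by
          rw [hq₂]
          have : H ≤ 3 / 2 * M * s₁ * l₂ := hH.trans (by gcongr)
          gcongr
      _ = 3 / 2 * (θ * (Real.exp (3 * e) * B * C₃ / C₂ / θ ^ 2 / (A - 1) * M * s₁)) := by
          field_simp
      _ ≤ _ := by gcongr
  -- `(1 - θ) e₂₁ + (3/2) θ e₂₂ < 3/2`: the overhead `3/2` of the residual bound is exactly what the
  -- Bregman range allows.
  have b3 : C₃ * B * (q₁ + q₂) < 3 / 2 := by nlinarith
  obtain ⟨r, hr1, hr2, hr3⟩ := exists_between_le_two_mul (by linarith : 0 < q₁ + q₂) b3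
  have hexp : Real.exp a ≤ 3 :=
    (Real.exp_le_exp.2 ha1).trans (by linarith [Real.exp_one_lt_d9])
  have hexp3 : Real.exp (3 * a) ≤ 27 := by
    have : Real.exp (3 * a) = Real.exp a ^ 3 := by rw [← Real.exp_nat_mul]; norm_num
    rw [this]
    calc Real.exp a ^ 3 ≤ 3 ^ 3 := pow_le_pow_left₀ (Real.exp_pos _).le hexp 3
      _ = 27 := by norm_num
  have d1 : q₁ ≤ 3 * (ξ + 1) ^ 2 * (A - 1) / (C₂ * ν ^ 2 * (1 - η)) * s₂ := by
    calc q₁ ≤ 3 * 1 * ((ξ + 1) ^ 2 * (A - 1) / (C₂ * ν ^ 2 * (1 - η)) * s₂) := by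
          rw [hq₁]; gcongr; linarith
      _ = _ := by ring
  have d2 : q₂ ≤ 27 * CH / (θ * C₂ * (A - 1)) * s₁ := by
    calc q₂ ≤ 27 / (θ * C₂) * (CH * s₁ * l₂) / ((A - 1) * l₂) := by
          rw [hq₂]
          have : H ≤ CH * s₁ * l₂ := hH'.trans (by gcongr)
          gcongr
      _ = _ := by field_simp
  refine ⟨r, by linarith, by linarith, hr2.trans ?_, ?_⟩
  · have f1 : 0 ≤ 3 * (ξ + 1) ^ 2 * (A - 1) / (C₂ * ν ^ 2 * (1 - η)) * s₁ := by positivity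
    have f2 : 0 ≤ 27 * CH / (θ * C₂ * (A - 1)) * s₂ := by positivity
    linarith
  · rw [e1, e2, ← mul_add]
    exact mul_lt_mul_of_pos_left hr1 (by positivity)

end Arithmetic

/-! ### Estimators on a regular sample and the resulting constant. -/

section Assembly

/-- The radius of localization of the calibrated estimator, relative to `|S_γ| λ̃₁`. -/
noncomputable def calConst (c : Constants) : ℝ :=
  8 * c.A₁ ^ 2 / ((c.A₁ - 1) * c.ν₁ ^ 2) + 2 * (c.ξ₁ + 1) ^ 2 / c.ν₁ ^ 2

/-- The size of the residual form at the calibrated estimator, relative to `|S_γ| λ̃₁²`. -/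
noncomputable def residConst (c : Constants) : ℝ :=
  c.σ₀ ^ 2 * (21 / 5 * c.A₁ + 7 / 2) * calConst c

/-- The radius of localization of the weighted likelihood estimator, relative to
`|S_γ| λ̃₁ + |S_α| λ̃₂`. -/
noncomputable def wlConst (c : Constants) : ℝ :=
  2 * (3 * (c.ξ₂ + 1) ^ 2 * (c.A₂ - 1) / (c.C₂ * c.ν₂ ^ 2 * (1 - c.η₂)) +
    27 * residConst c / (c.ξ₂₁ * c.C₂ * (c.A₂ - 1)))

/-- The mean squared change of the estimating function, relative to
`(K - 1) (|S_γ| λ̃₁ + |S_α| λ̃₂)²`. -/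
noncomputable def varConst (c : Constants) : ℝ :=
  18 * (c.B₀ * calConst c) ^ 2 * c.B₁ * (c.σ₀ ^ 2 * (c.B₁ + 18 * (c.B₀ ^ 2 * c.B₁))) +
    450 * (c.C₁ * c.B₁ * (c.B₀ * wlConst c)) ^ 2

theorem M₁_eq {c : Constants} {e₁ e₂ : ℝ} (he₁ : e₁ < 1) (he₂ : e₂ < 1) :
    c.M₁ e₁ e₂ = ((c.ξ₁ + 1) * (c.A₁ - 1)) ^ 2 / (c.ν₁ ^ 2 * (1 - e₁) * (1 - e₂)) := by
  rw [Constants.M₁, Constants.ξ₁₁, Constants.ν₁₁, mul_pow (c.ν₁ * _), mul_pow c.ν₁,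
    Real.sq_sqrt (by linarith), Real.sq_sqrt (by linarith)]

variable {p K n : ℕ} {t : Fin K} {𝒳 Ω₀ : Type*} [MeasurableSpace 𝒳] [MeasurableSpace Ω₀]
  {P : Measure Ω₀} [IsProbabilityMeasure P]
  {f : Fin (p + 1) → 𝒳 → ℝ} {ψ : ℝ → ℝ} {γ α : Coef p K t} {ε η₁₁ η₁₂ : ℝ} {c : Constants}
  {o : Fin n → Obs K 𝒳}

omit [MeasurableSpace 𝒳] [IsProbabilityMeasure P] in
/-- Localization of the regularized calibrated estimator on a regular sample. -/
theorem IsRegularSample.exists_calRadius {Z : Ω₀ → Obs K 𝒳} {l₂ : ℝ}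
    (hs : IsRegularSample c (c.lam₁ K p n ε) l₂ P Z ψ f γ α o)
    (hPS : AssumptionPS c η₁₁ η₁₂ n ε P Z f γ) (hA : (c.ξ₁ + 1) / (c.ξ₁ - 1) < c.A₁)
    (hl : 0 < c.lam₁ K p n ε) :
    ∃ r, 0 < r ∧ c.B₀ * r ≤ 1 ∧ c.B₀ * r ≤ c.η₁₃ η₁₁ η₁₂ ∧ 0 ≤ c.M₁₁ η₁₁ η₁₂ ∧
      r ≤ calConst c * ((support γ).card * c.lam₁ K p n ε) ∧
      (∃ γ', IsRCAL f (c.A₁ * c.lam₁ K p n ε) o γ' (t := t)) ∧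
      ∀ γ', IsRCAL f (c.A₁ * c.lam₁ K p n ε) o γ' → norm21 (γ' - γ) ≤ r ∧
        ∀ H, H ≤ c.σ₀ ^ 2 * (7 / 10 * gramForm o f γ (γ' - γ) +
            7 / 2 * (c.lam₁ K p n ε * r ^ 2)) →
          H ≤ 3 / 2 * c.M₁₁ η₁₁ η₁₂ * ((support γ).card * c.lam₁ K p n ε) * c.lam₁ K p n ε ∧
          H ≤ residConst c * ((support γ).card * c.lam₁ K p n ε) * c.lam₁ K p n ε := by
  obtain ⟨hA1, hAξ⟩ := one_lt_and_two_mul_lt_of_div_lt hPS.one_lt_ξ₁ hA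
  have hB₀1 := hPS.one_le_B₀
  have hB₀ : 0 ≤ c.B₀ := by linarith
  have hν := hPS.ν₁_pos
  obtain ⟨he₁0, he₁⟩ := hPS.η₁₁_mem
  obtain ⟨he₂0, he₂⟩ := hPS.η₁₂_mem
  have hM := M₁_eq (c := c) he₁ he₂
  have ha := hPS.sparse_a
  have hb := hPS.sparse_b
  have hη := hPS.card_le_η₁
  set l := c.lam₁ K p n ε with hldef
  have hS : (0 : ℝ) < (support γ).card := zero_lt_one.trans_le (one_le_card_support γ)
  set S : ℝ := ((support γ).card : ℝ) with hSdef
  set s := S * l with hsdef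
  have hs0 : 0 < s := mul_pos hS hl
  set r := calRadius c.A₁ c.ξ₁ c.ν₁ s with hr
  have ha' : (c.ξ₁ + 1) ^ 2 * s / c.ν₁ ^ 2 ≤ η₁₁ := by
    refine le_of_eq_of_le ?_ ha
    rw [hsdef]; ring
  have hb' : c.B₀ * (c.ξ₁ + 1) ^ 2 * (c.A₁ - 1) / (1 - η₁₁) / c.ν₁ ^ 2 * s ≤ η₁₂ := by
    refine le_of_eq_of_le ?_ hb
    rw [hsdef]; ring
  have ha1 := ha'.trans_lt he₁
  have hr0 : 0 < r := calRadius_pos hA1 hν hs0 ha1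
  have hBr := mul_calRadius_le hA1 hAξ hν hs0 he₁ ha' hB₀ hb'
  have hrC := calRadius_le_mul hA1 hν hs0 hB₀1 ha1 (hBr.trans he₂.le)
  have hrD := calRadius_le_div hA1 hAξ hν hs0 he₁ ha'
  rw [← hr] at hBr hrC hrD
  change r ≤ calConst c * s at hrC
  have h1A : 0 < c.A₁ - 1 := by linarith
  have h1e₁ : 0 < 1 - η₁₁ := by linarith
  have h1e₂ : 0 < 1 - η₁₂ := by linarith
  have hξ := hPS.one_lt_ξ₁
  have hM0 : 0 ≤ c.M₁ η₁₁ η₁₂ := by rw [hM]; positivity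
  have hrM : r ≤ c.M₁ η₁₁ η₁₂ / (c.A₁ - 1) * s := by
    refine hrD.trans ?_
    rw [hM]
    calc (c.ξ₁ + 1) ^ 2 * (c.A₁ - 1) * s / (c.ν₁ ^ 2 * (1 - η₁₁)) =
        ((c.ξ₁ + 1) * (c.A₁ - 1)) ^ 2 / (c.ν₁ ^ 2 * (1 - η₁₁) * 1) / (c.A₁ - 1) * s := by
          field_simp
      _ ≤ _ := by gcongr; linarith
  have hM11 : 0 ≤ c.M₁₁ η₁₁ η₁₂ := by
    have : 0 ≤ c.η₁ := hs0.le.trans hη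
    rw [Constants.M₁₁]; positivity
  have hBr13 : c.B₀ * r ≤ c.η₁₃ η₁₁ η₁₂ := by
    calc c.B₀ * r ≤ c.B₀ * (c.M₁ η₁₁ η₁₂ / (c.A₁ - 1) * c.η₁) := by
          refine mul_le_mul_of_nonneg_left (hrM.trans ?_) hB₀
          exact mul_le_mul_of_nonneg_left hη (by positivity)
      _ = _ := by rw [Constants.η₁₃]; ring
  have hη13 : 0 ≤ c.η₁₃ η₁₁ η₁₂ := (mul_nonneg hB₀ hr0.le).trans hBr13
  set a := (c.ξ₁ + 1) ^ 2 * s / c.ν₁ ^ 2 with hadef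
  have h1a : 0 < 1 - a := by linarith
  have hcone := hs.le_gramForm (a := a) hl.le hPS.compatibility (by
    have : a * c.ν₁ ^ 2 = (c.ξ₁ + 1) ^ 2 * s := by rw [hadef]; field_simp
    rw [this]
    have h2 : 0 ≤ (c.ξ₁ + 1) ^ 2 * s := by positivity
    have h3 : S * (l / 2) * (1 + c.ξ₁) ^ 2 = (c.ξ₁ + 1) ^ 2 * s / 2 := by rw [hsdef]; ring
    rw [h3]; linarith)
  rw [← hSdef] at hcone
  have hκ : 0 < c.ν₁ ^ 2 * (1 - a) / S := by positivity
  obtain ⟨hex, hall⟩ := isRCAL_localization hB₀ hs.bounded hs.calScore_le hl hA1 hAξ hκ hcone hr0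
    (hBr.trans he₂.le) (by
      -- The radius is defined by `(A₁ - 1) κ r = 4A₁² λ̃₁`; localization requires strictly more
      -- than `3A₁² λ̃₁`.
      have : (c.A₁ - 1) * (c.ν₁ ^ 2 * (1 - a) / S) * r = 4 * c.A₁ ^ 2 * l := by
        rw [hr, calRadius, ← hadef, hsdef]; field_simp
      rw [this]
      have : 0 < c.A₁ ^ 2 * l := by positivity
      linarith)
  refine ⟨r, hr0, hBr.trans he₂.le, hBr13, hM11, hrC, hex, fun γ' hγ' => ?_⟩
  obtain ⟨h1, h2, h3⟩ := hall γ' hγ'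
  refine ⟨h1, fun H hH => ⟨?_, ?_⟩⟩
  · have h4 := gram_le_of_mul_sq_le hA1 hAξ hν hS (gramForm_nonneg o f γ (γ' - γ)) hl hsdef he₁ he₂
      he₂0.le ha' hBr h3
    rw [← hM] at h4
    exact le_of_le_gram_add hl.le hr0.le hs0.le hM0 (Real.one_le_exp hη13) hη hrM h4 hH
  · exact le_of_le_gram_add' hl.le (by linarith) hr0.le (by nlinarith) hrC h2 hH

variable {Ypot : Fin K → Ω₀ → ℝ} {T : Ω₀ → Fin K} {X : Ω₀ → 𝒳}

/-- Localization of the regularized weighted likelihood estimator on a regular sample. -/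
theorem IsRegularSample.exists_wlRadius (hK : 2 ≤ K) (hψ : Differentiable ℝ ψ)
    (hs : IsRegularSample c (c.lam₁ K p n ε) (c.lam₂ K p n ε) P (observed Ypot T X) ψ f γ α o)
    (hB₀ : 0 ≤ c.B₀) (hl : 0 < c.lam₁ K p n ε)
    (hOR : AssumptionOR c η₁₁ η₁₂ n ε P Ypot T X ψ f γ α)
    (hA : (c.ξ₂ + 1) / (c.ξ₂ - 1) < c.A₂) (hres : 0 ≤ residConst c) {r : ℝ} (hr : c.B₀ * r ≤ 1)
    (hr' : c.B₀ * r ≤ c.η₁₃ η₁₁ η₁₂) (hM : 0 ≤ c.M₁₁ η₁₁ η₁₂) {d : Coef p K t}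
    (hd : norm21 d ≤ r)
    (hH : residualForm ψ o f γ α d ≤
      3 / 2 * c.M₁₁ η₁₁ η₁₂ * ((support γ).card * c.lam₁ K p n ε) * c.lam₁ K p n ε)
    (hH' : residualForm ψ o f γ α d ≤
      residConst c * ((support γ).card * c.lam₁ K p n ε) * c.lam₁ K p n ε) :
    ∃ r₂, 0 < r₂ ∧ c.C₃ * (c.B₀ * r₂) ≤ 3 / 2 ∧
      r₂ ≤ wlConst c * ((support γ).card * c.lam₁ K p n ε +
        (support α).card * c.lam₂ K p n ε) ∧
      (∃ α', IsRWL ψ f (c.A₂ * c.lam₂ K p n ε) o (γ + d) α') ∧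
      ∀ α', IsRWL ψ f (c.A₂ * c.lam₂ K p n ε) o (γ + d) α' → norm21 (α' - α) ≤ r₂ := by
  have hl₁₂ : c.lam₁ K p n ε ≤ c.lam₂ K p n ε := le_max_left _ _
  have hl₂ : 0 < c.lam₂ K p n ε := hl.trans_le hl₁₂
  have hSγ : (0 : ℝ) < (support γ).card := zero_lt_one.trans_le (one_le_card_support γ)
  have hSα : (0 : ℝ) < (support α).card := zero_lt_one.trans_le (one_le_card_support α)
  have ha := hOR.sparse_a
  have hb := hOR.sparse_b
  have hc := hOR.sparse_c
  rw [mul_assoc _ _ (c.lam₁ K p n ε)] at hc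
  obtain ⟨hA1, hAξ⟩ := one_lt_and_two_mul_lt_of_div_lt hOR.one_lt_ξ₂ hA
  have h1A : 0 < c.A₂ - 1 := by linarith
  have hξ := hOR.one_lt_ξ₂
  have hξ0 : 0 < c.ξ₂ := by linarith
  have hθ0 : 0 < c.ξ₂₁ := by
    rw [Constants.ξ₂₁, sub_pos, div_lt_one (by positivity)]
    exact hAξ
  obtain ⟨-, hη₂⟩ := hOR.η₂_mem
  have h1η : 0 < 1 - c.η₂ := by linarith
  have hν₂ := hOR.ν₂_pos
  obtain ⟨r₂, hr₂0, hr₂B, hr₂C, hr₂A⟩ := le_wlRadius_bound (θ := c.ξ₂₁) hA1 hξ0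
    hν₂ hOR.C₂_pos hOR.C₃_nonneg hB₀ rfl hθ0 hη₂ hSα hl hl₁₂ rfl
    (mul_pos hSγ hl).le hr' hr (residualForm_nonneg ψ o f γ α d) hM hH hH' hres hb hc
    hOR.η₂₁_mem.2 hOR.η₂₂_mem.2
  refine ⟨r₂, hr₂0, hr₂B, hr₂C, ?_⟩
  refine isRWL_localization hψ (hOR.monotone hK hψ) hs.bounded hOR.C₂_pos hOR.C₃_nonneg
    hOR.deriv_growth (mul_le_mul_of_nonneg_left hd hB₀) hs.le_deriv
    hs.wlScore_le hl₂ hA1 hξ0 rfl hθ0 (by positivity) ?_ hr₂0 hr₂B hr₂A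
  refine hs.le_gramForm hl.le hOR.compatibility ?_
  rw [div_mul_eq_mul_div, div_mul_eq_mul_div, div_le_iff₀ (by positivity)] at ha
  refine le_trans ?_ ha
  -- The level `λ̃₁/2` of the Gram error turns `(1 + ξ₂)²` into at most `1 + ξ₂²`, the constant in
  -- the sparsity condition.
  calc _ = (support α).card * c.lam₁ K p n ε * ((1 + c.ξ₂) ^ 2 / 2) := by ring
    _ ≤ (support α).card * c.lam₂ K p n ε * (1 + c.ξ₂ ^ 2) := by
      gcongr
      nlinarith [sq_nonneg (1 - c.ξ₂)]
    _ = _ := by ring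

/-- The mean squared change of the estimating function on a regular sample. -/
theorem IsRegularSample.sampleMean_phi_sub_sq_le (hK : 2 ≤ K) (hn : 1 ≤ n) (hε : 0 < ε)
    (hε1 : ε < 1) (hC : CausalAssumptions P Ypot T X)
    (hZ : AEMeasurable (observed Ypot T X) P) (hf : ∀ j, Measurable (f j))
    (hf0 : ∀ x, f 0 x = 1) (hψ : Differentiable ℝ ψ)
    (hPS : AssumptionPS c η₁₁ η₁₂ n ε P (observed Ypot T X) f γ)
    (hOR : AssumptionOR c η₁₁ η₁₂ n ε P Ypot T X ψ f γ α)
    (hA₁ : (c.ξ₁ + 1) / (c.ξ₁ - 1) < c.A₁) (hA₂ : (c.ξ₂ + 1) / (c.ξ₂ - 1) < c.A₂)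
    (hρ : Constants.rate K p n ε ≤ 1)
    (hs : IsRegularSample c (c.lam₁ K p n ε) (c.lam₂ K p n ε) P (observed Ypot T X) ψ f γ α o)
    {γ' α' : Coef p K t}
    (hγ' : (∃ γ', IsRCAL f (c.A₁ * c.lam₁ K p n ε) o γ' (t := t)) →
      IsRCAL f (c.A₁ * c.lam₁ K p n ε) o γ')
    (hα' : (∃ α', IsRWL ψ f (c.A₂ * c.lam₂ K p n ε) o γ' α') →
      IsRWL ψ f (c.A₂ * c.lam₂ K p n ε) o γ' α') :
    sampleMean o (fun z => (phi ψ f α' γ' z - phi ψ f α γ z) ^ 2) ≤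
      varConst c * ((K : ℝ) - 1) * ((support γ).card * c.lam₁ K p n ε +
        (support α).card * c.lam₂ K p n ε) ^ 2 := by
  have hB₀1 := hPS.one_le_B₀
  have hB₀ : 0 < c.B₀ := by linarith
  have hB₁ := hPS.one_lt_B₁
  have hB := hPS.ae_bounded hf0
  have hodds := hPS.ae_odds
  have hm := hOR.monotone hK hψ
  have hρ0 := rate_pos p hK hn hε hε1
  have hl₁ : 0 < c.lam₁ K p n ε := by rw [Constants.lam₁]; positivity
  have hl₁₂ : c.lam₁ K p n ε ≤ c.lam₂ K p n ε := le_max_left _ _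
  -- A rate of at most `1` makes `λ̃₁` bounded by constants, so `B₁ + 3λ̃₁` does not grow with the
  -- problem.
  have hl₁b : c.lam₁ K p n ε ≤ 6 * (c.B₀ ^ 2 * c.B₁) := by
    have h2 : √(2 : ℝ) ≤ 3 / 2 := by
      rw [Real.sqrt_le_left (by norm_num)]; norm_num
    rw [Constants.lam₁]
    calc 4 * √2 * c.B₀ ^ 2 * c.B₁ * Constants.rate K p n ε
        ≤ 4 * (3 / 2) * c.B₀ ^ 2 * c.B₁ * 1 := by gcongr
      _ = _ := by ring
  obtain ⟨r₁, hr₁0, hBr₁, hBr₁e, hM, hr₁C, hex, hall⟩ := hs.exists_calRadius hPS hA₁ hl₁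
  obtain ⟨hd, hH⟩ := hall γ' (hγ' hex)
  obtain ⟨hHM, hHC⟩ := hH _ (hs.residualForm_le hl₁.le (popResidualForm_le hC hZ hOR.σ₀_pos hB₀ hB₁
    hψ.continuous.measurable hf hB hodds hOR.subGaussian (γ' - γ)) hd)
  have hW := hs.sampleMean_resid_le hK hC hOR.σ₀_pos hψ.continuous.measurable hf hf0 hB hodds
    hOR.subGaussian
  obtain ⟨hA11, -⟩ := one_lt_and_two_mul_lt_of_div_lt hPS.one_lt_ξ₁ hA₁
  have h1A₁ : 0 < c.A₁ - 1 := by linarith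
  have hcal0 : 0 ≤ calConst c := by unfold calConst; positivity
  have hres0 : 0 ≤ residConst c := by unfold residConst; positivity
  obtain ⟨r₂, hr₂0, hr₂B, hr₂C, hex₂, hall₂⟩ := hs.exists_wlRadius hK hψ hB₀.le hl₁ hOR hA₂ hres0
    hBr₁ hBr₁e hM hd hHM hHC
  rw [add_sub_cancel] at hex₂ hall₂
  have hb := hall₂ α' (hα' hex₂)
  have hC₁ := hOR.C₁_pos
  have hSγ : (0 : ℝ) < (support γ).card := zero_lt_one.trans_le (one_le_card_support γ)
  have hSα : (0 : ℝ) < (support α).card := zero_lt_one.trans_le (one_le_card_support α)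
  have hl₂ : 0 < c.lam₂ K p n ε := hl₁.trans_le hl₁₂
  clear hall₂ hex₂ hall hH hex hα' hγ' hHM hHC
  have hs1 := (le_add_iff_nonneg_right ((support γ).card * c.lam₁ K p n ε)).2 (mul_pos hSα hl₂).le
  have hs0 := add_pos (mul_pos hSγ hl₁) (mul_pos hSα hl₂)
  have hr₁s := hr₁C.trans (mul_le_mul_of_nonneg_left hs1 hcal0)
  generalize (support γ).card * c.lam₁ K p n ε + (support α).card * c.lam₂ K p n ε = s at *
  have hK2 : (1 : ℝ) ≤ (K : ℝ) - 1 := by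
    have : (2 : ℝ) ≤ K := by exact_mod_cast hK
    linarith
  calc sampleMean o (fun z => (phi ψ f α' γ' z - phi ψ f α γ z) ^ 2)
      ≤ sampleMean o (fun z => 18 * (c.B₀ * r₁) ^ 2 * c.B₁ *
          (∑ k, oddsWeight f γ k z * outcomeResid ψ f α k z ^ 2) +
          450 * (c.C₁ * c.B₁ * (c.B₀ * r₂)) ^ 2) := by
        refine sampleMean_mono fun i => ?_
        have h := phi_sub_sq_le hψ hm hC₁.le hOR.C₃_nonneg hOR.deriv_growth
          (hs.bounded i) (hs.odds i) (hs.deriv_le i) hd hb hBr₁ hr₂B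
        rwa [add_sub_cancel, add_sub_cancel] at h
    _ = 18 * (c.B₀ * r₁) ^ 2 * c.B₁ *
          sampleMean o (fun z => ∑ k, oddsWeight f γ k z * outcomeResid ψ f α k z ^ 2) +
          450 * (c.C₁ * c.B₁ * (c.B₀ * r₂)) ^ 2 := by
        rw [sampleMean_add, sampleMean_const_mul, sampleMean_const hn]
    _ ≤ 18 * (c.B₀ * (calConst c * s)) ^ 2 * c.B₁ *
          (((K : ℝ) - 1) * (c.σ₀ ^ 2 * (c.B₁ + 18 * (c.B₀ ^ 2 * c.B₁)))) +
          450 * (c.C₁ * c.B₁ * (c.B₀ * (wlConst c * s))) ^ 2 * ((K : ℝ) - 1) := by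
        refine add_le_add ?_ ?_
        · refine mul_le_mul (by gcongr) (hW.trans ?_)
            (sampleMean_nonneg fun i => Finset.sum_nonneg fun k _ =>
              mul_nonneg (oddsWeight_nonneg _ _ _ _) (sq_nonneg _)) (by positivity)
          have : c.B₁ + 3 * c.lam₁ K p n ε ≤ c.B₁ + 18 * (c.B₀ ^ 2 * c.B₁) := by linarith
          gcongr
        -- The regression part has no factor `K - 1`; one is inserted since `K - 1 ≥ 1`.
        · refine le_trans ?_ (le_mul_of_one_le_right (by positivity) hK2)
          gcongr
    _ = _ := by rw [varConst]; ring

end Assembly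

/-! ### The variance bound. -/

theorem mainTheorem8 (c : Constants) :
    ∃ M₃₄ : ℝ, 0 < M₃₄ ∧
      ∀ (η₁₁ η₁₂ : ℝ) (K p n : ℕ) (t : Fin K) (ε : ℝ) (M₃ : ℝ)
        (𝒳 : Type*) [MeasurableSpace 𝒳]
        (Ω₀ : Type*) [MeasurableSpace Ω₀] (P : Measure Ω₀) [IsProbabilityMeasure P]
        (Ypot : Fin K → Ω₀ → ℝ) (T : Ω₀ → Fin K) (X : Ω₀ → 𝒳)
        (Ω : Type*) [MeasurableSpace Ω] (μ : Measure Ω) [IsProbabilityMeasure μ]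
        (O : Fin n → Ω → Obs K 𝒳)
        (f : Fin (p + 1) → 𝒳 → ℝ) (ψ : ℝ → ℝ) (γbar αbar : Coef p K t)
        (γhat αhat : Ω → Coef p K t),
        2 ≤ K → 1 ≤ n → 0 < ε → ε < 1 →
        CausalAssumptions P Ypot T X →
        (∀ j, Measurable (f j)) → (∀ x, f 0 x = 1) → Differentiable ℝ ψ →
        iIndepFun O μ → (∀ i, IdentDistrib (O i) (observed Ypot T X) μ P) →
        IsTargetCAL P (observed Ypot T X) f γbar →
        IsTargetWL P (observed Ypot T X) ψ f γbar αbar →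
        (∀ ω, (∃ γ : Coef p K t, IsRCAL f (c.A₁ * c.lam₁ K p n ε) (fun i => O i ω) γ) →
          IsRCAL f (c.A₁ * c.lam₁ K p n ε) (fun i => O i ω) (γhat ω)) →
        (∀ ω, (∃ α, IsRWL ψ f (c.A₂ * c.lam₂ K p n ε) (fun i => O i ω) (γhat ω) α) →
          IsRWL ψ f (c.A₂ * c.lam₂ K p n ε) (fun i => O i ω) (γhat ω) (αhat ω)) →
        AssumptionPS c η₁₁ η₁₂ n ε P (observed Ypot T X) f γbar →
        AssumptionOR c η₁₁ η₁₂ n ε P Ypot T X ψ f γbar αbar →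
        (c.ξ₁ + 1) / (c.ξ₁ - 1) < c.A₁ → (c.ξ₂ + 1) / (c.ξ₂ - 1) < c.A₂ →
        (((K : ℝ) - 1) + Real.log (((p : ℝ) + 1) / ε)) / n ≤ 1 →
        let l₁ := c.lam₁ K p n ε
        let l₂ := c.lam₂ K p n ε
        let sγ : ℝ := (support γbar).card
        let sα : ℝ := (support αbar).card
        let η₁₃ := c.η₁₃ η₁₁ η₁₂
        Real.exp (4 * η₁₃) / c.ξ₂₃ ^ 2 * (c.M₁₁ η₁₁ η₁₂ * sγ * l₁ ^ 2) +
            Real.exp (2 * η₁₃) * c.ξ₂₂ ^ 2 * (sα * l₂ ^ 2 / c.ν₂₂ ^ 2) ≤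
          Real.exp η₁₃ * M₃ * (sγ * l₁ * l₂ + sα * l₂ ^ 2) →
        let s := sγ * l₁ + sα * l₂
        let η₃ := (c.A₂ - 1)⁻¹ * M₃ * s
        let D := ((K : ℝ) - 1) + Lambda P (observed Ypot T X) ψ f γbar αbar η₃ ^ 2
        ∃ E : Set Ω, MeasurableSet E ∧ 1 - 9 * ε ≤ μ.real E ∧ ∀ ω ∈ E,
          let o : Fin n → Obs K 𝒳 := fun i => O i ω
          let φhat := phiCentered ψ f o (αhat ω) (γhat ω)
          let φbar := phiCentered ψ f o αbar γbar
          |sampleMean o (fun z => φhat z ^ 2 - φbar z ^ 2)| ≤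
            2 * √M₃₄ * √(sampleMean o (fun z => φbar z ^ 2)) * √D * s +
              M₃₄ * D * s ^ 2 := by
  -- The constant is chosen before any assumption on `c`, so the sign of `varConst c` is not yet
  -- known; this choice is positive regardless.
  refine ⟨1 + |varConst c|, by positivity, ?_⟩
  intro η₁₁ η₁₂ K p n t ε M₃ 𝒳 _ Ω₀ _ P _ Ypot T X Ω _ μ _ O f ψ γbar αbar γhat αhat hK hn hε hε1
    hC hf hf0 hψ hind hid hγ hα hγhat hαhat hPS hOR hA₁ hA₂ hrate l₁ l₂ sγ sα η₁₃ _ s η₃ D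
  obtain ⟨E, hE, hE1, hE2⟩ := exists_event_isRegularSample hK hn hε hε1 hC hf hf0 hψ hind hid hγ hα
    hPS hOR hrate
  refine ⟨E, hE, hE1, fun ω hω => ?_⟩
  intro o φhat φbar
  have hV := (hE2 ω hω).sampleMean_phi_sub_sq_le hK hn hε hε1 hC
    (hid ⟨0, hn⟩).aemeasurable_snd hf hf0 hψ hPS hOR hA₁ hA₂ (rate_le_one hrate)
    (hγhat ω) (hαhat ω)
  have hK2 : (1 : ℝ) ≤ (K : ℝ) - 1 := by
    have : (2 : ℝ) ≤ K := by exact_mod_cast hK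
    linarith
  have hρ0 := rate_pos p hK hn hε hε1
  have hB₁ := hPS.one_lt_B₁
  have hl₁ : 0 ≤ l₁ := by simp only [l₁, Constants.lam₁]; positivity
  have hl₂ : 0 ≤ l₂ := hl₁.trans (le_max_left _ _)
  have hs0 : 0 ≤ s := by positivity
  -- The mean squared change is already controlled with `K - 1`; of `Λ²` only nonnegativity is
  -- needed.
  have hD : (K : ℝ) - 1 ≤ D := le_add_of_nonneg_right (sq_nonneg _)
  have hD0 : 0 ≤ D := by linarith
  have hV' : sampleMean o (fun z => (phi ψ f (αhat ω) (γhat ω) z - phi ψ f αbar γbar z) ^ 2) ≤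
      (1 + |varConst c|) * D * s ^ 2 := by
    refine hV.trans ?_
    change varConst c * ((K : ℝ) - 1) * s ^ 2 ≤ _
    have : varConst c ≤ 1 + |varConst c| := by linarith [le_abs_self (varConst c)]
    gcongr
  refine (abs_sampleMean_sq_sub_sq_le hn ψ f o αbar γbar (αhat ω) (γhat ω) hV').trans
    (le_of_eq ?_)
  rw [Real.sqrt_mul (by positivity), Real.sqrt_mul (by positivity), Real.sqrt_sq hs0]
  ring
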